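/- **Conventions.** All registers consist of qubits, $|A|$ is the dimension of $\mathcal H_A$, $\tau^A=\mathbb 1/|A|$, $\phi^{+AA'}$ is the maximally entangled state, $\langle\sigma\rangle(X)=\operatorname{Tr}(X)\,\sigma$, and $\|L\|_\diamond=\max_\rho\|(L\otimes\mathrm{id})(\rho)\|_1$ over density matrices $\rho$ on two copies of the input space. A function $\varepsilon$ is negligible if for every (eventually positive) polynomial $p$, $\varepsilon(n)<1/p(n)$ for all large $n$. A *public-key quantum encryption scheme* consists of uniform polynomial-time (randomized classical, quantum, quantum) circuit families $\mathsf{KeyGen}$, with output $k=(pk,sk)$, $\mathsf{Enc}_k=\mathsf{Enc}_{pk}$, from a plaintext register $M$ of at least one qubit to a ciphertext register $C$, and $\mathsf{Dec}_k=\mathsf{Dec}_{sk}$, from $C$ to $M\oplus\bot$, such that $|M|\le|C|\le 2^{\mathrm{poly}(n)}$ and $\|\mathsf{Dec}_k\circ\mathsf{Enc}_k-\mathrm{id}\|_\diamond$ is at most a negligible function of $n$ for all keys $k$ that $\mathsf{KeyGen}$ can output. (A symmetric-key scheme is the case $pk=sk$.) An *attack* is an arbitrary channel $\Lambda$ from $CB$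 to $C\hat B$, for arbitrary registers $B,\hat B$. Its *effective map* is $\tilde\Lambda=\mathbb E_k[\mathsf{Dec}_k\circ\Lambda\circ\mathsf{Enc}_k]$. For $\alpha>1$ and maps $\Lambda_1,\Lambda_2$ from $B$ to $\hat B$ let $$\mathrm{Sim}_\alpha(\Lambda_1,\Lambda_2)=\mathrm{id}\otimes\Lambda_1+\tfrac1{\alpha-1}\bigl(\alpha\langle \mathbb E_k\mathsf{Dec}_k(\tau^C)\rangle-\mathrm{id}\bigr)\otimes\Lambda_2 .$$ * The scheme is **PNM** if there is a negligible $\varepsilon$ such that for all $n$ and all attacks there are completely positive trace-non-increasing $\Lambda_1,\Lambda_2$ whose sum is trace preserving with $\|\tilde\Lambda-\mathrm{Sim}_{|M|^2}(\Lambda_1,\Lambda_2)\|_\diamond\le\varepsilon(n)$. * It is **NM** if there is a negligible $\varepsilon$ such that for all $n$ and all attacks $\|\tilde\Lambda-\mathrm{Sim}_{|C|^2}(\Lambda_1,\Lambda_2)\|_\diamond\le\varepsilon(n)$ for $\Lambda_1=\operatorname{Tr}_{CC'}[\phi^{+CC'}\Lambda(\phi^{+CC'}\otimes\cdot)]$ and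 $\Lambda_2=\operatorname{Tr}_{CC'}[(\mathbb 1-\phi^{+CC'})\Lambda(\phi^{+CC'}\otimes\cdot)]$. * A *canonical form* of the scheme consists, for every key $k$, of a unitary $V_k$ from $MT$ to $C$, a state $\sigma_k$ and an orthogonal projector $P_k$ on $T$, a probability distribution $p_k$ on $r\in\{0,1\}^{\log|T|}$ and unit vectors $|\psi_{k,r}\rangle\in\mathcal H_T$ such that, up to a negligible error in diamond (trace) norm, for all keys that $\mathsf{KeyGen}$ can output: $\mathsf{Enc}_k$ is $V_k(\cdot\otimes\sigma_k)V_k^\dagger$ and is also $\sum_r p_k(r)\,\mathsf{Enc}_{k;r}$ with $\mathsf{Enc}_{k;r}=V_k(\cdot\otimes|\psi_{k,r}\rangle\langle\psi_{k,r}|)V_k^\dagger$; $P_k\sigma_kP_k$ is $\sigma_k$; and $\mathsf{Dec}_k(V_kP_kV_k^\dagger(\cdot)V_kP_kV_k^\dagger)$ is $\operatorname{Tr}_T[P_kV_k^\dagger(\cdot)V_kP_k]$. It is *efficient* if, given $k$, sampling $r$, preparing $\psi_{k,r}$, applying $V_k$ and $V_k^\dagger$, and measuring $\{P_k,\mathbb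 1-P_k\}$ are done by uniform polynomial-time circuit families. * The scheme is **CiNM** with respect to a canonical form if there is a negligible $\varepsilon$ such that for all $n$ and all attacks $\|\tilde\Lambda-\mathrm{Sim}_{|C|^2}(\Lambda_1,\Lambda_2)\|_\diamond\le\varepsilon(n)$ for $\Lambda_1=\mathbb E_{k,r}\operatorname{Tr}_{CM'}[\psi_{k,r}^{CM'}\Lambda(\psi_{k,r}^{CM'}\otimes\cdot)]$ and $\Lambda_2=\mathbb E_{k,r}\operatorname{Tr}_{CM'}[(\mathbb 1-\psi_{k,r}^{CM'})\Lambda(\psi_{k,r}^{CM'}\otimes\cdot)]$, where $\psi_{k,r}^{CM'}=\mathsf{Enc}_{k;r}(\phi^{+MM'})$. **Theorem.** There are public-key quantum encryption schemes $\Pi'=(\mathsf{KeyGen},\mathsf{Enc}',\mathsf{Dec}')$ and $\Pi=(\mathsf{KeyGen},\mathsf{Enc},\mathsf{Dec})$ such that $\Pi'$ is NM and $\Pi$ arises from it by appending an unused qubit $R$: $\mathsf{Enc}_k=\mathsf{Enc}'_k\otimes|0\rangle\langle0|^R$ and $\mathsf{Dec}_k=\mathsf{Dec}'_k\circ\operatorname{Tr}_R$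 for all $k$; and such that 1. $\Pi$ is PNM; 2. $\Pi$ is not NM; 3. $\Pi$ has an efficient canonical form, and $\Pi$ is not CiNM with respect to any of its canonical forms; 4. the attack $\Lambda_X$ that applies the Pauli $X$ gate to $R$ and discards $B$ defeats both simulators: for all sufficiently large $n$ and every register $B$, its effective map has diamond distance greater than $1$ from the map $\mathrm{Sim}_{|C|^2}(\Lambda_1,\Lambda_2)$ in the definition of NM, and, for every canonical form, for all sufficiently large $n$ and every $B$, from the one in the definition of CiNM. -/

import Mathlib

open Matrix
open scoped Kronecker ComplexOrder

noncomputable section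

namespace QNM

/-! ### Operators, superoperators and norms -/

/-- Bit strings of length `n`: the computational basis of an `n`-qubit register. -/
abbrev Bits (n : ℕ) : Type := Fin n → Bool

/-- Linear operators on the Hilbert space with orthonormal basis `a`. -/
abbrev Op (a : Type) : Type := Matrix a a ℂ

/-- Linear maps from operators on `a` to operators on `b`. -/
abbrev SuperOp (a b : Type) : Type := Op a →ₗ[ℂ] Op b

section Basic

variable {a a' b b' r : Type} [Fintype a] [Fintype a'] [Fintype b] [Fintype b']
  [DecidableEq a] [DecidableEq a'] [DecidableEq b] [DecidableEq b']

/-- `L ⊗ id` on a bipartite space. -/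
def onLeft (L : SuperOp a b) (r : Type) : SuperOp (a × r) (b × r) where
  toFun X := of fun p q => L (of fun i j => X (i, p.2) (j, q.2)) p.1 q.1
  map_add' X Y := by
    ext p q
    exact congrFun (congrFun (L.map_add (of fun i j => X (i, p.2) (j, q.2))
      (of fun i j => Y (i, p.2) (j, q.2))) p.1) q.1
  map_smul' c X := by
    ext p q
    exact congrFun (congrFun (L.map_smul c (of fun i j => X (i, p.2) (j, q.2))) p.1) q.1

/-- `id ⊗ L` on a bipartite space. -/
def onRight (r : Type) (L : SuperOp a b) : SuperOp (r × a) (r × b) where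
  toFun X := of fun p q => L (of fun i j => X (p.1, i) (q.1, j)) p.2 q.2
  map_add' X Y := by
    ext p q
    exact congrFun (congrFun (L.map_add (of fun i j => X (p.1, i) (q.1, j))
      (of fun i j => Y (p.1, i) (q.1, j))) p.2) q.2
  map_smul' c X := by
    ext p q
    exact congrFun (congrFun (L.map_smul c (of fun i j => X (p.1, i) (q.1, j))) p.2) q.2

/-- The tensor product `L ⊗ N` of two superoperators. -/
def tensorMap (L : SuperOp a a') (N : SuperOp b b') : SuperOp (a × b) (a' × b') :=
  onLeft L b' ∘ₗ onRight a N

/-- Complete positivity. -/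
def IsCP (L : SuperOp a b) : Prop :=
  ∀ (r : ℕ) (X : Op (a × Fin r)), X.PosSemidef → (onLeft L (Fin r) X).PosSemidef

/-- Completely positive and trace preserving (a quantum channel). -/
def IsCPTP (L : SuperOp a b) : Prop :=
  IsCP L ∧ ∀ X : Op a, (L X).trace = X.trace

/-- Completely positive and trace non-increasing. -/
def IsCPTNI (L : SuperOp a b) : Prop :=
  IsCP L ∧ ∀ X : Op a, X.PosSemidef → (L X).trace.re ≤ X.trace.re

/-- Density matrices. -/
def IsDensity (ρ : Op a) : Prop := ρ.PosSemidef ∧ ρ.trace = 1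

/-- The trace norm `Tr √(X† X)`, the sum of the singular values of `X`. -/
def traceNorm (X : Op a) : ℝ :=
  ∑ i, Real.sqrt ((isHermitian_conjTranspose_mul_self X).eigenvalues i)

/-- The diamond norm `max_ρ ‖(L ⊗ id)(ρ)‖₁`, where `ρ` ranges over the density matrices on two
copies of the input space. -/
def diamondNorm (L : SuperOp a b) : ℝ :=
  sSup {x | ∃ ρ : Op (a × a), IsDensity ρ ∧ x = traceNorm (onLeft L a ρ)}

/-- `X ↦ V X V†`. -/
def conjMap (V : Matrix b a ℂ) : SuperOp a b where
  toFun X := V * X * Vᴴ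
  map_add' X Y := by rw [Matrix.mul_add, Matrix.add_mul]
  map_smul' c X := by simp

/-- The constant map `⟨σ⟩ : X ↦ Tr(X) σ`. -/
def constMap (a : Type) [Fintype a] (σ : Op b) : SuperOp a b where
  toFun X := X.trace • σ
  map_add' X Y := by rw [Matrix.trace_add, add_smul]
  map_smul' c X := by simp [Matrix.trace_smul, mul_smul]

/-- `X ↦ X ⊗ σ`. -/
def tensorState (a : Type) (σ : Op b) : SuperOp a (a × b) where
  toFun X := X ⊗ₖ σ
  map_add' X Y := Matrix.add_kronecker X Y σ
  map_smul' c X := Matrix.smul_kronecker c X σ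

/-- The partial trace over the second factor. -/
def traceRight (a b : Type) [Fintype b] : SuperOp (a × b) a where
  toFun X := of fun i j => ∑ k, X (i, k) (j, k)
  map_add' X Y := by ext i j; simp [Finset.sum_add_distrib]
  map_smul' c X := by ext i j; simp [Finset.mul_sum]

/-- The embedding of operators on `M` into operators on `M ⊕ ⊥`; `none` is the basis vector `⊥`.
It is the map denoted `id` from `M` to `M ⊕ ⊥`. -/
def embedBot (a : Type) : SuperOp a (Option a) where
  toFun X := of fun i j =>
    match i, j with
    | some i, some j => X i j
    | _, _ => 0
  map_add' X Y := by ext i j; cases i <;> cases j <;> simp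
  map_smul' c X := by ext i j; cases i <;> cases j <;> simp

/-- The pure state `|v⟩⟨v|`. -/
def ketbra (v : a → ℂ) : Op a := vecMulVec v (star v)

/-- The maximally mixed state `1 / |A|`. -/
def maxMixed (a : Type) [Fintype a] [DecidableEq a] : Op a := ((Fintype.card a : ℂ)⁻¹) • 1

/-- The maximally entangled state on two copies of `a`. -/
def maxEnt (a : Type) [Fintype a] [DecidableEq a] : Op (a × a) :=
  of fun p q => if p.1 = p.2 ∧ q.1 = q.2 then (Fintype.card a : ℂ)⁻¹ else 0

end Basic

/-- For an operator `S` on `C R`, the map `Y ↦ S ⊗ Y`, arranged as an operator on `(C B) R`. -/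
def attach {c b r : Type} (S : Op (c × r)) : SuperOp b ((c × b) × r) where
  toFun Y := of fun u v => S (u.1.1, u.2) (v.1.1, v.2) * Y u.1.2 v.1.2
  map_add' X Y := by ext u v; simp [mul_add]
  map_smul' k X := by ext u v; simp [mul_left_comm]

/-- For an operator `E` on `C R`, the map `Z ↦ Tr_{C R} [ E · Z ]` from operators on `(C B) R` to
operators on `B`. -/
def contract {c b r : Type} [Fintype c] [Fintype r] (E : Op (c × r)) :
    SuperOp ((c × b) × r) b where
  toFun Z := of fun s s' => ∑ p : c × r, ∑ q : c × r,
    E p q * Z ((q.1, s), q.2) ((p.1, s'), p.2)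
  map_add' X Y := by ext s s'; simp [mul_add, Finset.sum_add_distrib]
  map_smul' k X := by ext s s'; simp [Finset.mul_sum, mul_left_comm]

/-- For an attack `Λ` from `C B` to `C B'`, a state `S` and an operator `E` on `C R`, the map
`Y ↦ Tr_{C R} [ E · (Λ ⊗ id_R)(S ⊗ Y) ]` from `B` to `B'`. -/
def probe {c b b' r : Type} [Fintype c] [Fintype r]
    (Λ : SuperOp (c × b) (c × b')) (E S : Op (c × r)) : SuperOp b b' :=
  contract E ∘ₗ onLeft Λ r ∘ₗ attach S

/-- `ε ≤ negl(n)`: for every polynomial `p` (that is eventually positive), `ε(n) < 1 / p(n)` for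
all sufficiently large `n`. -/
def Negligible (ε : ℕ → ℝ) : Prop :=
  ∀ p : Polynomial ℝ, (∀ᶠ n : ℕ in Filter.atTop, 0 < p.eval (n : ℝ)) →
    ∀ᶠ n : ℕ in Filter.atTop, ε n < 1 / p.eval (n : ℝ)

/-! ### Uniform polynomial-time circuit families -/

/-- A list of numbers, written in unary with separators. -/
def unaryCode (l : List ℕ) : List Bool := l.flatMap fun k => List.replicate k true ++ [false]

/-- A family of objects is uniform polynomial-time if a Turing machine prints the description
`code (c n)` on input `1ⁿ` in time polynomial in `n`. -/
def IsUniform {α : Type} (code : α → List ℕ) (c : ℕ → α) : Prop :=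
  Nonempty (Turing.TM2ComputableInPolyTime Computability.unaryEncodeNat unaryCode
    fun n => code (c n))

/-- A randomized classical circuit on wires indexed by `ℕ`; the triple `(i, j, k)` is the gate that
overwrites wire `k` by the NAND of the wires `i` and `j`. -/
structure BoolCircuit where
  randomBits : ℕ
  gates : List (ℕ × ℕ × ℕ)

/-- The description of a classical circuit. -/
def BoolCircuit.code (c : BoolCircuit) : List ℕ :=
  c.randomBits :: c.gates.flatMap fun g => [g.1, g.2.1, g.2.2]

/-- The output (the first `b` wires) of a classical circuit. The wires initially hold the input,
then the random bits, then zeros. -/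
def BoolCircuit.eval (c : BoolCircuit) {a : ℕ} (b : ℕ) (x : Bits a) (ω : Bits c.randomBits) :
    Bits b :=
  let start : ℕ → Bool := fun i =>
    if h : i < a + c.randomBits then Fin.append x ω ⟨i, h⟩ else false
  let final := c.gates.foldl
    (fun s g => Function.update s g.2.2 (!(s g.1 && s g.2.1))) start
  fun i => final i

/-- The probability that a classical circuit outputs `y` on input `x`, over uniform random bits. -/
def BoolCircuit.prob (c : BoolCircuit) {a b : ℕ} (x : Bits a) (y : Bits b) : ℝ :=
  ((Finset.univ.filter fun ω : Bits c.randomBits => c.eval b x ω = y).card : ℝ)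
    / 2 ^ c.randomBits

/-- Quantum gates: Hadamard, `T = diag(1, exp(iπ/4))`, and CNOT (control, target). -/
inductive QGate where
  | had (i : ℕ)
  | tgate (i : ℕ)
  | cnot (i j : ℕ)

/-- The description of a gate. -/
def QGate.code : QGate → List ℕ
  | had i => [0, i]
  | tgate i => [1, i]
  | cnot i j => [2, i, j]

/-- The value of wire `i`, and `false` if there is no such wire. -/
def wire {w : ℕ} (x : Bits w) (i : ℕ) : Bool := if h : i < w then x ⟨i, h⟩ else false

/-- The unitary of a gate on `w` wires. A gate that refers to a missing wire, or a CNOT whose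
control is its target, is the identity. -/
def QGate.matrix (w : ℕ) : QGate → Op (Bits w)
  | had i => of fun y x =>
      if ∀ l : Fin w, l.val ≠ i → y l = x l then
        if i < w then
          (if wire x i && wire y i then -1 else 1) * ((Real.sqrt 2 : ℂ))⁻¹
        else 1
      else 0
  | tgate i => diagonal fun x =>
      if wire x i then Complex.exp (Real.pi * Complex.I / 4) else 1
  | cnot i j => of fun y x =>
      if y = (fun l : Fin w => if l.val = j ∧ i ≠ j then xor (x l) (wire x i) else x l) then 1
      else 0

/-- A quantum circuit: a number of wires and a list of gates, applied from left to right. -/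
structure QCircuit where
  width : ℕ
  gates : List QGate

namespace QCircuit

/-- The description of a quantum circuit. -/
def code (c : QCircuit) : List ℕ := c.width :: c.gates.flatMap QGate.code

/-- The unitary of the whole circuit. -/
def unitary (c : QCircuit) : Op (Bits c.width) :=
  c.gates.foldl (fun U g => g.matrix c.width * U) 1

/-- Initial basis state: the quantum input on the first `a` wires, then the classical input `k`,
then ancillas in state `0`. -/
def startWires (c : QCircuit) {a κ : ℕ} (k : Bits κ) (x : Bits a) : Bits c.width :=
  fun i => if h : i.val < a + κ then Fin.append x k ⟨i, h⟩ else false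

/-- The isometry `|x⟩ ↦ |x⟩|k⟩|0…0⟩`. -/
def inject (c : QCircuit) (a : ℕ) {κ : ℕ} (k : Bits κ) : Matrix (Bits c.width) (Bits a) ℂ :=
  of fun z x => if z = c.startWires k x then 1 else 0

/-- Trace out all wires but the first `b`. -/
def keepFirst (w b : ℕ) : SuperOp (Bits w) (Bits b) where
  toFun X := of fun y y' => ∑ z : Bits w, ∑ z' : Bits w,
    if (∀ i : Fin b, wire z i = y i) ∧ (∀ i : Fin b, wire z' i = y' i) ∧
        (∀ i : Fin w, b ≤ i.val → z i = z' i) then X z z' else 0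
  map_add' X Y := by
    ext y y'
    simp only [of_apply, Matrix.add_apply, ← Finset.sum_add_distrib]
    refine Finset.sum_congr rfl fun z _ => Finset.sum_congr rfl fun z' _ => ?_
    split_ifs <;> simp
  map_smul' k X := by
    ext y y'
    simp only [of_apply, Matrix.smul_apply, Finset.smul_sum, RingHom.id_apply]
    refine Finset.sum_congr rfl fun z _ => Finset.sum_congr rfl fun z' _ => ?_
    split_ifs <;> simp

/-- The circuit has enough wires for its inputs and outputs. -/
def Fits (c : QCircuit) (a κ b : ℕ) : Prop := a + κ ≤ c.width ∧ b ≤ c.width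

/-- The channel from `a` to `b` qubits computed by the circuit on classical input `k`. -/
def channel (c : QCircuit) (a b : ℕ) {κ : ℕ} (k : Bits κ) : SuperOp (Bits a) (Bits b) :=
  keepFirst c.width b ∘ₗ conjMap (c.unitary * c.inject a k)

end QCircuit

/-- Measure the last qubit: outcome `0` leaves the state of the first `m` qubits, outcome `1` gives
the state `⊥`. -/
def flagToBot (m : ℕ) : SuperOp (Bits (m + 1)) (Option (Bits m)) where
  toFun X := of fun i j =>
    match i, j with
    | some x, some y => X (Fin.snoc x false) (Fin.snoc y false)
    | none, none => ∑ x : Bits m, X (Fin.snoc x true) (Fin.snoc x true)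
    | _, _ => 0
  map_add' X Y := by ext i j; cases i <;> cases j <;> simp [Finset.sum_add_distrib]
  map_smul' k X := by ext i j; cases i <;> cases j <;> simp [Finset.mul_sum]

/-! ### Public-key quantum encryption schemes -/

/-- A public-key quantum encryption scheme with public keys of `pkLen n` bits, secret keys of
`skLen n` bits, plaintexts of `msgLen n ≥ 1` qubits and ciphertexts of `ctLen n` qubits, at security
parameter `n`. -/
structure PKQES (pkLen skLen msgLen ctLen : ℕ → ℕ) where
  /-- outputs `(pk, sk)` -/
  keyGen : ℕ → BoolCircuit
  /-- quantum input `M`, classical input `pk`, output `C` -/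
  encCircuit : ℕ → QCircuit
  /-- quantum input `C`, classical input `sk`, output `M` and a qubit that flags `⊥` -/
  decCircuit : ℕ → QCircuit
  keyGen_uniform : IsUniform BoolCircuit.code keyGen
  enc_uniform : IsUniform QCircuit.code encCircuit
  dec_uniform : IsUniform QCircuit.code decCircuit
  enc_fits : ∀ n, (encCircuit n).Fits (msgLen n) (pkLen n) (ctLen n)
  dec_fits : ∀ n, (decCircuit n).Fits (ctLen n) (skLen n) (msgLen n + 1)
  msgLen_pos : ∀ n, 1 ≤ msgLen n
  msgLen_le : ∀ n, msgLen n ≤ ctLen n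
  ctLen_le : ∃ q : Polynomial ℕ, ∀ n, ctLen n ≤ q.eval n
  correct : ∃ ε : ℕ → ℝ, Negligible ε ∧ ∀ n (pk : Bits (pkLen n)) (sk : Bits (skLen n)),
    0 < (keyGen n).prob (Fin.elim0 : Bits 0) (Fin.append pk sk) →
    diamondNorm
      (flagToBot (msgLen n) ∘ₗ (decCircuit n).channel (ctLen n) (msgLen n + 1) sk
          ∘ₗ (encCircuit n).channel (msgLen n) (ctLen n) pk
        - embedBot (Bits (msgLen n))) ≤ ε n

namespace PKQES

variable {pkLen skLen msgLen ctLen : ℕ → ℕ} (S : PKQES pkLen skLen msgLen ctLen)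

/-- The probability that key generation outputs `(pk, sk)`. -/
def keyProb (n : ℕ) (pk : Bits (pkLen n)) (sk : Bits (skLen n)) : ℝ :=
  (S.keyGen n).prob (Fin.elim0 : Bits 0) (Fin.append pk sk)

/-- The encryption channel `Enc_pk`. -/
def enc (n : ℕ) (pk : Bits (pkLen n)) : SuperOp (Bits (msgLen n)) (Bits (ctLen n)) :=
  (S.encCircuit n).channel (msgLen n) (ctLen n) pk

/-- The decryption channel `Dec_sk`, with values in `M ⊕ ⊥`. -/
def dec (n : ℕ) (sk : Bits (skLen n)) : SuperOp (Bits (ctLen n)) (Option (Bits (msgLen n))) :=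
  flagToBot (msgLen n) ∘ₗ (S.decCircuit n).channel (ctLen n) (msgLen n + 1) sk

/-- The effective map `E_k [Dec_k ∘ Λ ∘ Enc_k]` of an attack. -/
def effectiveMap (n : ℕ) {b b' : Type}
    (Λ : SuperOp (Bits (ctLen n) × b) (Bits (ctLen n) × b')) :
    SuperOp (Bits (msgLen n) × b) (Option (Bits (msgLen n)) × b') :=
  ∑ pk, ∑ sk, (S.keyProb n pk sk : ℂ) •
    (onLeft (S.dec n sk) b' ∘ₗ Λ ∘ₗ onLeft (S.enc n pk) b)

/-- The state `Dec_K(τ) = E_k [Dec_k(τ)]`, where `τ` is the maximally mixed ciphertext. -/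
def decMixed (n : ℕ) : Op (Option (Bits (msgLen n))) :=
  ∑ pk, ∑ sk, (S.keyProb n pk sk : ℂ) • S.dec n sk (maxMixed (Bits (ctLen n)))

/-- The simulator `id ⊗ Λ₁ + (α ⟨Dec_K(τ)⟩ - id) / (α - 1) ⊗ Λ₂`. -/
def simulator (n : ℕ) (α : ℂ) {b b' : Type} (Λ₁ Λ₂ : SuperOp b b') :
    SuperOp (Bits (msgLen n) × b) (Option (Bits (msgLen n)) × b') :=
  tensorMap (embedBot (Bits (msgLen n))) Λ₁ +
    tensorMap ((α - 1)⁻¹ • (α • constMap (Bits (msgLen n)) (S.decMixed n)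
      - embedBot (Bits (msgLen n)))) Λ₂

/-- The simulator used for NM: `Λ₁` is `Λ` probed on, and projected to, a maximally entangled state
of the ciphertext register and a copy of it. -/
def simNM (n : ℕ) {b b' : Type}
    (Λ : SuperOp (Bits (ctLen n) × b) (Bits (ctLen n) × b')) :
    SuperOp (Bits (msgLen n) × b) (Option (Bits (msgLen n)) × b') :=
  S.simulator n ((Fintype.card (Bits (ctLen n)) : ℂ) ^ 2)
    (probe Λ (maxEnt (Bits (ctLen n))) (maxEnt (Bits (ctLen n))))
    (probe Λ (1 - maxEnt (Bits (ctLen n))) (maxEnt (Bits (ctLen n))))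

/-- Non-malleability (NM). -/
def IsNM : Prop :=
  ∃ ε : ℕ → ℝ, Negligible ε ∧ ∀ (n b b' : ℕ)
    (Λ : SuperOp (Bits (ctLen n) × Bits b) (Bits (ctLen n) × Bits b')), IsCPTP Λ →
    diamondNorm (S.effectiveMap n Λ - S.simNM n Λ) ≤ ε n

/-- Plaintext non-malleability (PNM). -/
def IsPNM : Prop :=
  ∃ ε : ℕ → ℝ, Negligible ε ∧ ∀ (n b b' : ℕ)
    (Λ : SuperOp (Bits (ctLen n) × Bits b) (Bits (ctLen n) × Bits b')), IsCPTP Λ →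
    ∃ Λ₁ Λ₂ : SuperOp (Bits b) (Bits b'),
      IsCPTNI Λ₁ ∧ IsCPTNI Λ₂ ∧ IsCPTP (Λ₁ + Λ₂) ∧
      diamondNorm (S.effectiveMap n Λ
        - S.simulator n ((Fintype.card (Bits (msgLen n)) : ℂ) ^ 2) Λ₁ Λ₂) ≤ ε n

/-- A canonical form of the scheme, up to a negligible error: for every key `k = (pk, sk)`, with
`T` a register of `ctLen n - msgLen n` qubits, a unitary `V_k` from `M T` to `C`, a state `σ_k` and
a projector `P_k` on `T`, a distribution `p_k` on bit strings `r` and unit vectors `ψ_{k,r}` of `T`,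
such that `Enc_k` is close to `V_k (· ⊗ σ_k) V_k†` and to sampling `r` and applying
`Enc_{k;r} = V_k (· ⊗ |ψ_{k,r}⟩⟨ψ_{k,r}|) V_k†`, and `Dec_k` is close to undoing `V_k` and tracing
out `T` on the ciphertexts whose `T` part lies in the range of `P_k`. -/
structure CanonicalForm where
  V : ∀ n, Bits (pkLen n) → Bits (skLen n) →
    Matrix (Bits (ctLen n)) (Bits (msgLen n) × Bits (ctLen n - msgLen n)) ℂ
  σ : ∀ n, Bits (pkLen n) → Bits (skLen n) → Op (Bits (ctLen n - msgLen n))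
  P : ∀ n, Bits (pkLen n) → Bits (skLen n) → Op (Bits (ctLen n - msgLen n))
  p : ∀ n, Bits (pkLen n) → Bits (skLen n) → Bits (ctLen n - msgLen n) → ℝ
  ψ : ∀ n, Bits (pkLen n) → Bits (skLen n) → Bits (ctLen n - msgLen n) →
    Bits (ctLen n - msgLen n) → ℂ
  err : ℕ → ℝ
  err_negl : Negligible err
  V_isometry : ∀ n pk sk, (V n pk sk)ᴴ * V n pk sk = 1
  V_coisometry : ∀ n pk sk, V n pk sk * (V n pk sk)ᴴ = 1
  σ_density : ∀ n pk sk, IsDensity (σ n pk sk)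
  P_herm : ∀ n pk sk, (P n pk sk)ᴴ = P n pk sk
  P_idem : ∀ n pk sk, P n pk sk * P n pk sk = P n pk sk
  p_nonneg : ∀ n pk sk r, 0 ≤ p n pk sk r
  p_sum : ∀ n pk sk, ∑ r, p n pk sk r = 1
  ψ_unit : ∀ n pk sk r, ∑ x, ‖ψ n pk sk r x‖ ^ 2 = 1
  enc_close : ∀ n pk sk, 0 < S.keyProb n pk sk →
    diamondNorm (S.enc n pk
      - conjMap (V n pk sk) ∘ₗ tensorState (Bits (msgLen n)) (σ n pk sk)) ≤ err n
  dec_close : ∀ n pk sk, 0 < S.keyProb n pk sk →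
    diamondNorm
      (S.dec n sk ∘ₗ conjMap (V n pk sk) ∘ₗ onRight (Bits (msgLen n)) (conjMap (P n pk sk))
          ∘ₗ conjMap (V n pk sk)ᴴ
        - embedBot (Bits (msgLen n))
          ∘ₗ traceRight (Bits (msgLen n)) (Bits (ctLen n - msgLen n))
          ∘ₗ onRight (Bits (msgLen n)) (conjMap (P n pk sk))
          ∘ₗ conjMap (V n pk sk)ᴴ) ≤ err n
  P_close : ∀ n pk sk, 0 < S.keyProb n pk sk →
    traceNorm (P n pk sk * σ n pk sk * P n pk sk - σ n pk sk) ≤ err n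
  sample_close : ∀ n pk sk, 0 < S.keyProb n pk sk →
    diamondNorm (S.enc n pk - ∑ r, (p n pk sk r : ℂ) •
      (conjMap (V n pk sk) ∘ₗ tensorState (Bits (msgLen n)) (ketbra (ψ n pk sk r)))) ≤ err n

variable {S}

namespace CanonicalForm

variable (D : S.CanonicalForm)

/-- The state `ψ_{k,r} = Enc_{k;r}(φ⁺)` on the ciphertext register and a copy of the message
register. -/
def encState (n : ℕ) (pk : Bits (pkLen n)) (sk : Bits (skLen n))
    (r : Bits (ctLen n - msgLen n)) : Op (Bits (ctLen n) × Bits (msgLen n)) :=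
  onLeft (conjMap (D.V n pk sk)
      ∘ₗ tensorState (Bits (msgLen n)) (ketbra (D.ψ n pk sk r)))
    (Bits (msgLen n)) (maxEnt (Bits (msgLen n)))

/-- The simulator used for CiNM: `Λ` is probed on, and projected to, the states `ψ_{k,r}`, on
average over `k` and `r`. -/
def simCiNM (n : ℕ) {b b' : Type}
    (Λ : SuperOp (Bits (ctLen n) × b) (Bits (ctLen n) × b')) :
    SuperOp (Bits (msgLen n) × b) (Option (Bits (msgLen n)) × b') :=
  S.simulator n ((Fintype.card (Bits (ctLen n)) : ℂ) ^ 2)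
    (∑ pk, ∑ sk, ∑ r, ((S.keyProb n pk sk * D.p n pk sk r : ℝ) : ℂ) •
      probe Λ (D.encState n pk sk r) (D.encState n pk sk r))
    (∑ pk, ∑ sk, ∑ r, ((S.keyProb n pk sk * D.p n pk sk r : ℝ) : ℂ) •
      probe Λ (1 - D.encState n pk sk r) (D.encState n pk sk r))

/-- Ciphertext non-malleability (CiNM), with respect to a canonical form of the scheme. -/
def IsCiNM : Prop :=
  ∃ ε : ℕ → ℝ, Negligible ε ∧ ∀ (n b b' : ℕ)
    (Λ : SuperOp (Bits (ctLen n) × Bits b) (Bits (ctLen n) × Bits b')), IsCPTP Λ →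
    diamondNorm (S.effectiveMap n Λ - D.simCiNM n Λ) ≤ ε n

/-- All steps of the canonical form can be carried out, given the key, by uniform polynomial-time
circuits: sampling `r`, preparing `ψ_{k,r}`, applying `V_k` and its inverse, and the measurement
`{P_k, 1 - P_k}` (its outcome is written to an additional last qubit). -/
def IsEfficient : Prop :=
  ∃ (sample : ℕ → BoolCircuit) (prep app unapp meas : ℕ → QCircuit),
    IsUniform BoolCircuit.code sample ∧ IsUniform QCircuit.code prep ∧
    IsUniform QCircuit.code app ∧ IsUniform QCircuit.code unapp ∧ IsUniform QCircuit.code meas ∧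
    ∀ n,
      let m := msgLen n
      let t := ctLen n - msgLen n
      let c := ctLen n
      let κ := pkLen n + skLen n
      (prep n).Fits t κ t ∧ (app n).Fits (m + t) κ c ∧ (unapp n).Fits c κ (m + t) ∧
      (meas n).Fits t κ (t + 1) ∧
      ∀ (pk : Bits (pkLen n)) (sk : Bits (skLen n)), 0 < S.keyProb n pk sk →
        let k : Bits κ := Fin.append pk sk
        (∀ r : Bits t, (sample n).prob k r = D.p n pk sk r) ∧
        (∀ r : Bits t, (prep n).channel t t k (single r r 1) = ketbra (D.ψ n pk sk r)) ∧
        (∀ X : Op (Bits m × Bits t),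
          (app n).channel (m + t) c k
              (reindex (Fin.appendEquiv m t) (Fin.appendEquiv m t) X)
            = conjMap (D.V n pk sk) X) ∧
        (∀ Y : Op (Bits c),
          (unapp n).channel c (m + t) k Y
            = reindex (Fin.appendEquiv m t) (Fin.appendEquiv m t)
                (conjMap (D.V n pk sk)ᴴ Y)) ∧
        (∀ X : Op (Bits t),
          (meas n).channel t (t + 1) k X = of fun y y' =>
            if y (Fin.last t) = false ∧ y' (Fin.last t) = false then
              conjMap (D.P n pk sk) X (Fin.init y) (Fin.init y')
            else if y (Fin.last t) = true ∧ y' (Fin.last t) = true then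
              conjMap (1 - D.P n pk sk) X (Fin.init y) (Fin.init y')
            else 0)

end CanonicalForm

end PKQES

/-! ### Appending an unused qubit -/

/-- `X ↦ X ⊗ |0⟩⟨0|`, the new qubit being the last one. -/
def appendZero (c : ℕ) : SuperOp (Bits c) (Bits (c + 1)) where
  toFun X := of fun y y' =>
    if y (Fin.last c) = false ∧ y' (Fin.last c) = false then X (Fin.init y) (Fin.init y') else 0
  map_add' X Y := by ext y y'; simp only [of_apply, Matrix.add_apply]; split_ifs <;> simp
  map_smul' k X := by
    ext y y'; simp only [of_apply, Matrix.smul_apply, RingHom.id_apply]; split_ifs <;> simp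

/-- Trace out the last qubit. -/
def dropLast (c : ℕ) : SuperOp (Bits (c + 1)) (Bits c) where
  toFun X := of fun y y' => ∑ s : Bool, X (Fin.snoc y s) (Fin.snoc y' s)
  map_add' X Y := by ext y y'; simp [Finset.sum_add_distrib]
  map_smul' k X := by ext y y'; simp [mul_add]

/-- Negate the last bit. -/
def flipLastBit {c : ℕ} (y : Bits (c + 1)) : Bits (c + 1) :=
  Fin.snoc (Fin.init y) (!(y (Fin.last c)))

/-- Apply the Pauli `X` gate to the last qubit. -/
def flipLast (c : ℕ) : SuperOp (Bits (c + 1)) (Bits (c + 1)) where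
  toFun X := of fun y y' => X (flipLastBit y) (flipLastBit y')
  map_add' X Y := by ext y y'; simp
  map_smul' k X := by ext y y'; simp

/-- The attack that flips the last qubit of the ciphertext and discards the `b`-qubit side
register. -/
def flipAttack (c b : ℕ) :
    SuperOp (Bits (c + 1) × Bits b) (Bits (c + 1) × Bits 0) :=
  tensorMap (flipLast c) (constMap (Bits b) (1 : Op (Bits 0)))

/-- `S` arises from `S'` by appending an unused qubit in state `|0⟩` to each ciphertext and tracing
it out before decryption; key generation is the same. -/
def PKQES.IsPaddingOf {pkLen skLen msgLen ctLen : ℕ → ℕ}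
    (S : PKQES pkLen skLen msgLen fun n => ctLen n + 1)
    (S' : PKQES pkLen skLen msgLen ctLen) : Prop :=
  S.keyGen = S'.keyGen ∧
  (∀ n pk, S.enc n pk = appendZero (ctLen n) ∘ₗ S'.enc n pk) ∧
  (∀ n sk, S.dec n sk = S'.dec n sk ∘ₗ dropLast (ctLen n))

end QNM

end

/-!
The plaintext is one qubit. The key `k = (x, z, t, s)` selects a unitary `U_k` (`keyMat`), which is a
Pauli operator if `s = 1` and a Pauli operator times a cyclic permutation of the three axes of the
Bloch ball if `s = 0`, always up to a phase. If `x`, `z` and `t` are uniform and `s = 0` has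
probability `2/3`, every nontrivial Pauli operator is mapped to each of the three axes equally often,
so that the `U_k` form a unitary 2-design: `E_k [U_k† L(U_k X U_k†) U_k]` is a combination of the
identity and the completely depolarizing map for every linear `L` (`twirl`). Applied to the matrix
entries of an attack in the side registers, this says that the effective map *equals* the simulator
in the definition of NM (`ideal_effectiveMap`).

Circuits over Hadamard, `T` and CNOT gates with classical controls do implement `U_k` exactly, since
`T X^b T` is `diag(1, i)` or a multiple of `X`, according to the bit `b`. Fair coins do not produce
the probability `2/3`, however: key generation runs a chain of `n` NAND gates on random bits, whose
output has this distribution up to an error of order `2⁻ⁿ` (`prob_keyGenCircuit`). The diamond norm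
of a real combination of channels is at most the sum of the absolute values of the coefficients
(`diamondNorm_sum_smul_le`), so the error of the simulation is negligible (`isNM_unitaryScheme`). The
key generation circuits form the only family that depends on `n`; a Turing machine with four stacks
prints them in quadratic time (`isUniform_of_loop`).

For the padded scheme, adding the unused qubit before an attack and discarding it afterwards turns
the attack into one on the unpadded scheme, with the same effective map, and the NM simulator of the
latter is a PNM simulator of the former (`isPNM_paddedScheme`).

The attack that flips the unused qubit acts as the identity on the plaintext. Its probe on a
maximally entangled state of the whole ciphertext never succeeds, because the flipped state is
orthogonal (`flipOverlap_maxEnt`). In any canonical form, the states `ψ_{k,r}` are pure and have, on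
average over `r` and up to its error, no weight on strings that end in `1`, so that their probes
rarely succeed either (`norm_flipOverlap_ketbra_le`, `sum_weight_le`). When the probe succeeds with
probability `x`, the effective map and the simulator differ by `(1 - x) 16/15 (id - ⟨τ⟩)`, which
has diamond norm at least `(1 - x) 16/15`, as the input `|0⟩⟨0|` shows
(`one_lt_diamondNorm_flipAttack`).

The quantum circuits that occur here keep all wires but wire `0` classical; the columns of their
unitaries are product states (`prodState`), from which their channels are read off
(`channel_apply`).
-/

noncomputable section

namespace QNM

/-! ### The trace norm and the diamond norm -/

section Norms

variable {a b r : Type} [Fintype a] [DecidableEq a] [Fintype b] [DecidableEq b] [Fintype r]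

/-- The Gram matrix of the columns of `X V` is diagonal if the columns of `V` are eigenvectors of
`X† X`. -/
theorem gram_mul_eigenvectorUnitary (X : Op a) :
    (X * ((isHermitian_conjTranspose_mul_self X).eigenvectorUnitary : Op a))ᴴ *
        (X * ((isHermitian_conjTranspose_mul_self X).eigenvectorUnitary : Op a))
      = diagonal fun i => ((isHermitian_conjTranspose_mul_self X).eigenvalues i : ℂ) := by
  set hX := isHermitian_conjTranspose_mul_self X
  set V : Op a := (hX.eigenvectorUnitary : Op a) with hV
  have hu : Vᴴ * V = 1 := by
    simpa [star_eq_conjTranspose] using Unitary.coe_star_mul_self hX.eigenvectorUnitary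
  have h := hX.spectral_theorem
  rw [Unitary.conjStarAlgAut_apply] at h
  change Xᴴ * X = V * diagonal (fun i => (hX.eigenvalues i : ℂ)) * Vᴴ at h
  calc (X * V)ᴴ * (X * V) = Vᴴ * (Xᴴ * X) * V := by
        rw [conjTranspose_mul]; simp only [Matrix.mul_assoc]
    _ = Vᴴ * (V * diagonal (fun i => (hX.eigenvalues i : ℂ)) * Vᴴ) * V :=
        congrArg (fun M => Vᴴ * M * V) h
    _ = (Vᴴ * V) * diagonal (fun i => (hX.eigenvalues i : ℂ)) * (Vᴴ * V) := by
        simp only [Matrix.mul_assoc]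
    _ = _ := by rw [hu]; simp

theorem sum_normSq_col (X : Op a) (j : a) :
    ∑ i, ‖(X * ((isHermitian_conjTranspose_mul_self X).eigenvectorUnitary : Op a)) i j‖ ^ 2
      = (isHermitian_conjTranspose_mul_self X).eigenvalues j := by
  have h3 := congrFun (congrFun (gram_mul_eigenvectorUnitary X) j) j
  rw [Matrix.mul_apply, diagonal_apply_eq] at h3
  simp only [conjTranspose_apply, Complex.star_def, Complex.conj_mul'] at h3
  exact_mod_cast h3

theorem unitary_col_normSq (V : unitaryGroup a ℂ) (j : a) : ∑ i, ‖(V : Op a) i j‖ ^ 2 = 1 := by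
  have hu : (V : Op a)ᴴ * (V : Op a) = 1 := by
    simpa [star_eq_conjTranspose] using Unitary.coe_star_mul_self V
  have h3 := congrFun (congrFun hu j) j
  rw [Matrix.mul_apply, one_apply_eq] at h3
  simp only [conjTranspose_apply, Complex.star_def, Complex.conj_mul'] at h3
  exact_mod_cast h3

/-- Testing with diagonal observables bounds the trace norm from below. -/
theorem sum_norm_diag_le_traceNorm (X : Op a) : ∑ i, ‖X i i‖ ≤ traceNorm X := by
  set hX := isHermitian_conjTranspose_mul_self X
  set V := hX.eigenvectorUnitary
  have hXV : ∀ i, ‖X i i‖ ≤ ∑ j, ‖(X * (V : Op a)) i j‖ * ‖(V : Op a) i j‖ := by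
    intro i
    have h : X = (X * (V : Op a)) * (V : Op a)ᴴ := by
      have hu : (V : Op a) * (V : Op a)ᴴ = 1 := by
        simpa [star_eq_conjTranspose] using Unitary.coe_mul_star_self V
      rw [Matrix.mul_assoc, hu, Matrix.mul_one]
    conv_lhs => rw [h]
    rw [Matrix.mul_apply]
    refine (norm_sum_le _ _).trans (le_of_eq ?_)
    simp
  calc ∑ i, ‖X i i‖ ≤ ∑ i, ∑ j, ‖(X * (V : Op a)) i j‖ * ‖(V : Op a) i j‖ :=
        Finset.sum_le_sum fun i _ => hXV i
    _ = ∑ j, ∑ i, ‖(X * (V : Op a)) i j‖ * ‖(V : Op a) i j‖ := Finset.sum_comm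
    _ ≤ ∑ j, Real.sqrt (hX.eigenvalues j) := by
        refine Finset.sum_le_sum fun j _ => ?_
        refine (Real.sum_mul_le_sqrt_mul_sqrt _ _ _).trans ?_
        rw [unitary_col_normSq, sum_normSq_col]; simp
    _ = traceNorm X := rfl

theorem traceNorm_nonneg (X : Op a) : 0 ≤ traceNorm X :=
  Finset.sum_nonneg fun _ _ => Real.sqrt_nonneg _

/-- Polar decomposition: the trace norm is attained on a pair of a unitary `V` and a matrix `Z` whose
columns are orthonormal or zero; the latter enters only through the projection `1 - Z Z†`. -/
theorem exists_traceNorm_eq (X : Op a) : ∃ Z V : Op a, V * Vᴴ = 1 ∧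
    (1 - Z * Zᴴ) * (1 - Z * Zᴴ) = 1 - Z * Zᴴ ∧ (traceNorm X : ℂ) = (Zᴴ * X * V).trace := by
  set hX := isHermitian_conjTranspose_mul_self X with hXdef
  set V : Op a := (hX.eigenvectorUnitary : Op a) with hV
  have hu : V * Vᴴ = 1 := by
    simpa [star_eq_conjTranspose] using Unitary.coe_mul_star_self hX.eigenvectorUnitary
  set lam := hX.eigenvalues with hlam
  have hnn : ∀ j, 0 ≤ lam j := fun j => by
    rw [hlam, ← sum_normSq_col]; positivity
  have h2 : (X * V)ᴴ * (X * V) = diagonal (fun i => (lam i : ℂ)) :=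
    gram_mul_eigenvectorUnitary X
  -- `c j = λ_j ^ (-1/2)`, where `0⁻¹ = 0` makes the columns of eigenvalue zero vanish
  set c : a → ℂ := fun j => ((Real.sqrt (lam j))⁻¹ : ℝ) with hc
  have hcstar : (diagonal c)ᴴ = diagonal c := by
    rw [diagonal_conjTranspose]; congr 1; ext j; simp [hc]
  set Z : Op a := X * V * diagonal c with hZ
  have hZZ : Zᴴ * Z = diagonal (fun j => c j * lam j * c j) := by
    rw [hZ, conjTranspose_mul, hcstar, show diagonal c * (X * V)ᴴ * (X * V * diagonal c)
      = diagonal c * ((X * V)ᴴ * (X * V)) * diagonal c by simp only [Matrix.mul_assoc], h2,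
      diagonal_mul_diagonal, diagonal_mul_diagonal]
  have hccc : ∀ j, c j * (c j * lam j * c j) = c j := by
    intro j
    simp only [hc, ← Complex.ofReal_mul]
    congr 1
    rcases (hnn j).eq_or_lt with h0 | h0
    · rw [← h0]; simp
    · have hs := Real.sqrt_pos.2 h0
      have hq := Real.mul_self_sqrt (hnn j)
      field_simp
      nlinarith
  have hZP : Z * (Zᴴ * Z) = Z := by
    rw [hZZ]; conv_lhs => rw [hZ]
    rw [Matrix.mul_assoc, diagonal_mul_diagonal, hZ]
    congr 2; ext j; exact hccc j
  refine ⟨Z, V, hu, ?_, ?_⟩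
  · have : Z * Zᴴ * (Z * Zᴴ) = Z * Zᴴ := by
      rw [show Z * Zᴴ * (Z * Zᴴ) = Z * (Zᴴ * Z) * Zᴴ by simp only [Matrix.mul_assoc], hZP]
    rw [Matrix.sub_mul, Matrix.mul_sub, Matrix.mul_sub, this]; simp
  · rw [show Zᴴ * X * V = diagonal c * ((X * V)ᴴ * (X * V)) by
      rw [hZ, conjTranspose_mul, hcstar]; simp only [Matrix.mul_assoc], h2, diagonal_mul_diagonal,
      trace_diagonal, traceNorm, Complex.ofReal_sum]
    refine Finset.sum_congr rfl fun j _ => ?_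
    simp only [hc, ← Complex.ofReal_mul]
    congr 1
    change Real.sqrt (lam j) = _
    rcases (hnn j).eq_or_lt with h0 | h0
    · rw [← h0]; simp
    · have hs := Real.sqrt_pos.2 h0
      have hq := Real.mul_self_sqrt (hnn j)
      field_simp
      nlinarith

omit [DecidableEq a] in
theorem re_trace_nonneg {A : Op a} (hA : A.PosSemidef) : 0 ≤ A.trace.re :=
  (Complex.le_def.1 hA.trace_nonneg).1

/-- Real combinations of positive operators obey the triangle inequality for the trace norm. -/
theorem traceNorm_sum_smul_le {κ : Type} [Fintype κ] (c : κ → ℝ) (A : κ → Op a)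
    (hA : ∀ k, (A k).PosSemidef) :
    traceNorm (∑ k, (c k : ℂ) • A k) ≤ ∑ k, |c k| * (A k).trace.re := by
  obtain ⟨Z, V, hV, hQ, htr⟩ := exists_traceNorm_eq (∑ k, (c k : ℂ) • A k)
  have hre : traceNorm (∑ k, (c k : ℂ) • A k) = ∑ k, c k * (Zᴴ * A k * V).trace.re := by
    have h := congrArg Complex.re htr
    rw [Complex.ofReal_re] at h
    rw [h, Matrix.mul_sum, Finset.sum_mul, trace_sum, Complex.re_sum]
    refine Finset.sum_congr rfl fun k _ => ?_
    rw [Matrix.mul_smul, Matrix.smul_mul, trace_smul, smul_eq_mul, Complex.re_ofReal_mul]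
  rw [hre]
  refine Finset.sum_le_sum fun k _ => ?_
  have hP := hA k
  set P := A k
  have hVV : (Vᴴ * P * V).trace = P.trace := by
    rw [trace_mul_comm, ← Matrix.mul_assoc, hV, Matrix.one_mul]
  have hZZ : (Zᴴ * P * Z).trace.re ≤ P.trace.re := by
    have hq : (1 - Z * Zᴴ)ᴴ = 1 - Z * Zᴴ := by simp
    have h1 := re_trace_nonneg (hP.conjTranspose_mul_mul_same (1 - Z * Zᴴ))
    rw [hq, trace_mul_comm, ← Matrix.mul_assoc, hQ, Matrix.sub_mul, Matrix.one_mul, trace_sub,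
      Matrix.mul_assoc, trace_mul_comm, Complex.sub_re] at h1
    linarith
  have hcross : (Vᴴ * P * Z).trace.re = (Zᴴ * P * V).trace.re := by
    have : Vᴴ * P * Z = (Zᴴ * P * V)ᴴ := by
      simp only [conjTranspose_mul, conjTranspose_conjTranspose, hP.1.eq, Matrix.mul_assoc]
    rw [this, trace_conjTranspose]; simp
  have hpm := re_trace_nonneg (hP.conjTranspose_mul_mul_same (Z - V))
  have hpp := re_trace_nonneg (hP.conjTranspose_mul_mul_same (Z + V))
  simp only [conjTranspose_sub, conjTranspose_add, Matrix.sub_mul, Matrix.mul_sub, Matrix.add_mul,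
    Matrix.mul_add, trace_sub, trace_add, Complex.sub_re, Complex.add_re, hcross, hVV] at hpm hpp
  have habs : |(Zᴴ * P * V).trace.re| ≤ P.trace.re := abs_le.2 ⟨by linarith, by linarith⟩
  calc c k * (Zᴴ * P * V).trace.re ≤ |c k| * |(Zᴴ * P * V).trace.re| := by
        rw [← abs_mul]; exact le_abs_self _
    _ ≤ |c k| * P.trace.re := mul_le_mul_of_nonneg_left habs (abs_nonneg _)

theorem traceNorm_zero : traceNorm (0 : Op a) = 0 := by
  refine le_antisymm ?_ (traceNorm_nonneg _)
  have := traceNorm_sum_smul_le (κ := Unit) (fun _ => 0) (fun _ => (0 : Op a))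
    fun _ => Matrix.PosSemidef.zero
  simpa using this

theorem sum_normSq_eq (X : Op a) :
    ∑ j, (isHermitian_conjTranspose_mul_self X).eigenvalues j = ∑ i, ∑ j, ‖X i j‖ ^ 2 := by
  have h := (isHermitian_conjTranspose_mul_self X).trace_eq_sum_eigenvalues
  have h2 : (Xᴴ * X).trace = ((∑ i, ∑ j, ‖X i j‖ ^ 2 : ℝ) : ℂ) := by
    rw [Finset.sum_comm]
    simp only [Matrix.trace, diag_apply, Matrix.mul_apply, conjTranspose_apply]
    push_cast
    refine Finset.sum_congr rfl fun i _ => Finset.sum_congr rfl fun j _ => ?_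
    rw [Complex.star_def, mul_comm, Complex.mul_conj, Complex.normSq_eq_norm_sq]; simp
  rw [h2] at h
  have h3 : (((∑ i, ∑ j, ‖X i j‖ ^ 2 : ℝ)) : ℂ) =
    ((∑ j, (isHermitian_conjTranspose_mul_self X).eigenvalues j : ℝ) : ℂ) := by
    rw [h]; simp
  exact (Complex.ofReal_injective h3).symm

theorem traceNorm_le_of_entries (X : Op a) {K : ℝ} (hK : ∀ i j, ‖X i j‖ ≤ K) :
    traceNorm X ≤
      ∑ _j : a, Real.sqrt (∑ _i : a, ∑ _j : a, K ^ 2) := by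
  refine Finset.sum_le_sum fun j _ => Real.sqrt_le_sqrt ?_
  have hnn : ∀ j, 0 ≤ (isHermitian_conjTranspose_mul_self X).eigenvalues j := fun j => by
    rw [← sum_normSq_col]; positivity
  calc _ ≤ ∑ j, (isHermitian_conjTranspose_mul_self X).eigenvalues j :=
        Finset.single_le_sum (f := (isHermitian_conjTranspose_mul_self X).eigenvalues)
          (fun j _ => hnn j) (Finset.mem_univ j)
    _ = ∑ i, ∑ j, ‖X i j‖ ^ 2 := sum_normSq_eq X
    _ ≤ _ := Finset.sum_le_sum fun i _ => Finset.sum_le_sum fun j _ =>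
        pow_le_pow_left₀ (norm_nonneg _) (hK i j) 2

omit [DecidableEq a] in
theorem exists_eq_sum_mul_star {A : Op a} (hA : A.PosSemidef) :
    ∃ (m : ℕ) (v : Fin m → a → ℂ), ∀ i j, A i j = ∑ k, v k i * star (v k j) := by
  obtain ⟨m, v, hv⟩ := posSemidef_iff_eq_sum_vecMulVec.1 hA
  refine ⟨m, v, fun i j => ?_⟩
  rw [hv, Matrix.sum_apply]
  rfl

omit [DecidableEq a] in
theorem IsDensity.norm_entry_le {ρ : Op a} (h : IsDensity ρ) (i j : a) : ‖ρ i j‖ ≤ 1 := by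
  obtain ⟨m, v, hv⟩ := exists_eq_sum_mul_star h.1
  have hcol : ∀ l, ∑ k, ‖v k l‖ ^ 2 ≤ 1 := by
    intro l
    have h1 : ((∑ l, ∑ k, ‖v k l‖ ^ 2 : ℝ) : ℂ) = 1 := by
      rw [← h.2]
      simp only [Matrix.trace, diag_apply, hv, Complex.star_def, Complex.mul_conj']
      push_cast
      rfl
    have h2 : (∑ l, ∑ k, ‖v k l‖ ^ 2 : ℝ) = 1 := by exact_mod_cast h1
    rw [← h2]
    exact Finset.single_le_sum (f := fun l => ∑ k, ‖v k l‖ ^ 2)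
      (fun _ _ => Finset.sum_nonneg fun _ _ => by positivity) (Finset.mem_univ l)
  rw [hv]
  refine (norm_sum_le _ _).trans ?_
  simp only [norm_mul, norm_star]
  calc ∑ k, ‖v k i‖ * ‖v k j‖ ≤ ∑ k, (‖v k i‖ ^ 2 + ‖v k j‖ ^ 2) / 2 :=
        Finset.sum_le_sum fun k _ => by nlinarith [sq_nonneg (‖v k i‖ - ‖v k j‖)]
    _ = (∑ k, ‖v k i‖ ^ 2 + ∑ k, ‖v k j‖ ^ 2) / 2 := by
        rw [← Finset.sum_div, Finset.sum_add_distrib]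
    _ ≤ 1 := by linarith [hcol i, hcol j]

omit [Fintype b] [DecidableEq b] in
theorem superOp_apply_eq_sum (L : SuperOp a b) (X : Op a) :
    L X = ∑ i, ∑ j, X i j • L (single i j 1) := by
  conv_lhs => rw [matrix_eq_sum_single X]
  simp only [map_sum]
  refine Finset.sum_congr rfl fun i _ => Finset.sum_congr rfl fun j _ => ?_
  rw [← map_smul, smul_single, smul_eq_mul, mul_one]

/-- The supremum in the definition of the diamond norm is over a bounded set. -/
theorem bddAbove_traceNorm_density (L : SuperOp a b) :
    BddAbove {x | ∃ ρ : Op (a × a), IsDensity ρ ∧ x = traceNorm (onLeft L a ρ)} := by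
  set K : ℝ := ∑ p, ∑ q, ∑ i, ∑ j, ‖L (single i j 1) p q‖ with hK
  refine ⟨∑ _j : b × a, Real.sqrt (∑ _i : b × a, ∑ _j : b × a, K ^ 2), ?_⟩
  rintro x ⟨ρ, hρ, rfl⟩
  refine traceNorm_le_of_entries _ fun p q => ?_
  change ‖L (of fun i j => ρ (i, p.2) (j, q.2)) p.1 q.1‖ ≤ K
  rw [superOp_apply_eq_sum]
  simp only [Matrix.sum_apply, Matrix.smul_apply, smul_eq_mul, of_apply]
  have h1 : ‖∑ i, ∑ j, ρ (i, p.2) (j, q.2) * L (single i j 1) p.1 q.1‖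
      ≤ ∑ i, ∑ j, ‖L (single i j 1) p.1 q.1‖ := by
    refine (norm_sum_le _ _).trans (Finset.sum_le_sum fun i _ => (norm_sum_le _ _).trans
      (Finset.sum_le_sum fun j _ => ?_))
    rw [norm_mul]
    exact mul_le_of_le_one_left (norm_nonneg _) (hρ.norm_entry_le _ _)
  refine h1.trans ?_
  have hnn : ∀ p q, 0 ≤ ∑ i, ∑ j, ‖L (single i j 1) p q‖ := fun p q =>
    Finset.sum_nonneg fun _ _ => Finset.sum_nonneg fun _ _ => norm_nonneg _
  refine le_trans ?_ (Finset.single_le_sum (f := fun p => ∑ q, ∑ i, ∑ j, ‖L (single i j 1) p q‖)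
    (fun p _ => Finset.sum_nonneg fun q _ => hnn p q) (Finset.mem_univ p.1))
  exact Finset.single_le_sum (f := fun q => ∑ i, ∑ j, ‖L (single i j 1) p.1 q‖)
    (fun q _ => hnn p.1 q) (Finset.mem_univ q.1)

theorem traceNorm_le_diamondNorm (L : SuperOp a b) {ρ : Op (a × a)} (hρ : IsDensity ρ) :
    traceNorm (onLeft L a ρ) ≤ diamondNorm L :=
  le_csSup (bddAbove_traceNorm_density L) ⟨ρ, hρ, rfl⟩

theorem diamondNorm_le (L : SuperOp a b) {C : ℝ} (hC : 0 ≤ C)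
    (h : ∀ ρ : Op (a × a), IsDensity ρ → traceNorm (onLeft L a ρ) ≤ C) : diamondNorm L ≤ C := by
  refine Real.sSup_le ?_ hC
  rintro x ⟨ρ, hρ, rfl⟩
  exact h ρ hρ

theorem diamondNorm_zero : diamondNorm (0 : SuperOp a b) ≤ 0 := by
  refine diamondNorm_le _ le_rfl fun ρ _ => le_of_eq ?_
  exact traceNorm_zero

end Norms

/-! ### Completely positive maps -/

section CP

variable {a b c r s : Type}

theorem onLeft_apply (L : SuperOp a b) (X : Op (a × r)) (p q : b × r) :
    onLeft L r X p q = L (of fun i j => X (i, p.2) (j, q.2)) p.1 q.1 := rfl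

theorem onRight_apply (L : SuperOp a b) (X : Op (r × a)) (p q : r × b) :
    onRight r L X p q = L (of fun i j => X (p.1, i) (q.1, j)) p.2 q.2 := rfl

theorem onLeft_sum {κ : Type} [Fintype κ] (L : κ → SuperOp a b) (r : Type) (X : Op (a × r)) :
    onLeft (∑ k, L k) r X = ∑ k, onLeft (L k) r X := by
  ext p q
  simp only [onLeft_apply, LinearMap.sum_apply, Matrix.sum_apply]

theorem onLeft_smul (z : ℂ) (L : SuperOp a b) (r : Type) (X : Op (a × r)) :
    onLeft (z • L) r X = z • onLeft L r X := rfl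

variable [Fintype a] [Fintype b] [Fintype c] [Fintype r] [Fintype s]

theorem trace_onLeft (L : SuperOp a b) (hL : ∀ X, (L X).trace = X.trace) (X : Op (a × r)) :
    (onLeft L r X).trace = X.trace := by
  simp only [Matrix.trace, diag_apply, Fintype.sum_prod_type_right, onLeft_apply]
  exact Finset.sum_congr rfl fun k _ => hL (of fun i j => X (i, k) (j, k))

theorem trace_onRight (L : SuperOp a b) (hL : ∀ X, (L X).trace = X.trace) (X : Op (r × a)) :
    (onRight r L X).trace = X.trace := by
  simp only [Matrix.trace, diag_apply, Fintype.sum_prod_type, onRight_apply]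
  exact Finset.sum_congr rfl fun k _ => hL (of fun i j => X (k, i) (k, j))

omit [Fintype b] [Fintype a] in
/-- Complete positivity, tested with numbered ancillas, extends to all finite ancillas. -/
theorem IsCP.posSemidef {L : SuperOp a b} (hL : IsCP L) {X : Op (a × r)} (hX : X.PosSemidef) :
    (onLeft L r X).PosSemidef := by
  let e := Fintype.equivFin r
  have h := hL _ (X.submatrix (Prod.map id e.symm) (Prod.map id e.symm)) (hX.submatrix _)
  have h2 := h.submatrix (Prod.map id e : b × r → _)
  convert h2 using 1
  ext p q
  simp [onLeft_apply]

omit [Fintype c] [Fintype a] [Fintype b] in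
theorem IsCP.comp {L : SuperOp b c} {N : SuperOp a b} (hL : IsCP L) (hN : IsCP N) :
    IsCP (L ∘ₗ N) := fun r X hX => hL r _ (hN r X hX)

omit [Fintype a] [Fintype b] in
theorem IsCP.add {L N : SuperOp a b} (hL : IsCP L) (hN : IsCP N) : IsCP (L + N) :=
  fun r X hX => (hL r X hX).add (hN r X hX)

omit [Fintype a] [Fintype b] in
theorem isCP_sum {κ : Type} [Fintype κ] {L : κ → SuperOp a b} (hL : ∀ k, IsCP (L k)) :
    IsCP (∑ k, L k) := by
  intro r X hX
  rw [onLeft_sum]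
  exact Matrix.posSemidef_sum _ fun k _ => hL k r X hX

theorem isCP_conjMap (V : Matrix b a ℂ) : IsCP (conjMap V) := by
  intro r X hX
  have h : onLeft (conjMap V) (Fin r) X =
      (V ⊗ₖ (1 : Op (Fin r))) * X * (V ⊗ₖ (1 : Op (Fin r)))ᴴ := by
    ext p q
    simp [onLeft_apply, conjMap, Matrix.mul_apply, Fintype.sum_prod_type, one_apply,
      Finset.sum_mul, apply_ite (starRingEnd ℂ), mul_ite]
  rw [h]
  exact hX.mul_mul_conjTranspose_same _

omit [Fintype a] [Fintype b] in
theorem IsCP.onLeft {L : SuperOp a b} (hL : IsCP L) : IsCP (onLeft L s) := by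
  intro r X hX
  have h := hL.posSemidef (hX.submatrix (Equiv.prodAssoc a s (Fin r)).symm)
  exact h.submatrix (Equiv.prodAssoc b s (Fin r))

omit [Fintype a] [Fintype b] in
theorem IsCP.onRight {L : SuperOp a b} (hL : IsCP L) : IsCP (onRight s L) := by
  intro r X hX
  have h := hL.posSemidef (hX.submatrix fun p : a × (s × Fin r) => ((p.2.1, p.1), p.2.2))
  exact h.submatrix fun p : (s × b) × Fin r => (p.1.2, (p.1.1, p.2))

theorem isCP_constMap_one (b : ℕ) : IsCP (constMap (Bits b) (1 : Op (Bits 0))) := by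
  have h : constMap (Bits b) (1 : Op (Bits 0))
      = ∑ i : Bits b, conjMap (of fun _ j => if j = i then 1 else 0) := by
    ext X p q
    rw [Subsingleton.elim q p]
    simp [constMap, conjMap, Matrix.mul_apply, Matrix.trace, LinearMap.sum_apply,
      Matrix.sum_apply]
  rw [h]
  exact isCP_sum fun i => isCP_conjMap _

theorem isCP_attach [DecidableEq b] {S : Op (c × r)} (hS : S.PosSemidef) :
    IsCP (attach (b := b) S) := by
  classical
  obtain ⟨m, v, hv⟩ := exists_eq_sum_mul_star hS
  have h : attach (b := b) S = ∑ k, conjMap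
      (of fun (u : (c × b) × r) y => if u.1.2 = y then v k (u.1.1, u.2) else 0) := by
    ext Y u w
    simp [attach, conjMap, Matrix.mul_apply, Matrix.sum_apply, hv, Finset.sum_mul,
      LinearMap.sum_apply, apply_ite (starRingEnd ℂ)]
    exact Finset.sum_congr rfl fun k _ => by ring
  rw [h]
  exact isCP_sum fun i => isCP_conjMap _

theorem isCP_contract [DecidableEq b] {E : Op (c × r)} (hE : E.PosSemidef) :
    IsCP (contract (b := b) E) := by
  classical
  obtain ⟨m, v, hv⟩ := exists_eq_sum_mul_star hE
  have h : contract (b := b) E = ∑ k, conjMap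
      (of fun y (u : (c × b) × r) => if u.1.2 = y then star (v k (u.1.1, u.2)) else 0) := by
    ext Y u w
    simp [contract, conjMap, Matrix.mul_apply, Matrix.sum_apply, hv, Finset.sum_mul,
      LinearMap.sum_apply, apply_ite (starRingEnd ℂ), Fintype.sum_prod_type]
    symm
    rw [Finset.sum_comm]
    refine Finset.sum_congr rfl fun x _ => ?_
    rw [Finset.sum_comm]
    refine Finset.sum_congr rfl fun x _ => ?_
    rw [Finset.sum_comm]
    refine Finset.sum_congr rfl fun x _ => ?_
    rw [Finset.sum_comm]
    exact Finset.sum_congr rfl fun x _ => Finset.sum_congr rfl fun x _ => by ring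
  rw [h]
  exact isCP_sum fun i => isCP_conjMap _

theorem isCP_embedBot [DecidableEq a] : IsCP (embedBot a) := by
  have h : embedBot a = conjMap (of fun (o : Option a) i => if o = some i then 1 else 0) := by
    ext X p q
    rcases p with _ | p <;> rcases q with _ | q <;>
      simp [embedBot, conjMap, Matrix.mul_apply, apply_ite (starRingEnd ℂ)]
  rw [h]
  exact isCP_conjMap _

theorem trace_embedBot (X : Op a) : (embedBot a X).trace = X.trace := by
  simp [embedBot, Matrix.trace, Fintype.sum_option]

theorem isCP_appendZero (n : ℕ) : IsCP (appendZero n) := by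
  have h : appendZero n = conjMap (of fun (y : Bits (n + 1)) x =>
      if y (Fin.last n) = false ∧ Fin.init y = x then 1 else 0) := by
    ext X p q
    simp only [appendZero, conjMap, Matrix.mul_apply, LinearMap.coe_mk, AddHom.coe_mk, of_apply,
      conjTranspose_apply]
    by_cases h1 : p (Fin.last n) = false <;> by_cases h2 : q (Fin.last n) = false <;>
      simp [h1, h2, apply_ite (starRingEnd ℂ)]
  rw [h]
  exact isCP_conjMap _

theorem sum_bits_succ {β : Type} [AddCommMonoid β] {n : ℕ} (f : Bits (n + 1) → β) :
    ∑ y, f y = ∑ x : Bits n, ∑ s : Bool, f (Fin.snoc x s) := by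
  rw [← (Fin.snocEquiv fun _ => Bool).sum_comp, Fintype.sum_prod_type, Finset.sum_comm]
  rfl

theorem trace_appendZero (n : ℕ) (X : Op (Bits n)) : (appendZero n X).trace = X.trace := by
  simp [appendZero, Matrix.trace, sum_bits_succ]

theorem isCP_dropLast (n : ℕ) : IsCP (dropLast n) := by
  have h : dropLast n = ∑ s : Bool, conjMap (of fun x (y : Bits (n + 1)) =>
      if y = Fin.snoc x s then 1 else 0) := by
    ext X p q
    simp [dropLast, conjMap, Matrix.mul_apply, apply_ite (starRingEnd ℂ)]
  rw [h]
  exact isCP_sum fun i => isCP_conjMap _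

theorem trace_dropLast (n : ℕ) (X : Op (Bits (n + 1))) : (dropLast n X).trace = X.trace := by
  simp [dropLast, Matrix.trace, sum_bits_succ]

theorem flipLastBit_flipLastBit {n : ℕ} (y : Bits (n + 1)) : flipLastBit (flipLastBit y) = y := by
  simp [flipLastBit]

theorem isCP_flipLast (n : ℕ) : IsCP (flipLast n) := by
  have h : flipLast n = conjMap (of fun y (y' : Bits (n + 1)) =>
      if flipLastBit y = y' then 1 else 0) := by
    ext X p q
    simp [flipLast, conjMap, Matrix.mul_apply, apply_ite (starRingEnd ℂ)]
  rw [h]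
  exact isCP_conjMap _

theorem trace_flipLast (n : ℕ) (X : Op (Bits (n + 1))) : (flipLast n X).trace = X.trace := by
  simp only [flipLast, Matrix.trace, diag_apply, LinearMap.coe_mk, AddHom.coe_mk, of_apply]
  exact Equiv.sum_comp (Function.Involutive.toPerm flipLastBit flipLastBit_flipLastBit)
    fun y => X y y

theorem isCPTP_flipAttack (n b : ℕ) : IsCPTP (flipAttack n b) := by
  refine ⟨(isCP_flipLast n).onLeft.comp (isCP_constMap_one b).onRight, fun X => ?_⟩
  rw [flipAttack, tensorMap, LinearMap.comp_apply, trace_onLeft _ (trace_flipLast n),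
    trace_onRight _ fun X => ?_]
  simp [constMap, Matrix.trace]

theorem trace_conjMap [DecidableEq a] {V : Matrix b a ℂ} (hV : Vᴴ * V = 1) (X : Op a) :
    (conjMap V X).trace = X.trace := by
  change (V * X * Vᴴ).trace = _
  rw [Matrix.mul_assoc, trace_mul_comm, Matrix.mul_assoc, hV, Matrix.mul_one]

theorem trace_attach (S : Op (c × r)) (Y : Op b) :
    (attach S Y).trace = S.trace * Y.trace := by
  simp only [attach, Matrix.trace, diag_apply, LinearMap.coe_mk, AddHom.coe_mk, of_apply,
    Fintype.sum_prod_type, Finset.sum_mul_sum]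
  refine Finset.sum_congr rfl fun x _ => ?_
  simp only [Finset.sum_mul]

theorem trace_contract_one [DecidableEq c] [DecidableEq r] (Z : Op ((c × b) × r)) :
    (contract (1 : Op (c × r)) Z).trace = Z.trace := by
  simp only [contract, Matrix.trace, diag_apply, LinearMap.coe_mk, AddHom.coe_mk, of_apply,
    one_apply, ite_mul, one_mul, zero_mul, Finset.sum_ite_eq, Finset.mem_univ, if_true,
    Fintype.sum_prod_type]
  rw [Finset.sum_comm]

omit [Fintype b] in
theorem contract_add (E F : Op (c × r)) :
    contract (b := b) (E + F) = contract E + contract F := by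
  ext Z p q
  simp [contract, add_mul, Finset.sum_add_distrib]

omit [Fintype a] [Fintype b] in
theorem probe_add_sub [DecidableEq c] [DecidableEq r] (Λ : SuperOp (c × a) (c × b))
    (E S : Op (c × r)) : probe Λ E S + probe Λ (1 - E) S = probe Λ 1 S := by
  simp only [probe, ← LinearMap.add_comp, ← contract_add, add_sub_cancel]

theorem isCP_probe [DecidableEq a] [DecidableEq b] {Λ : SuperOp (c × a) (c × b)} (hΛ : IsCP Λ)
    {E S : Op (c × r)} (hE : E.PosSemidef) (hS : S.PosSemidef) : IsCP (probe Λ E S) :=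
  (isCP_contract hE).comp (hΛ.onLeft.comp (isCP_attach hS))

theorem trace_probe_one [DecidableEq c] [DecidableEq r] {Λ : SuperOp (c × a) (c × b)}
    (hΛ : ∀ X, (Λ X).trace = X.trace) {S : Op (c × r)} (hS : S.trace = 1) (Y : Op a) :
    (probe Λ 1 S Y).trace = Y.trace := by
  rw [probe, LinearMap.comp_apply, LinearMap.comp_apply, trace_contract_one, trace_onLeft _ hΛ,
    trace_attach, hS, one_mul]

/-- A branch of an instrument is trace non-increasing. -/
theorem IsCPTP.isCPTNI_of_add {L N : SuperOp a b} (h : ∀ X, ((L + N) X).trace = X.trace)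
    (hL : IsCP L) (hN : IsCP N) : IsCPTNI L := by
  refine ⟨hL, fun X hX => ?_⟩
  have h1 : (N X).PosSemidef := by
    have h2 := hN 1 (X.submatrix Prod.fst Prod.fst) (hX.submatrix _)
    exact h2.submatrix fun p : b => (p, (0 : Fin 1))
  have h3 := congrArg Complex.re (h X)
  rw [LinearMap.add_apply, trace_add, Complex.add_re] at h3
  linarith [re_trace_nonneg h1]

/-- Probing an attack with a state `E` and the measurement `{E, 1 - E}` is an instrument. -/
theorem probe_instrument [DecidableEq a] [DecidableEq b] [DecidableEq c] [DecidableEq r]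
    {Λ : SuperOp (c × a) (c × b)} (hΛ : IsCPTP Λ) {E : Op (c × r)} (hE : E.PosSemidef)
    (hE' : (1 - E).PosSemidef) (htr : E.trace = 1) :
    IsCPTNI (probe Λ E E) ∧ IsCPTNI (probe Λ (1 - E) E) ∧
      IsCPTP (probe Λ E E + probe Λ (1 - E) E) := by
  have h1 := isCP_probe hΛ.1 hE hE
  have h2 := isCP_probe hΛ.1 hE' hE
  have h3 : ∀ Y, ((probe Λ E E + probe Λ (1 - E) E) Y).trace = Y.trace := fun Y => by
    rw [probe_add_sub]; exact trace_probe_one hΛ.2 htr Y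
  refine ⟨IsCPTP.isCPTNI_of_add h3 h1 h2, IsCPTP.isCPTNI_of_add (N := probe Λ E E) ?_ h2 h1,
    h1.add h2, h3⟩
  intro X
  rw [add_comm]
  exact h3 X

theorem posSemidef_one_sub_of_mul_self_eq [DecidableEq a] {E : Op a} (hE : E.PosSemidef)
    (hi : E * E = E) : (1 - E).PosSemidef := by
  have h : 1 - E = (1 - E)ᴴ * (1 - E) := by
    rw [conjTranspose_sub, conjTranspose_one, hE.1.eq, Matrix.sub_mul, Matrix.mul_sub,
      Matrix.mul_sub, hi]
    simp
  rw [h]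
  exact posSemidef_conjTranspose_mul_self _

theorem maxEnt_mul_self [DecidableEq a] [Nonempty a] : maxEnt a * maxEnt a = maxEnt a := by
  have hc : (Fintype.card a : ℂ) ≠ 0 := by exact_mod_cast Fintype.card_ne_zero
  ext p q
  by_cases hp : p.1 = p.2 <;> by_cases hq : q.1 = q.2 <;>
    simp [maxEnt, Matrix.mul_apply, Fintype.sum_prod_type, hp, hq, hc, ite_and]

theorem maxEnt_posSemidef [DecidableEq a] : (maxEnt a).PosSemidef := by
  have h : maxEnt a = ((Fintype.card a : ℝ)⁻¹ : ℝ) •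
      vecMulVec (fun p : a × a => if p.1 = p.2 then (1 : ℂ) else 0)
      (star fun p : a × a => if p.1 = p.2 then (1 : ℂ) else 0) := by
    ext p q
    by_cases hp : p.1 = p.2 <;> by_cases hq : q.1 = q.2 <;>
      simp [maxEnt, vecMulVec_apply, hp, hq]
  rw [h]
  exact (posSemidef_vecMulVec_self_star _).smul (by positivity)

theorem trace_maxEnt [DecidableEq a] [Nonempty a] : (maxEnt a).trace = 1 := by
  have hc : (Fintype.card a : ℂ) ≠ 0 := by exact_mod_cast Fintype.card_ne_zero
  simp [maxEnt, Matrix.trace, Fintype.sum_prod_type, hc]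

theorem isDensity_maxEnt [DecidableEq a] [Nonempty a] : IsDensity (maxEnt a) :=
  ⟨maxEnt_posSemidef, trace_maxEnt⟩

/-- The diamond norm of a real combination of channels is at most the `ℓ¹` norm of the
coefficients. -/
theorem diamondNorm_sum_smul_le [DecidableEq a] [DecidableEq b] {κ : Type} [Fintype κ] (w : κ → ℝ)
    (L : κ → SuperOp a b) (hL : ∀ k, IsCPTP (L k)) :
    diamondNorm (∑ k, (w k : ℂ) • L k) ≤ ∑ k, |w k| := by
  refine diamondNorm_le _ (Finset.sum_nonneg fun _ _ => abs_nonneg _) fun ρ hρ => ?_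
  rw [onLeft_sum]
  simp only [onLeft_smul]
  refine (traceNorm_sum_smul_le w _ fun k => (hL k).1.posSemidef hρ.1).trans (le_of_eq ?_)
  refine Finset.sum_congr rfl fun k _ => ?_
  rw [trace_onLeft _ (hL k).2, hρ.2, Complex.one_re, mul_one]

end CP

/-! ### Turing machines that print circuit descriptions -/

section Uniform

open Turing StateTransition Computability

/-- `f` leads from `x` to `y` in exactly `n` steps. -/
def StepsTo {σ : Type} (f : σ → Option σ) (n : ℕ) (x y : σ) : Prop :=
  (flip bind f)^[n] (some x) = some y

theorem StepsTo.refl {σ : Type} (f : σ → Option σ) (x : σ) : StepsTo f 0 x x := rfl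

theorem StepsTo.single {σ : Type} {f : σ → Option σ} {x y : σ} (h : f x = some y) :
    StepsTo f 1 x y := h

theorem StepsTo.trans {σ : Type} {f : σ → Option σ} {m n : ℕ} {x y z : σ}
    (h₁ : StepsTo f m x y) (h₂ : StepsTo f n y z) : StepsTo f (m + n) x z := by
  unfold StepsTo at *
  rw [Nat.add_comm, Function.iterate_add_apply, h₁, h₂]

theorem unaryEncodeNat_eq (n : ℕ) : unaryEncodeNat n = List.replicate n true := by
  induction n with
  | zero => rfl
  | succ n ih => rw [List.replicate_succ, ← ih]; rfl

/-- Push the word `w` onto stack `k`, its first letter ending up on top. -/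
def pushWord {K Λ σ : Type} (k : K) : List Bool → TM2.Stmt (fun _ : K => Bool) Λ σ →
    TM2.Stmt (fun _ : K => Bool) Λ σ
  | [], q => q
  | b :: w, q => pushWord k w (TM2.Stmt.push k (fun _ => b) q)

theorem stepAux_pushWord {K Λ σ : Type} [DecidableEq K] (k : K) (w : List Bool)
    (q : TM2.Stmt (fun _ : K => Bool) Λ σ) (v : σ) (S : K → List Bool) :
    TM2.stepAux (pushWord k w q) v S = TM2.stepAux q v (Function.update S k (w ++ S k)) := by
  induction w generalizing q with
  | nil => simp [pushWord]
  | cons b w ih => rw [pushWord, ih, TM2.stepAux]; simp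

/-- A machine whose stacks are all binary and whose memory is the symbol popped last. -/
def binaryMachine {K Λ : Type} [DecidableEq K] [Fintype K] [Fintype Λ] (kin kout : K) (start : Λ)
    (M : Λ → TM2.Stmt (fun _ : K => Bool) Λ (Option Bool)) : FinTM2 where
  K := K
  k₀ := kin
  k₁ := kout
  Γ _ := Bool
  Λ := Λ
  main := start
  σ := Option Bool
  initialState := none
  m := M

theorem initList_binaryMachine {K Λ : Type} [DecidableEq K] [Fintype K] [Fintype Λ] (kin kout : K)
    (start : Λ) (M : Λ → TM2.Stmt (fun _ : K => Bool) Λ (Option Bool)) (w : List Bool) :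
    initList (binaryMachine kin kout start M) w =
      (⟨some start, none, fun k : K => if k = kin then w else []⟩ :
        TM2.Cfg (fun _ : K => Bool) Λ (Option Bool)) := by
  simp only [initList]
  congr 1

theorem haltList_binaryMachine {K Λ : Type} [DecidableEq K] [Fintype K] [Fintype Λ] (kin kout : K)
    (start : Λ) (M : Λ → TM2.Stmt (fun _ : K => Bool) Λ (Option Bool)) (w : List Bool) :
    haltList (binaryMachine kin kout start M) w =
      (⟨none, none, fun k : K => if k = kout then w else []⟩ :
        TM2.Cfg (fun _ : K => Bool) Λ (Option Bool)) := by
  simp only [haltList]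
  congr 1

theorem isUniform_of_stepsTo {K Λ : Type} [DecidableEq K] [Fintype K] [Fintype Λ] (kin kout : K)
    (start : Λ) (M : Λ → TM2.Stmt (fun _ : K => Bool) Λ (Option Bool)) {α : Type}
    (code : α → List ℕ) (c : ℕ → α) (time : Polynomial ℕ)
    (h : ∀ n, ∃ t ≤ time.eval n, StepsTo (TM2.step M) t
      ⟨some start, none, fun k => if k = kin then List.replicate n true else []⟩
      ⟨none, none, fun k => if k = kout then unaryCode (code (c n)) else []⟩) :
    IsUniform code c := by
  choose t ht hs using h
  refine ⟨{ tm := binaryMachine kin kout start M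
            inputAlphabet := Equiv.refl Bool
            outputAlphabet := Equiv.refl Bool
            time := time
            outputsFun := fun n => ⟨⟨t n, ?_⟩, ?_⟩ }⟩
  · have h1 : List.map (Equiv.refl Bool).invFun (unaryEncodeNat n) = List.replicate n true := by
      rw [unaryEncodeNat_eq]; exact List.map_id _
    have h2 : List.map (Equiv.refl Bool).invFun (unaryCode (code (c n))) = unaryCode (code (c n)) :=
      List.map_id _
    have h3 := (congrArg (initList (binaryMachine kin kout start M)) h1).trans
      (initList_binaryMachine kin kout start M _)
    have h4 := (congrArg (haltList (binaryMachine kin kout start M)) h2).trans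
      (haltList_binaryMachine kin kout start M _)
    exact (congrArg (fun x => (flip bind (TM2.step M))^[t n] (some x)) h3).trans
      (Eq.trans (hs n) (congrArg some h4).symm)
  · have h5 : (unaryEncodeNat n).length = n := by rw [unaryEncodeNat_eq, List.length_replicate]
    exact (ht n).trans_eq (congrArg time.eval h5.symm)

/-- A constant family of circuits is uniform: the machine erases its input and prints the
description. -/
theorem isUniform_const {α : Type} (code : α → List ℕ) (c : α) : IsUniform code fun _ => c := by
  set w := unaryCode (code c)
  let M : Unit → TM2.Stmt (fun _ : Bool => Bool) Unit (Option Bool) := fun _ =>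
    TM2.Stmt.pop false (fun _ o => o)
      (TM2.Stmt.branch (fun v => v.isSome) (TM2.Stmt.goto fun _ => ())
        (pushWord true w TM2.Stmt.halt))
  refine isUniform_of_stepsTo false true () M code _ (Polynomial.X + 1) fun n =>
    ⟨n + 1, by simp, ?_⟩
  have key : ∀ (n : ℕ) (v : Option Bool), StepsTo (TM2.step M) (n + 1)
      ⟨some (), v, fun k => if k = false then List.replicate n true else []⟩
      ⟨none, none, fun k => if k = true then w else []⟩ := by
    intro n
    induction n with
    | zero =>
      intro v
      apply StepsTo.single
      simp only [M, TM2.step, TM2.stepAux, stepAux_pushWord]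
      simp
      funext k
      cases k <;> simp
    | succ n ih =>
      intro v
      rw [Nat.add_comm (n + 1) 1]
      refine StepsTo.trans (StepsTo.single ?_) (ih (some true))
      simp only [M, TM2.step, TM2.stepAux]
      simp [List.replicate_succ]
      funext k
      cases k <;> simp
  exact key n none

/-- The configuration with label `l` and register `v`, the four stacks holding `inp`, `cnt`,
`tmp` and `out`. -/
def cfg4 {Λ : Type} (l : Option Λ) (v : Option Bool) (inp cnt tmp out : List Bool) :
    TM2.Cfg (fun _ : Fin 4 => Bool) Λ (Option Bool) :=
  ⟨l, v, ![inp, cnt, tmp, out]⟩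

theorem update_stack {β : Type} (x₀ x₁ x₂ x₃ y : β) :
    Function.update ![x₀, x₁, x₂, x₃] 0 y = ![y, x₁, x₂, x₃] ∧
    Function.update ![x₀, x₁, x₂, x₃] 1 y = ![x₀, y, x₂, x₃] ∧
    Function.update ![x₀, x₁, x₂, x₃] 2 y = ![x₀, x₁, y, x₃] ∧
    Function.update ![x₀, x₁, x₂, x₃] 3 y = ![x₀, x₁, x₂, y] := by
  refine ⟨?_, ?_, ?_, ?_⟩ <;> (funext k; fin_cases k <;> rfl)

/-- A loop that prints, for `i = 0, …, n - 1`, the words `pre ++ 1ⁱ ++ post`, preceded by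
`1ⁿ ++ head` and followed by `tail`. Label `0` starts; label `1` takes the next index; labels `2` and
`3` copy the index to the output and restore it; label `4` prints `1ⁿ`. -/
def loopProgram (head pre post tail : List Bool) :
    Fin 5 → TM2.Stmt (fun _ : Fin 4 => Bool) (Fin 5) (Option Bool)
  | 0 => pushWord 3 tail (TM2.Stmt.goto fun _ => 1)
  | 1 => TM2.Stmt.pop 0 (fun _ o => o)
      (TM2.Stmt.branch (fun v => v.isSome)
        (TM2.Stmt.push 1 (fun _ => true) (pushWord 3 post (TM2.Stmt.goto fun _ => 2)))
        (pushWord 3 head (TM2.Stmt.goto fun _ => 4)))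
  | 2 => TM2.Stmt.pop 0 (fun _ o => o)
      (TM2.Stmt.branch (fun v => v.isSome)
        (TM2.Stmt.push 2 (fun _ => true) (TM2.Stmt.push 3 (fun _ => true)
          (TM2.Stmt.goto fun _ => 2)))
        (pushWord 3 pre (TM2.Stmt.goto fun _ => 3)))
  | 3 => TM2.Stmt.pop 2 (fun _ o => o)
      (TM2.Stmt.branch (fun v => v.isSome)
        (TM2.Stmt.push 0 (fun _ => true) (TM2.Stmt.goto fun _ => 3))
        (TM2.Stmt.goto fun _ => 1))
  | 4 => TM2.Stmt.pop 1 (fun _ o => o)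
      (TM2.Stmt.branch (fun v => v.isSome)
        (TM2.Stmt.push 3 (fun _ => true) (TM2.Stmt.goto fun _ => 4))
        TM2.Stmt.halt)

section Loop

variable (head pre post tail : List Bool)

theorem loopProgram_copy (i : ℕ) (v : Option Bool) (cnt tmp out : List Bool) :
    StepsTo (TM2.step (loopProgram head pre post tail)) (i + 1)
      (cfg4 (some 2) v (List.replicate i true) cnt tmp out)
      (cfg4 (some 3) none [] cnt (List.replicate i true ++ tmp)
        (pre ++ (List.replicate i true ++ out))) := by
  induction i generalizing v tmp out with
  | zero =>
    apply StepsTo.single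
    simp [cfg4, TM2.step, loopProgram, stepAux_pushWord, update_stack]
  | succ i ih =>
    rw [Nat.add_comm (i + 1) 1]
    refine StepsTo.trans (StepsTo.single ?_) (by
      simpa [List.replicate_succ', List.append_assoc] using
        ih (some true) (true :: tmp) (true :: out))
    simp [cfg4, TM2.step, loopProgram, update_stack, List.replicate_succ]

theorem loopProgram_restore (i : ℕ) (v : Option Bool) (inp cnt out : List Bool) :
    StepsTo (TM2.step (loopProgram head pre post tail)) (i + 1)
      (cfg4 (some 3) v inp cnt (List.replicate i true) out)
      (cfg4 (some 1) none (List.replicate i true ++ inp) cnt [] out) := by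
  induction i generalizing v inp with
  | zero =>
    apply StepsTo.single
    simp [cfg4, TM2.step, loopProgram, update_stack]
  | succ i ih =>
    rw [Nat.add_comm (i + 1) 1]
    refine StepsTo.trans (StepsTo.single ?_) (by
      simpa [List.replicate_succ', List.append_assoc] using ih (some true) (true :: inp))
    simp [cfg4, TM2.step, loopProgram, update_stack, List.replicate_succ]

theorem loopProgram_count (i : ℕ) (v : Option Bool) (out : List Bool) :
    StepsTo (TM2.step (loopProgram head pre post tail)) (i + 1)
      (cfg4 (some 4) v [] (List.replicate i true) [] out)
      (cfg4 none none [] [] [] (List.replicate i true ++ out)) := by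
  induction i generalizing v out with
  | zero =>
    apply StepsTo.single
    simp [cfg4, TM2.step, loopProgram, update_stack]
  | succ i ih =>
    rw [Nat.add_comm (i + 1) 1]
    refine StepsTo.trans (StepsTo.single ?_) (by
      simpa [List.replicate_succ', List.append_assoc] using ih (some true) (true :: out))
    simp [cfg4, TM2.step, loopProgram, update_stack, List.replicate_succ]

theorem loopProgram_body (i : ℕ) (v : Option Bool) (cnt out : List Bool) :
    StepsTo (TM2.step (loopProgram head pre post tail)) (1 + ((i + 1) + (i + 1)))
      (cfg4 (some 1) v (List.replicate (i + 1) true) cnt [] out)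
      (cfg4 (some 1) none (List.replicate i true) (true :: cnt) []
        (pre ++ (List.replicate i true ++ (post ++ out)))) := by
  refine StepsTo.trans (StepsTo.single (y := cfg4 (some 2) (some true) (List.replicate i true)
    (true :: cnt) [] (post ++ out)) ?_) (StepsTo.trans (loopProgram_copy ..) ?_)
  · simp [cfg4, TM2.step, loopProgram, stepAux_pushWord, update_stack, List.replicate_succ]
  · simpa using loopProgram_restore head pre post tail i none [] (true :: cnt) _

theorem loopProgram_loop (n m : ℕ) (v : Option Bool) (out : List Bool) :
    ∃ t ≤ 2 * n ^ 2 + 5 * n + 5 + m, StepsTo (TM2.step (loopProgram head pre post tail)) t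
      (cfg4 (some 1) v (List.replicate n true) (List.replicate m true) [] out)
      (cfg4 none none [] [] [] (List.replicate (n + m) true ++ (head ++
        (((List.range n).flatMap fun i => pre ++ (List.replicate i true ++ post)) ++ out)))) := by
  induction n generalizing m v out with
  | zero =>
    refine ⟨1 + (m + 1), by omega, ?_⟩
    refine StepsTo.trans (StepsTo.single (y := cfg4 (some 4) none [] (List.replicate m true) []
      (head ++ out)) ?_) ?_
    · simp [cfg4, TM2.step, loopProgram, stepAux_pushWord, update_stack]
    · simpa using loopProgram_count head pre post tail m none (head ++ out)
  | succ n ih =>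
    obtain ⟨t, ht, h⟩ := ih (m + 1) none (pre ++ (List.replicate n true ++ (post ++ out)))
    refine ⟨1 + ((n + 1) + (n + 1)) + t, by nlinarith, ?_⟩
    have h' := (loopProgram_body head pre post tail n v (List.replicate m true) out).trans h
    rw [show n + 1 + m = n + (m + 1) by omega, List.range_succ, List.flatMap_append]
    simpa [List.append_assoc] using h'

end Loop

/-- A family of circuits whose description is a fixed pattern, repeated for every `i < n` with the
number `d + i` in it, is uniform. -/
theorem isUniform_of_loop {α : Type} (code : α → List ℕ) (c : ℕ → α) (a d : ℕ)
    (l₁ l₂ l₃ : List ℕ)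
    (hc : ∀ n, code (c n) =
      (n + a) :: (((List.range n).flatMap fun i => l₁ ++ (i + d) :: l₂) ++ l₃)) :
    IsUniform code c := by
  have hcode : ∀ l l', unaryCode (l ++ l') = unaryCode l ++ unaryCode l' := fun l l' =>
    List.flatMap_append
  have hcons : ∀ i d l, unaryCode ((i + d) :: l)
      = List.replicate i true ++ (List.replicate d true ++ false :: unaryCode l) := by
    intro i d l
    rw [← List.append_assoc, List.replicate_append_replicate]
    simp [unaryCode]
  refine isUniform_of_stepsTo 0 3 0 (loopProgram (List.replicate a true ++ [false]) (unaryCode l₁)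
    (List.replicate d true ++ false :: unaryCode l₂) (unaryCode l₃)) code c
    (2 * Polynomial.X ^ 2 + 5 * Polynomial.X + 6) fun n => ?_
  obtain ⟨t, ht, h⟩ := loopProgram_loop (List.replicate a true ++ [false]) (unaryCode l₁)
    (List.replicate d true ++ false :: unaryCode l₂) (unaryCode l₃) n 0 none (unaryCode l₃)
  have hin : (fun k : Fin 4 => if k = 0 then List.replicate n true else [])
      = ![List.replicate n true, [], [], []] := by
    funext k; fin_cases k <;> rfl
  have hout : (fun k : Fin 4 => if k = 3 then unaryCode (code (c n)) else [])
      = ![[], [], [], unaryCode (code (c n))] := by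
    funext k; fin_cases k <;> rfl
  have hflat : unaryCode ((List.range n).flatMap fun i => l₁ ++ (i + d) :: l₂) =
      (List.range n).flatMap fun i => unaryCode l₁ ++
        (List.replicate i true ++ (List.replicate d true ++ false :: unaryCode l₂)) := by
    simp only [← hcons, ← hcode]
    rw [unaryCode, List.flatMap_assoc]
    rfl
  rw [hin, hout, hc, hcons, hcode, hflat]
  refine ⟨1 + t, ?_, StepsTo.trans (StepsTo.single (y := cfg4 (some 1) none
    (List.replicate n true) (List.replicate 0 true) [] (unaryCode l₃)) ?_) ?_⟩
  · simp; omega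
  · simp [cfg4, TM2.step, loopProgram, stepAux_pushWord, update_stack]
  · simpa [cfg4, List.append_assoc] using h

end Uniform

/-! ### Circuits acting on one quantum wire under classical control -/

section Circuits

/-- The Hadamard matrix. -/
def hadMat : Op Bool := of fun y x => (if x && y then -1 else 1) * ((Real.sqrt 2 : ℂ))⁻¹

/-- The matrix `diag(1, exp(iπ/4))`. -/
def tMat : Op Bool := diagonal fun x => if x then Complex.exp (Real.pi * Complex.I / 4) else 1

/-- The power `X^b` of the Pauli matrix `X`. -/
def xMat (b : Bool) : Op Bool := of fun y x => if y = xor x b then 1 else 0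

/-- The action of a gate on wire `0`, the values of the other wires being given by `f`. -/
def QGate.act (f : ℕ → Bool) : QGate → Op Bool
  | had _ => hadMat
  | tgate _ => tMat
  | cnot i _ => xMat (f i)

/-- The gate acts on wire `0`, controlled at most by another existing wire. -/
def QGate.OnZero (w : ℕ) : QGate → Prop
  | had i => i = 0
  | tgate i => i = 0
  | cnot i j => j = 0 ∧ i ≠ 0 ∧ i < w

/-- The action on wire `0` of a list of gates, the values of the other wires being given by `f`. -/
def word (f : ℕ → Bool) (l : List QGate) : Op Bool :=
  l.foldl (fun U g => g.act f * U) 1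

/-- The vector `v ⊗ |f⟩`, where wire `0` carries `v` and every other wire `l` the bit `f l`. -/
def prodState (w : ℕ) (v : Bool → ℂ) (f : ℕ → Bool) : Bits w → ℂ := fun z =>
  if ∀ l : Fin w, l.val ≠ 0 → z l = f l then v (wire z 0) else 0

theorem foldl_act_mul (f : ℕ → Bool) (l : List QGate) (U : Op Bool) :
    l.foldl (fun U g => g.act f * U) U = word f l * U := by
  induction l generalizing U with
  | nil => simp [word]
  | cons g l ih =>
    have h : word f (g :: l) = word f l * g.act f := by
      unfold word
      rw [List.foldl_cons, ih, Matrix.mul_one, word]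
    rw [List.foldl_cons, ih, h, Matrix.mul_assoc]

theorem word_nil (f : ℕ → Bool) : word f [] = 1 := rfl

theorem word_cons (f : ℕ → Bool) (g : QGate) (l : List QGate) :
    word f (g :: l) = word f l * g.act f := by
  rw [word, List.foldl_cons, foldl_act_mul, Matrix.mul_one]

theorem word_append (f : ℕ → Bool) (l l' : List QGate) :
    word f (l ++ l') = word f l' * word f l := by
  rw [word, List.foldl_append, foldl_act_mul]; rfl

theorem sum_bits_cons {β : Type} [AddCommMonoid β] {n : ℕ} (f : Bits (n + 1) → β) :
    ∑ y, f y = ∑ b : Bool, ∑ x : Bits n, f (Fin.cons b x) := by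
  rw [← (Fin.consEquiv fun _ => Bool).sum_comp, Fintype.sum_prod_type]
  rfl

theorem forall_ne_zero_cons_iff {n : ℕ} (b : Bool) (x : Bits n) (f : Fin (n + 1) → Bool) :
    (∀ l : Fin (n + 1), l.val ≠ 0 → (Fin.cons b x : Bits (n + 1)) l = f l) ↔
      x = fun l => f l.succ := by
  constructor
  · intro h
    funext l
    have := h l.succ (by simp)
    simpa using this
  · rintro rfl l hl
    obtain ⟨m, rfl⟩ := Fin.exists_succ_eq.2 (fun h : l = 0 => hl (by simp [h]))
    simp

theorem prodState_cons (n : ℕ) (v : Bool → ℂ) (f : ℕ → Bool) (b : Bool) (x : Bits n) :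
    prodState (n + 1) v f (Fin.cons b x) = if x = fun l => f (l.val + 1) then v b else 0 := by
  have h := forall_ne_zero_cons_iff b x fun l => f l
  simp only [Fin.val_succ] at h
  simp only [prodState, h]
  simp [wire]

theorem QGate.matrix_mulVec_prodState {w : ℕ} (hw : 0 < w) (g : QGate) (hg : g.OnZero w)
    (v : Bool → ℂ) (f : ℕ → Bool) :
    g.matrix w *ᵥ prodState w v f = prodState w (g.act f *ᵥ v) f := by
  obtain ⟨n, rfl⟩ : ∃ n, w = n + 1 := ⟨w - 1, by omega⟩
  ext y
  rw [← Fin.cons_self_tail y]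
  generalize y 0 = b
  generalize Fin.tail y = y'
  rw [mulVec, dotProduct, sum_bits_cons, prodState_cons]
  simp only [prodState_cons]
  cases g with
  | had i =>
    obtain rfl : i = 0 := hg
    have h : ∀ c x, (∀ l : Fin (n + 1), l.val ≠ 0 →
        (Fin.cons b y' : Bits (n + 1)) l = (Fin.cons c x : Bits (n + 1)) l) ↔ y' = x := by
      intro c x
      simpa using forall_ne_zero_cons_iff b y' (Fin.cons c x : Bits (n + 1))
    simp only [QGate.matrix, of_apply, h]
    by_cases hy : y' = fun l => f (l.val + 1)
    · simp [QGate.act, hadMat, mulVec, dotProduct, hy, wire]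
    · simp [hy]
  | tgate i =>
    obtain rfl : i = 0 := hg
    have h : ∀ c x, (Fin.cons b y' : Bits (n + 1)) = (Fin.cons c x : Bits (n + 1)) ↔
        c = b ∧ x = y' := by
      intro c x
      rw [Fin.cons_inj, eq_comm, @eq_comm _ y']
    simp only [QGate.matrix, diagonal_apply, h]
    by_cases hy : y' = fun l => f (l.val + 1)
    · simp [QGate.act, tMat, mulVec, dotProduct, hy, wire, diagonal_apply, ite_and]
    · simp [hy, Ne.symm hy, ite_and]
  | cnot i j =>
    obtain ⟨rfl, hi0, hi⟩ := hg
    obtain ⟨i, rfl⟩ : ∃ m, i = m + 1 := ⟨i - 1, by omega⟩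
    have h : ∀ c x, ((Fin.cons b y' : Bits (n + 1)) = fun l : Fin (n + 1) =>
        if l.val = 0 ∧ i + 1 ≠ 0 then xor ((Fin.cons c x : Bits (n + 1)) l)
          (wire (Fin.cons c x : Bits (n + 1)) (i + 1)) else (Fin.cons c x : Bits (n + 1)) l) ↔
        x = y' ∧ b = xor c (y' ⟨i, by omega⟩) := by
      intro c x
      have hw : wire (Fin.cons c x : Bits (n + 1)) (i + 1) = x ⟨i, by omega⟩ := by
        rw [wire, dif_pos hi]
        exact Fin.cons_succ (α := fun _ => Bool) c x (⟨i, by omega⟩ : Fin n)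
      rw [hw, funext_iff, Fin.forall_fin_succ, funext_iff]
      simp only [Fin.cons_zero, Fin.cons_succ, Fin.val_zero, Fin.val_succ]
      constructor
      · rintro ⟨h1, h2⟩
        have h3 : ∀ l, x l = y' l := fun l => by simpa using (h2 l).symm
        refine ⟨h3, ?_⟩
        rw [← h3]; simpa using h1
      · rintro ⟨h1, h2⟩
        refine ⟨by rw [h2, ← h1]; simp, fun l => by simp [h1]⟩
    simp only [QGate.matrix, of_apply, h]
    by_cases hy : y' = fun l => f (l.val + 1)
    · simp [QGate.act, xMat, mulVec, dotProduct, hy, ite_and]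
    · simp [hy, Ne.symm hy, ite_and]

/-- A CNOT between classical wires updates the classical bits. -/
theorem cnot_mulVec_prodState {w i j : ℕ} (hi : i ≠ 0) (hj : j ≠ 0) (hij : i ≠ j) (hiw : i < w)
    (v : Bool → ℂ) (f : ℕ → Bool) :
    (QGate.cnot i j).matrix w *ᵥ prodState w v f
      = prodState w v (Function.update f j (xor (f j) (f i))) := by
  set φ : Bits w → Bits w := fun x l => if l.val = j ∧ i ≠ j then xor (x l) (wire x i) else x l
    with hφ
  have hwire : ∀ x, wire (φ x) i = wire x i := fun x => by simp [wire, hiw, hφ, hij]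
  have hinv : ∀ x, φ (φ x) = x := by
    intro x
    funext l
    by_cases hl : l.val = j
    · have h1 : φ x l = xor (x l) (wire x i) := by simp [hφ, hl, hij]
      have h2 : φ (φ x) l = xor (φ x l) (wire (φ x) i) := by simp [hφ, hl, hij]
      rw [h2, h1, hwire]; simp
    · simp [hφ, hl]
  ext y
  have h1 : ∀ x, y = φ x ↔ x = φ y := fun x =>
    ⟨fun h => by rw [h, hinv], fun h => by rw [h, hinv]⟩
  simp only [mulVec, dotProduct, QGate.matrix, of_apply]
  change ∑ x, (if y = φ x then 1 else 0) * prodState w v f x = _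
  simp only [h1]
  rw [Finset.sum_eq_single (φ y) (by intro x _ hx; simp [hx]) (by simp)]
  have h0 : wire (φ y) 0 = wire y 0 := by
    simp only [wire]
    split_ifs with h
    · simp [hφ, hj.symm]
    · rfl
  have hcond : (∀ l : Fin w, l.val ≠ 0 → φ y l = f l) ↔
      ∀ l : Fin w, l.val ≠ 0 → y l = Function.update f j (xor (f j) (f i)) l := by
    have hwi : wire y i = y ⟨i, hiw⟩ := by simp [wire, hiw]
    constructor
    · intro h l hl
      have hyi : y ⟨i, hiw⟩ = f i := by
        have := h ⟨i, hiw⟩ hi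
        simpa [hφ, hij] using this
      by_cases hlj : l.val = j
      · have := h l hl
        simp only [hφ, hlj, hij, ne_eq, not_false_eq_true, and_self, if_true, hwi, hyi] at this
        rw [hlj, Function.update_self, ← this]; simp
      · have := h l hl
        simp only [hφ, hlj, false_and, if_false] at this
        rw [Function.update_of_ne hlj, this]
    · intro h l hl
      have hyi : y ⟨i, hiw⟩ = f i := by
        have := h ⟨i, hiw⟩ hi
        simpa [hij] using this
      by_cases hlj : l.val = j
      · have := h l hl
        rw [hlj, Function.update_self] at this
        simp only [hφ, hlj, hij, ne_eq, not_false_eq_true, and_self, if_true, hwi, hyi, this]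
        simp
      · have := h l hl
        rw [Function.update_of_ne hlj] at this
        simp only [hφ, hlj, false_and, if_false, this]
  simp only [prodState, hcond, h0, if_true, one_mul]

end Circuits

/-! ### Channels of circuits -/

section Circuits

/-- The initial value of wire `l`: the quantum input `x`, then the classical input `k`, then
zeros. -/
def startVal {a κ : ℕ} (k : Bits κ) (x : Bits a) (l : ℕ) : Bool :=
  if h : l < a + κ then Fin.append x k ⟨l, h⟩ else false

theorem startVal_left {a κ : ℕ} (k : Bits κ) (x : Bits a) (l : Fin a) :
    startVal k x l = x l := by
  rw [startVal, dif_pos (by omega)]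
  exact Fin.append_left x k l

theorem startVal_right {a κ : ℕ} (k : Bits κ) (x : Bits a) (l : Fin κ) :
    startVal k x (a + l) = k l := by
  rw [startVal, dif_pos (by omega)]
  exact Fin.append_right x k l

theorem startVal_congr {a κ : ℕ} (k : Bits κ) (x x' : Bits a) {l : ℕ} (hl : a ≤ l) :
    startVal k x l = startVal k x' l := by
  by_cases h : l < a + κ
  · obtain ⟨m, rfl⟩ := Nat.exists_eq_add_of_le hl
    rw [startVal_right k x ⟨m, by omega⟩, startVal_right k x' ⟨m, by omega⟩]
  · rw [startVal, startVal, dif_neg h, dif_neg h]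

theorem inject_eq_prodState (c : QCircuit) {a κ : ℕ} (ha : 0 < a) (k : Bits κ) (x : Bits a)
    (hw : 0 < c.width) :
    (fun z => c.inject a k z x) = prodState c.width (Pi.single (x ⟨0, ha⟩) 1) (startVal k x) := by
  funext z
  have h0 : startVal k x 0 = x ⟨0, ha⟩ := startVal_left k x ⟨0, ha⟩
  have hz : z = c.startWires k x ↔ (∀ l : Fin c.width, l.val ≠ 0 → z l = startVal k x l) ∧
      wire z 0 = x ⟨0, ha⟩ := by
    have hw0 : wire z 0 = z ⟨0, hw⟩ := by rw [wire, dif_pos hw]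
    constructor
    · rintro rfl
      refine ⟨fun l _ => rfl, ?_⟩
      rw [hw0, ← h0]; rfl
    · rintro ⟨h1, h2⟩
      funext l
      by_cases hl : l.val = 0
      · have : l = ⟨0, hw⟩ := Fin.ext hl
        rw [this, ← hw0, h2, ← h0]; rfl
      · rw [h1 l hl]; rfl
  simp only [QCircuit.inject, of_apply, prodState, hz, Pi.single_apply, ite_and]

theorem unitary_mulVec (c : QCircuit) (ψ : Bits c.width → ℂ) :
    c.unitary *ᵥ ψ = c.gates.foldl (fun ψ g => g.matrix c.width *ᵥ ψ) ψ := by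
  have h : ∀ (l : List QGate) (U : Op (Bits c.width)),
      l.foldl (fun U g => g.matrix c.width * U) U *ᵥ ψ
        = l.foldl (fun ψ g => g.matrix c.width *ᵥ ψ) (U *ᵥ ψ) := by
    intro l
    induction l with
    | nil => intro U; rfl
    | cons g l ih => intro U; rw [List.foldl_cons, List.foldl_cons, ih, mulVec_mulVec]
  rw [QCircuit.unitary, h, one_mulVec]

theorem foldl_mulVec_prodState {w : ℕ} (hw : 0 < w) (l : List QGate) (hl : ∀ g ∈ l, g.OnZero w)
    (v : Bool → ℂ) (f : ℕ → Bool) :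
    l.foldl (fun ψ g => g.matrix w *ᵥ ψ) (prodState w v f) = prodState w (word f l *ᵥ v) f := by
  induction l generalizing v with
  | nil => simp [word_nil]
  | cons g l ih =>
    rw [List.foldl_cons, QGate.matrix_mulVec_prodState hw g (hl g (by simp)),
      ih (fun g' hg' => hl g' (by simp [hg'])), word_cons, mulVec_mulVec]

/-- Moving the content of wire `1` to a fresh wire `p`. -/
def clearOne (p : ℕ) : List QGate := [QGate.cnot 1 p, QGate.cnot p 1]

theorem foldl_clearOne {w p : ℕ} (hp : 1 < p) (hpw : p < w) (v : Bool → ℂ) (f : ℕ → Bool)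
    (hf : f p = false) :
    (clearOne p).foldl (fun ψ g => g.matrix w *ᵥ ψ) (prodState w v f)
      = prodState w v (Function.update (Function.update f p (f 1)) 1 false) := by
  simp only [clearOne, List.foldl_cons, List.foldl_nil]
  rw [cnot_mulVec_prodState (by omega) (by omega) (by omega) (by omega),
    cnot_mulVec_prodState (by omega) (by omega) (by omega) hpw]
  congr 2
  · rw [hf, Bool.false_xor]
  · rw [Function.update_self, Function.update_of_ne (by omega), hf]; simp

theorem ite_mul_mul_star_ite (P Q R : Prop) [Decidable P] [Decidable Q] [Decidable R]
    [Decidable (P ∧ Q ∧ R)] (x y z : ℂ) :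
    (if P then (if Q then x else 0) * y * star (if R then z else 0) else 0) =
      if P ∧ Q ∧ R then x * y * star z else 0 := by
  by_cases hP : P <;> by_cases hQ : Q <;> by_cases hR : R <;> simp [hP, hQ, hR]

/-- The channel of a circuit all of whose columns are product states: wires `l ≥ b` are traced out,
so that they contribute the condition that their bits agree. -/
theorem channel_apply (c : QCircuit) {a b κ : ℕ} (k : Bits κ) (hb : 0 < b) (hbw : b ≤ c.width)
    (v : Bits a → Bool → ℂ) (f : Bits a → ℕ → Bool)
    (hcol : ∀ x, c.unitary *ᵥ (fun z => c.inject a k z x) = prodState c.width (v x) (f x))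
    (X : Op (Bits a)) (y y' : Bits b) :
    c.channel a b k X y y' = ∑ x, ∑ x',
      if (∀ l, b ≤ l → l < c.width → f x l = f x' l) ∧ (∀ i : Fin b, i.val ≠ 0 → y i = f x i) ∧
          (∀ i : Fin b, i.val ≠ 0 → y' i = f x' i)
      then v x (y ⟨0, hb⟩) * X x x' * star (v x' (y' ⟨0, hb⟩)) else 0 := by
  have hM : ∀ z x, (c.unitary * c.inject a k) z x = prodState c.width (v x) (f x) z := by
    intro z x; rw [← hcol]; rfl
  have hLHS : c.channel a b k X y y' = ∑ z : Bits c.width, ∑ z' : Bits c.width, ∑ x, ∑ x',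
      if (∀ i : Fin b, wire z i = y i) ∧ (∀ i : Fin b, wire z' i = y' i) ∧
        (∀ i : Fin c.width, b ≤ i.val → z i = z' i) then
        prodState c.width (v x) (f x) z * X x x' * star (prodState c.width (v x') (f x') z')
      else 0 := by
    simp only [QCircuit.channel, LinearMap.comp_apply, QCircuit.keepFirst, conjMap,
      LinearMap.coe_mk, AddHom.coe_mk, of_apply]
    refine Finset.sum_congr rfl fun z _ => Finset.sum_congr rfl fun z' _ => ?_
    split_ifs with h
    · rw [Matrix.mul_apply]
      simp only [Matrix.mul_apply (M := c.unitary * c.inject a k), conjTranspose_apply, hM,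
        Finset.sum_mul]
      rw [Finset.sum_comm]
    · simp
  rw [hLHS]
  have hswap : ∀ F : Bits c.width → Bits c.width → Bits a → Bits a → ℂ,
      ∑ z, ∑ z', ∑ x, ∑ x', F z z' x x' = ∑ x, ∑ x', ∑ z, ∑ z', F z z' x x' := by
    intro F
    calc _ = ∑ z, ∑ x, ∑ z', ∑ x', F z z' x x' :=
          Finset.sum_congr rfl fun z _ => Finset.sum_comm
      _ = ∑ x, ∑ z, ∑ z', ∑ x', F z z' x x' := Finset.sum_comm
      _ = ∑ x, ∑ z, ∑ x', ∑ z', F z z' x x' :=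
          Finset.sum_congr rfl fun x _ => Finset.sum_congr rfl fun z _ => Finset.sum_comm
      _ = _ := Finset.sum_congr rfl fun x _ => Finset.sum_comm
  rw [hswap]
  refine Finset.sum_congr rfl fun x _ => Finset.sum_congr rfl fun x' _ => ?_
  -- the only basis state that is compatible with the output `u` and the classical bits `g`
  let Z : Bits b → (ℕ → Bool) → Bits c.width := fun u g l =>
    if h : l.val < b then u ⟨l, h⟩ else g l
  have huniq : ∀ (z : Bits c.width) (u : Bits b) (g : ℕ → Bool),
      (∀ i : Fin b, wire z i = u i) → (∀ l : Fin c.width, l.val ≠ 0 → z l = g l) → z = Z u g := by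
    intro z u g h1 h2
    funext l
    by_cases hl : l.val < b
    · have := h1 ⟨l, hl⟩
      simp only [wire, l.2, dif_pos] at this
      simp [Z, hl, this]
    · rw [h2 l (by omega)]; simp [Z, hl]
  have hps : ∀ (z : Bits c.width) (u : Bits b) (w : Bool → ℂ) (g : ℕ → Bool),
      (∀ i : Fin b, wire z i = u i) → z ≠ Z u g → prodState c.width w g z = 0 := by
    intro z u w g h1 h2
    rw [prodState, if_neg fun h3 => h2 (huniq z u g h1 h3)]
  rw [Finset.sum_eq_single (Z y (f x)), Finset.sum_eq_single (Z y' (f x'))]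
  · have hw1 : ∀ (u : Bits b) (g : ℕ → Bool), ∀ i : Fin b, wire (Z u g) i = u i := by
      intro u g i
      have : i.val < c.width := by omega
      simp [wire, this, Z]
    have hpz : ∀ (u : Bits b) (w : Bool → ℂ) (g : ℕ → Bool), prodState c.width w g (Z u g) =
        if ∀ i : Fin b, i.val ≠ 0 → u i = g i then w (u ⟨0, hb⟩) else 0 := by
      intro u w g
      have h1 : (∀ l : Fin c.width, l.val ≠ 0 → Z u g l = g l) ↔
          ∀ i : Fin b, i.val ≠ 0 → u i = g i := by
        constructor
        · intro h i hi
          have := h ⟨i, by omega⟩ hi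
          simpa [Z] using this
        · intro h l hl
          by_cases hlb : l.val < b
          · simpa [Z, hlb] using h ⟨l, hlb⟩ hl
          · simp [Z, hlb]
      rw [prodState]
      simp only [h1]
      rw [show wire (Z u g) 0 = u ⟨0, hb⟩ from hw1 u g ⟨0, hb⟩]
    have htr : (∀ i : Fin c.width, b ≤ i.val → Z y (f x) i = Z y' (f x') i) ↔
        ∀ l, b ≤ l → l < c.width → f x l = f x' l := by
      constructor
      · intro h l h1 h2
        have := h ⟨l, h2⟩ h1
        simpa [Z, Nat.not_lt.2 h1] using this
      · intro h i hi
        simpa [Z, Nat.not_lt.2 hi] using h i hi i.2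
    simp only [hpz, htr, hw1, implies_true, true_and]
    exact ite_mul_mul_star_ite _ _ _ _ _ _
  · intro z' _ hz'
    split_ifs with h
    · rw [hps z' y' _ _ h.2.1 hz']; simp
    · rfl
  · simp
  · intro z _ hz
    refine Finset.sum_eq_zero fun z' _ => ?_
    split_ifs with h
    · rw [hps z y _ _ h.1 hz]; simp
    · rfl
  · simp

theorem channel_mk_apply (w : ℕ) (l : List QGate) {a b κ : ℕ} (k : Bits κ) (hb : 0 < b)
    (hbw : b ≤ w) (v : Bits a → Bool → ℂ) (f : Bits a → ℕ → Bool)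
    (hcol : ∀ x, (QCircuit.mk w l).unitary *ᵥ (fun z => (QCircuit.mk w l).inject a k z x)
      = prodState w (v x) (f x)) (X : Op (Bits a)) (y y' : Bits b) :
    (QCircuit.mk w l).channel a b k X y y' = ∑ x, ∑ x',
      if (∀ l, b ≤ l → l < w → f x l = f x' l) ∧ (∀ i : Fin b, i.val ≠ 0 → y i = f x i) ∧
          (∀ i : Fin b, i.val ≠ 0 → y' i = f x' i)
      then v x (y ⟨0, hb⟩) * X x x' * star (v x' (y' ⟨0, hb⟩)) else 0 :=
  channel_apply _ k hb hbw v f hcol X y y'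

/-- A one-qubit operator, acting on a register of one qubit. -/
def bitOp (U : Op Bool) : Op (Bits 1) := of fun y x => U (y 0) (x 0)

theorem conjMap_apply {a b : Type} [Fintype a] (V : Matrix b a ℂ) (X : Op a) (y y' : b) :
    conjMap V X y y' = ∑ x, ∑ x', V y x * X x x' * star (V y' x') := by
  simp only [conjMap, LinearMap.coe_mk, AddHom.coe_mk, Matrix.mul_apply, conjTranspose_apply,
    Finset.sum_mul]
  rw [Finset.sum_comm]

theorem mulVec_single_one_apply (U : Op Bool) (b c : Bool) :
    (U *ᵥ Pi.single b 1) c = U c b := by simp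

/-- The columns of a circuit of gates acting on wire `0`. -/
theorem unitary_mulVec_inject (w : ℕ) (l l' : List QGate) {a κ : ℕ} (ha : 0 < a) (hw : 0 < w)
    (hl : ∀ g ∈ l, g.OnZero w) (k : Bits κ) (x : Bits a) :
    (QCircuit.mk w (l ++ l')).unitary *ᵥ (fun z => (QCircuit.mk w (l ++ l')).inject a k z x) =
      l'.foldl (fun ψ g => g.matrix w *ᵥ ψ) (prodState w
        (word (startVal k x) l *ᵥ Pi.single (x ⟨0, ha⟩) 1) (startVal k x)) := by
  rw [inject_eq_prodState _ ha k x hw, unitary_mulVec, List.foldl_append,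
    foldl_mulVec_prodState hw l hl]

theorem unitary_mulVec_inject_nil (w : ℕ) (l : List QGate) {a κ : ℕ} (ha : 0 < a) (hw : 0 < w)
    (hl : ∀ g ∈ l, g.OnZero w) (k : Bits κ) (x : Bits a) :
    (QCircuit.mk w l).unitary *ᵥ (fun z => (QCircuit.mk w l).inject a k z x) =
      prodState w (word (startVal k x) l *ᵥ Pi.single (x ⟨0, ha⟩) 1) (startVal k x) := by
  rw [inject_eq_prodState _ ha k x hw, unitary_mulVec, foldl_mulVec_prodState hw l hl]

/-- One qubit in, one qubit out. -/
theorem channel_one_one (w : ℕ) (l : List QGate) {κ : ℕ} (hw : 0 < w)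
    (hl : ∀ g ∈ l, g.OnZero w) (k : Bits κ) (U : Op Bool)
    (hU : ∀ x : Bits 1, word (startVal k x) l = U) :
    (QCircuit.mk w l).channel 1 1 k = conjMap (bitOp U) := by
  ext X y y'
  have hcol := fun x => unitary_mulVec_inject_nil w l Nat.one_pos hw hl k x
  simp only [hU] at hcol
  rw [channel_mk_apply _ _ k Nat.one_pos hw _ _ hcol, conjMap_apply]
  refine Finset.sum_congr rfl fun x _ => Finset.sum_congr rfl fun x' _ => ?_
  rw [if_pos]
  · rw [mulVec_single_one_apply, mulVec_single_one_apply]; rfl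
  · exact ⟨fun l h1 _ => startVal_congr k x x' h1, fun i hi => absurd i.2 (by omega),
      fun i hi => absurd i.2 (by omega)⟩

/-- One qubit in, a second qubit in state `|0⟩` appended to the output. -/
theorem channel_one_two (w p : ℕ) (l : List QGate) {κ : ℕ} (hp : κ < p) (hp1 : 1 < p) (hpw : p < w)
    (hl : ∀ g ∈ l, g.OnZero w) (k : Bits κ) (U : Op Bool)
    (hU : ∀ x : Bits 1, word (startVal k x) l = U) :
    (QCircuit.mk w (l ++ clearOne p)).channel 1 2 k = appendZero 1 ∘ₗ conjMap (bitOp U) := by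
  ext X y y'
  have hfp : ∀ x : Bits 1, startVal k x p = false := fun x => by
    rw [startVal, dif_neg (by omega)]
  have hcol := fun x => unitary_mulVec_inject w l (clearOne p) Nat.one_pos (by omega) hl k x
  simp only [hU] at hcol
  have hcol2 := fun x => (hcol x).trans (foldl_clearOne hp1 hpw _ _ (hfp x))
  rw [channel_mk_apply _ _ k Nat.two_pos (by omega) _ _ hcol2]
  have hA : ∀ x x' : Bits 1, ∀ l, 2 ≤ l → l < w →
      Function.update (Function.update (startVal k x) p (startVal k x 1)) 1 false l =
      Function.update (Function.update (startVal k x') p (startVal k x' 1)) 1 false l := by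
    intro x x' l h1 _
    have hl1 : l ≠ 1 := by omega
    by_cases h : l = p
    · simp [h, hp1.ne', startVal_congr k x x' le_rfl]
    · simp [hl1, h, startVal_congr k x x' (show 1 ≤ l by omega)]
  have hB : ∀ (x : Bits 1) (u : Bits 2), (∀ i : Fin 2, i.val ≠ 0 → u i =
      Function.update (Function.update (startVal k x) p (startVal k x 1)) 1 false i) ↔
      u 1 = false := by
    intro x u
    simp [Fin.forall_fin_two]
  simp only [fun x x' => iff_true_intro (hA x x'), hB, true_and, LinearMap.comp_apply, appendZero, LinearMap.coe_mk,
    AddHom.coe_mk, of_apply, conjMap_apply, mulVec_single_one_apply]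
  rw [show (Fin.last 1 : Fin 2) = 1 from rfl]
  by_cases h1 : y 1 = false ∧ y' 1 = false
  · rw [if_pos h1]
    simp only [h1, and_self, if_true]
    rfl
  · rw [if_neg h1]
    simp only [h1, if_false, Finset.sum_const_zero]

/-- Two qubits in, the second one replaced by `|0⟩`. -/
theorem channel_two_two_clear (w p : ℕ) (l : List QGate) {κ : ℕ} (hp : κ + 1 < p) (hpw : p < w)
    (hl : ∀ g ∈ l, g.OnZero w) (k : Bits κ) (U : Op Bool)
    (hU : ∀ x : Bits 2, word (startVal k x) l = U) :
    (QCircuit.mk w (l ++ clearOne p)).channel 2 2 k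
      = appendZero 1 ∘ₗ conjMap (bitOp U) ∘ₗ dropLast 1 := by
  ext X y y'
  have hfp : ∀ x : Bits 2, startVal k x p = false := fun x => by
    rw [startVal, dif_neg (by omega)]
  have hcol := fun x => unitary_mulVec_inject w l (clearOne p) Nat.two_pos (by omega) hl k x
  simp only [hU] at hcol
  have hcol2 := fun x => (hcol x).trans (foldl_clearOne (by omega) hpw _ _ (hfp x))
  rw [channel_mk_apply _ _ k Nat.two_pos (by omega) _ _ hcol2]
  have hA : ∀ x x' : Bits 2, (∀ l, 2 ≤ l → l < w →
      Function.update (Function.update (startVal k x) p (startVal k x 1)) 1 false l =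
      Function.update (Function.update (startVal k x') p (startVal k x' 1)) 1 false l) ↔
      x 1 = x' 1 := by
    intro x x'
    have hp1 : p ≠ 1 := by omega
    have e : ∀ x : Bits 2, startVal k x 1 = x 1 := fun x => startVal_left k x 1
    simp only [e]
    constructor
    · intro h
      simpa [hp1] using h p (by omega) hpw
    · intro h l h1 _
      have hl1 : l ≠ 1 := by omega
      by_cases hlp : l = p
      · simp [hlp, hp1, h]
      · simp [hl1, hlp, startVal_congr k x x' h1]
  have hB : ∀ (x : Bits 2) (u : Bits 2), (∀ i : Fin 2, i.val ≠ 0 → u i =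
      Function.update (Function.update (startVal k x) p (startVal k x 1)) 1 false i) ↔
      u 1 = false := by
    intro x u
    simp [Fin.forall_fin_two]
  simp only [hA, hB, LinearMap.comp_apply, appendZero, LinearMap.coe_mk,
    AddHom.coe_mk, of_apply, conjMap_apply, mulVec_single_one_apply]
  rw [show (Fin.last 1 : Fin 2) = 1 from rfl]
  by_cases h1 : y 1 = false ∧ y' 1 = false
  · rw [if_pos h1]
    simp only [h1, and_self, and_true, dropLast, LinearMap.coe_mk, AddHom.coe_mk, of_apply,
      sum_bits_succ (n := 1)]
    refine Finset.sum_congr rfl fun x _ => ?_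
    rw [Finset.sum_comm]
    refine Finset.sum_congr rfl fun x' _ => ?_
    have e1 : ∀ (u : Bits 1) (s : Bool), (Fin.snoc u s : Bits 2) 1 = s := fun u s => by
      exact Fin.snoc_last (α := fun _ => Bool) _ _
    have e0 : ∀ (u : Bits 1) (s : Bool), (Fin.snoc u s : Bits 2) ⟨0, Nat.two_pos⟩ = u 0 :=
      fun u s => Fin.snoc_castSucc (α := fun _ => Bool) _ _ 0
    simp only [e1, e0, Fintype.sum_bool]
    simp [bitOp, mul_add, add_mul, Fin.init]
  · have h1' : ∀ P : Prop, ¬ (P ∧ y 1 = false ∧ y' 1 = false) := fun P h => h1 h.2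
    simp only [h1', if_false, Finset.sum_const_zero]
    exact (if_neg h1).symm

/-- The operator `U` on the first of two qubits. -/
def bitOpFirst (U : Op Bool) : Op (Bits 2) := of fun y x =>
  if y 1 = x 1 then U (y 0) (x 0) else 0

/-- Two qubits in, two qubits out, the second one being left alone. -/
theorem channel_two_two (w : ℕ) (l : List QGate) {κ : ℕ} (hw : 2 ≤ w)
    (hl : ∀ g ∈ l, g.OnZero w) (k : Bits κ) (U : Op Bool)
    (hU : ∀ x : Bits 2, word (startVal k x) l = U) :
    (QCircuit.mk w l).channel 2 2 k = conjMap (bitOpFirst U) := by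
  ext X y y'
  have hcol := fun x => unitary_mulVec_inject_nil w l Nat.two_pos (by omega) hl k x
  simp only [hU] at hcol
  rw [channel_mk_apply _ _ k Nat.two_pos hw _ _ hcol, conjMap_apply]
  refine Finset.sum_congr rfl fun x _ => Finset.sum_congr rfl fun x' _ => ?_
  have hA : ∀ x x' : Bits 2, ∀ l, 2 ≤ l → startVal k x l = startVal k x' l :=
    fun x x' l h => startVal_congr k x x' h
  have hB : ∀ (x : Bits 2) (u : Bits 2),
      (∀ i : Fin 2, i.val ≠ 0 → u i = startVal k x i) ↔ u 1 = x 1 := by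
    intro x u
    simp [Fin.forall_fin_two, ← startVal_left k x 1]
  rw [mulVec_single_one_apply, mulVec_single_one_apply]
  simp only [hB]
  by_cases h1 : y 1 = x 1 <;> by_cases h2 : y' 1 = x' 1
  · rw [if_pos ⟨fun l h _ => hA x x' l h, h1, h2⟩]; simp [bitOpFirst, h1, h2]
  all_goals (rw [if_neg fun h => by tauto]; simp [bitOpFirst, h1, h2])

end Circuits

/-! ### The key unitaries -/

section KeyUnitaries

theorem inv_sqrt_two_mul_self : ((Real.sqrt 2 : ℂ))⁻¹ * ((Real.sqrt 2 : ℂ))⁻¹ = 1 / 2 := by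
  rw [← mul_inv, ← Complex.ofReal_mul, Real.mul_self_sqrt (by norm_num)]
  norm_num

theorem hadMat_conjTranspose : hadMatᴴ = hadMat := by
  ext i j
  cases i <;> cases j <;> simp [hadMat, conjTranspose_apply]

theorem hadMat_mul_hadMat : hadMat * hadMat = 1 := by
  ext i j
  cases i <;> cases j <;> simp [hadMat, Matrix.mul_apply, inv_sqrt_two_mul_self]
  all_goals norm_num

theorem xMat_conjTranspose (b : Bool) : (xMat b)ᴴ = xMat b := by
  ext i j
  cases i <;> cases j <;> cases b <;> simp [xMat, conjTranspose_apply]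

theorem xMat_mul_xMat (b : Bool) : xMat b * xMat b = 1 := by
  ext i j
  cases i <;> cases j <;> cases b <;> simp [xMat, Matrix.mul_apply]

theorem star_exp_pi_div_four : star (Complex.exp (Real.pi * Complex.I / 4))
    = Complex.exp (-(Real.pi * Complex.I / 4)) := by
  rw [Complex.star_def, ← Complex.exp_conj]
  congr 1
  simp only [map_div₀, map_mul, Complex.conj_ofReal, Complex.conj_I, map_ofNat]
  ring

theorem tMat_conjTranspose_mul : tMatᴴ * tMat = 1 := by
  rw [tMat, diagonal_conjTranspose, diagonal_mul_diagonal, ← diagonal_one]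
  congr 1
  funext b
  cases b
  · simp
  · simp only [Pi.star_apply, if_true, star_exp_pi_div_four, ← Complex.exp_add]
    simp

/-- `T⁷ = T†`. -/
theorem tMat_pow_seven : tMat ^ 7 = tMatᴴ := by
  rw [tMat, diagonal_conjTranspose, diagonal_pow]
  congr 1
  funext b
  cases b
  · simp
  · simp only [Pi.pow_apply, Pi.star_apply, if_true, star_exp_pi_div_four, ← Complex.exp_nat_mul]
    rw [Complex.exp_eq_exp_iff_exists_int]
    exact ⟨1, by push_cast; ring⟩

/-- The inverse of a gate: `T` has order eight, the other gates are involutions. -/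
def QGate.inverse : QGate → List QGate
  | had i => [had i]
  | tgate i => List.replicate 7 (tgate i)
  | cnot i j => [cnot i j]

/-- The gates of the inverse circuit. -/
def inverseGates (l : List QGate) : List QGate := l.reverse.flatMap QGate.inverse

theorem act_conjTranspose_mul (f : ℕ → Bool) (g : QGate) : (g.act f)ᴴ * g.act f = 1 := by
  cases g with
  | had i => simp only [QGate.act, hadMat_conjTranspose, hadMat_mul_hadMat]
  | tgate i => exact tMat_conjTranspose_mul
  | cnot i j => simp only [QGate.act, xMat_conjTranspose, xMat_mul_xMat]

theorem word_inverse (f : ℕ → Bool) (g : QGate) : word f g.inverse = (g.act f)ᴴ := by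
  cases g with
  | had i => simp [QGate.inverse, word_cons, word_nil, QGate.act, hadMat_conjTranspose]
  | tgate i =>
    simp only [QGate.inverse, QGate.act, ← tMat_pow_seven, List.replicate, word_cons, word_nil,
      Matrix.one_mul, pow_succ, pow_zero]
  | cnot i j => simp [QGate.inverse, word_cons, word_nil, QGate.act, xMat_conjTranspose]

theorem word_inverseGates (f : ℕ → Bool) (l : List QGate) :
    word f (inverseGates l) = (word f l)ᴴ := by
  induction l with
  | nil => simp [inverseGates, word_nil]
  | cons g l ih =>
    rw [inverseGates, List.reverse_cons, List.flatMap_append, word_append, ← inverseGates, ih,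
      word_cons, conjTranspose_mul]
    simp [word_inverse]

theorem word_conjTranspose_mul (f : ℕ → Bool) (l : List QGate) : (word f l)ᴴ * word f l = 1 := by
  induction l with
  | nil => simp [word_nil]
  | cons g l ih =>
    rw [word_cons, conjTranspose_mul, Matrix.mul_assoc, ← Matrix.mul_assoc (word f l)ᴴ, ih,
      Matrix.one_mul, act_conjTranspose_mul]

theorem onZero_inverseGates {w : ℕ} {l : List QGate} (hl : ∀ g ∈ l, g.OnZero w) :
    ∀ g ∈ inverseGates l, g.OnZero w := by
  intro g hg
  obtain ⟨g', hg', h⟩ := List.mem_flatMap.1 hg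
  have h' := hl g' (List.mem_reverse.1 hg')
  cases g' with
  | had i => rw [List.mem_singleton.1 h]; exact h'
  | tgate i => rw [List.eq_of_mem_replicate h]; exact h'
  | cnot i j => rw [List.mem_singleton.1 h]; exact h'

/-- `T X^b T`: up to a phase, this is `diag(1, i)` for `b = 0` and `X` for `b = 1`. -/
def aMat (b : Bool) : Op Bool := tMat * xMat b * tMat

/-- The conjugate of `T X^b T` by the Hadamard matrix. -/
def bMat (b : Bool) : Op Bool := hadMat * aMat b * hadMat

/-- The unitary of the key `(x, z, t, s)`. The first two bits select a Pauli operator. Up to a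
phase, the word in `A` and `B` is a Pauli operator if `s = 1`; if `s = 0`, it permutes the three axes
of the Bloch ball cyclically, in a direction that depends on `t`. -/
def keyMat (x z t s : Bool) : Op Bool :=
  hadMat * xMat z * hadMat * xMat x * bMat t * aMat s * bMat s * bMat t

/-- The gates `T X^b T`, where `b` is the content of wire `i`. -/
def aGates (i : ℕ) : List QGate := [.tgate 0, .cnot i 0, .tgate 0]

/-- The gates `H T X^b T H`, where `b` is the content of wire `i`. -/
def bGates (i : ℕ) : List QGate := [.had 0, .tgate 0, .cnot i 0, .tgate 0, .had 0]

/-- The encryption of wire `0` with the key on the four wires from wire `o` on. -/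
def encGates (o : ℕ) : List QGate :=
  bGates (o + 2) ++ (bGates (o + 3) ++ (aGates (o + 3) ++ (bGates (o + 2) ++
    [.cnot o 0, .had 0, .cnot (o + 1) 0, .had 0])))

theorem word_encGates (f : ℕ → Bool) (o : ℕ) :
    word f (encGates o) = keyMat (f o) (f (o + 1)) (f (o + 2)) (f (o + 3)) := by
  simp only [encGates, aGates, bGates, word_append, word_cons, word_nil, QGate.act, keyMat, aMat,
    bMat, Matrix.one_mul, Matrix.mul_assoc]

theorem onZero_encGates {o w : ℕ} (ho : 0 < o) (hw : o + 3 < w) :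
    ∀ g ∈ encGates o, g.OnZero w := by
  intro g hg
  simp only [encGates, aGates, bGates, List.mem_append, List.mem_cons, List.not_mem_nil,
    or_false] at hg
  rcases hg with (rfl | rfl | rfl | rfl | rfl) | (rfl | rfl | rfl | rfl | rfl) | (rfl | rfl | rfl) |
    (rfl | rfl | rfl | rfl | rfl) | (rfl | rfl | rfl | rfl) <;>
  simp [QGate.OnZero] <;> omega

theorem keyMat_conjTranspose_mul (x z t s : Bool) :
    (keyMat x z t s)ᴴ * keyMat x z t s = 1 := by
  have h := word_conjTranspose_mul (fun i => if i = 0 then x else if i = 1 then z else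
    if i = 2 then t else s) (encGates 0)
  simpa [word_encGates] using h

end KeyUnitaries

/-! ### Averaging over the key -/

section Twirl

/-- The operator `a₀ + a₁ X + a₂ Y + a₃ Z`. -/
def pauliSum (a₀ a₁ a₂ a₃ : ℂ) : Op Bool := of fun i j =>
  match i, j with
  | false, false => a₀ + a₃
  | false, true => a₁ - Complex.I * a₂
  | true, false => a₁ + Complex.I * a₂
  | true, true => a₀ - a₃

theorem eq_pauliSum (A : Op Bool) : A = pauliSum ((A false false + A true true) / 2)
    ((A false true + A true false) / 2) (Complex.I * (A false true - A true false) / 2)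
    ((A false false - A true true) / 2) := by
  ext i j
  cases i <;> cases j <;> simp only [pauliSum, of_apply]
  · ring
  · linear_combination ((A false true - A true false) / 2) * Complex.I_mul_I
  · linear_combination (-(A false true - A true false) / 2) * Complex.I_mul_I
  · ring

/-- Conjugation of observables, `A ↦ U† A U`. -/
def pull (U A : Op Bool) : Op Bool := Uᴴ * A * U

theorem pull_mul (U V A : Op Bool) : pull (U * V) A = pull V (pull U A) := by
  simp only [pull, conjTranspose_mul, Matrix.mul_assoc]

variable (a₀ a₁ a₂ a₃ : ℂ)

theorem pull_hadMat : pull hadMat (pauliSum a₀ a₁ a₂ a₃) = pauliSum a₀ a₃ (-a₂) a₁ := by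
  have h := inv_sqrt_two_mul_self
  rw [pull, hadMat_conjTranspose]
  ext i j
  cases i <;> cases j <;> simp [hadMat, pauliSum, Matrix.mul_apply]
  · linear_combination (2 * (a₀ + a₁)) * h
  · linear_combination (2 * (a₃ + Complex.I * a₂)) * h
  · linear_combination (2 * (a₃ - Complex.I * a₂)) * h
  · linear_combination (2 * (a₀ - a₁)) * h

theorem pull_xMat_false (A : Op Bool) : pull (xMat false) A = A := by
  have h : xMat false = 1 := by
    ext i j
    cases i <;> cases j <;> simp [xMat]
  simp [pull, h]

theorem pull_xMat_true :
    pull (xMat true) (pauliSum a₀ a₁ a₂ a₃) = pauliSum a₀ a₁ (-a₂) (-a₃) := by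
  rw [pull, xMat_conjTranspose]
  ext i j
  cases i <;> cases j <;> simp [xMat, pauliSum, Matrix.mul_apply] <;> ring

theorem exp_mul_exp_pi_div_four :
    Complex.exp (Real.pi * Complex.I / 4) * Complex.exp (Real.pi * Complex.I / 4) = Complex.I := by
  rw [← Complex.exp_add, show (Real.pi * Complex.I / 4 + Real.pi * Complex.I / 4 : ℂ)
    = Real.pi / 2 * Complex.I by ring, Complex.exp_pi_div_two_mul_I]

theorem pull_aMat_false :
    pull (aMat false) (pauliSum a₀ a₁ a₂ a₃) = pauliSum a₀ a₂ (-a₁) a₃ := by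
  have h : aMat false = diagonal fun b => if b then Complex.I else 1 := by
    have h1 : xMat false = 1 := by
      ext i j
      cases i <;> cases j <;> simp [xMat]
    rw [aMat, h1, Matrix.mul_one, tMat, diagonal_mul_diagonal]
    congr 1
    funext b
    cases b <;> simp [exp_mul_exp_pi_div_four]
  rw [pull, h, diagonal_conjTranspose]
  ext i j
  cases i <;> cases j <;> simp [pauliSum, Matrix.mul_apply, diagonal_apply]
  · linear_combination (-a₂) * Complex.I_mul_I
  · linear_combination (-a₂) * Complex.I_mul_I
  · linear_combination (-(a₀ - a₃)) * Complex.I_mul_I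

theorem pull_aMat_true :
    pull (aMat true) (pauliSum a₀ a₁ a₂ a₃) = pauliSum a₀ a₁ (-a₂) (-a₃) := by
  have h : aMat true = Complex.exp (Real.pi * Complex.I / 4) • xMat true := by
    ext i j
    cases i <;> cases j <;> simp [aMat, xMat, tMat, Matrix.mul_apply, diagonal_apply]
  have h2 : star (Complex.exp (Real.pi * Complex.I / 4)) * Complex.exp (Real.pi * Complex.I / 4)
      = 1 := by
    rw [star_exp_pi_div_four, ← Complex.exp_add]; simp
  rw [← pull_xMat_true, h, pull, pull, conjTranspose_smul, Matrix.smul_mul, Matrix.smul_mul,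
    Matrix.mul_smul, smul_smul, h2, one_smul]

/-- The limit of the probability of a key with last bit `s`: the first three bits are uniform, and
`s = 0` has probability `2/3`. -/
def idealProb (s : Bool) : ℝ := if s then 1 / 24 else 1 / 12

/-- Averaging over the Pauli operators removes the cross terms; averaging over the cyclic permutations
of the axes makes the weights of `X`, `Y` and `Z` equal. -/
theorem twirl_mul (A B X : Op Bool) :
    ∑ x, ∑ z, ∑ t, ∑ s, (idealProb s : ℂ) •
        (pull (keyMat x z t s) A * X * pull (keyMat x z t s) B) =
      (A.trace * B.trace / 4) • X +
        (1 / 3 * ((A * B).trace / 2 - A.trace * B.trace / 4)) • ((2 * X.trace) • 1 - X) := by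
  rw [eq_pauliSum A, eq_pauliSum B]
  generalize (A false false + A true true) / 2 = a₀
  generalize (A false true + A true false) / 2 = a₁
  generalize Complex.I * (A false true - A true false) / 2 = a₂
  generalize (A false false - A true true) / 2 = a₃
  generalize (B false false + B true true) / 2 = b₀
  generalize (B false true + B true false) / 2 = b₁
  generalize Complex.I * (B false true - B true false) / 2 = b₂
  generalize (B false false - B true true) / 2 = b₃
  -- the four Pauli operators change the signs of two of the three components
  have key : ∀ t s, ∑ x, ∑ z, pull (keyMat x z t s) (pauliSum a₀ a₁ a₂ a₃) * X *
      pull (keyMat x z t s) (pauliSum b₀ b₁ b₂ b₃) = (4 : ℂ) •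
        if s then pauliSum 1 0 0 0 * X * pauliSum (a₀ * b₀) 0 0 0
          + pauliSum 0 1 0 0 * X * pauliSum 0 (a₁ * b₁) 0 0
          + pauliSum 0 0 1 0 * X * pauliSum 0 0 (a₂ * b₂) 0
          + pauliSum 0 0 0 1 * X * pauliSum 0 0 0 (a₃ * b₃)
        else if t then pauliSum 1 0 0 0 * X * pauliSum (a₀ * b₀) 0 0 0
          + pauliSum 0 1 0 0 * X * pauliSum 0 (a₂ * b₂) 0 0
          + pauliSum 0 0 1 0 * X * pauliSum 0 0 (a₃ * b₃) 0
          + pauliSum 0 0 0 1 * X * pauliSum 0 0 0 (a₁ * b₁)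
        else pauliSum 1 0 0 0 * X * pauliSum (a₀ * b₀) 0 0 0
          + pauliSum 0 1 0 0 * X * pauliSum 0 (a₃ * b₃) 0 0
          + pauliSum 0 0 1 0 * X * pauliSum 0 0 (a₁ * b₁) 0
          + pauliSum 0 0 0 1 * X * pauliSum 0 0 0 (a₂ * b₂) := by
    intro t s
    cases t <;> cases s <;>
    simp only [Fintype.sum_bool, keyMat, bMat, pull_mul, pull_hadMat, pull_xMat_false,
      pull_xMat_true, pull_aMat_false, pull_aMat_true] <;>
    (ext i j
     cases i <;> cases j <;> simp [pauliSum, Matrix.mul_apply] <;> ring)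
  have hsum : ∀ F : Bool → Bool → Bool → Bool → Op Bool,
      ∑ x, ∑ z, ∑ t, ∑ s, (idealProb s : ℂ) • F x z t s =
        ∑ t, ∑ s, (idealProb s : ℂ) • ∑ x, ∑ z, F x z t s := by
    intro F
    simp only [Fintype.sum_bool, smul_add]
    abel
  rw [hsum]
  simp only [key]
  ext i j
  cases i <;> cases j <;>
    simp [pauliSum, idealProb, Matrix.mul_apply, Matrix.trace] <;> ring_nf <;>
    simp only [Complex.I_sq] <;> ring

/-- The twirled map `X ↦ E_k [U_k† L(U_k X U_k†) U_k]` is a combination of the identity and the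
completely depolarizing map, for every linear map `L`. -/
theorem twirl (L : SuperOp Bool Bool) (X : Op Bool) :
    ∑ x, ∑ z, ∑ t, ∑ s, (idealProb s : ℂ) • ((keyMat x z t s)ᴴ *
        L (keyMat x z t s * X * (keyMat x z t s)ᴴ) * keyMat x z t s) =
      (∑ i, ∑ j, L (single i j 1) i j / 4) • X +
        (1 / 3 * (∑ i, (L 1) i i / 2 - ∑ i, ∑ j, L (single i j 1) i j / 4)) •
          ((2 * X.trace) • 1 - X) := by
  have hL : ∀ Y, L Y = ∑ i, ∑ j, ∑ k, ∑ l,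
      L (single k l 1) i j • (single i k 1 * Y * single l j 1) := by
    intro Y
    ext i j
    rw [superOp_apply_eq_sum L Y]
    cases i <;> cases j <;> simp [Matrix.sum_apply, single_apply] <;> ring
  have hU : ∀ x z t s, (keyMat x z t s)ᴴ * L (keyMat x z t s * X * (keyMat x z t s)ᴴ) *
      keyMat x z t s = ∑ i, ∑ j, ∑ k, ∑ l, L (single k l 1) i j •
        (pull (keyMat x z t s) (single i k 1) * X * pull (keyMat x z t s) (single l j 1)) := by
    intro x z t s
    rw [hL]
    simp only [Matrix.mul_sum, Finset.sum_mul, Matrix.mul_smul, Matrix.smul_mul, pull,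
      Matrix.mul_assoc]
  have hswap : ∀ G : Bool → Bool → Bool → Bool → Bool → Op Bool,
      ∑ x, ∑ z, ∑ t, ∑ s, ∑ i, G x z t s i = ∑ i, ∑ x, ∑ z, ∑ t, ∑ s, G x z t s i := by
    intro G
    simp only [Fintype.sum_bool]
    abel
  have hcoef : ∀ i j k l : Bool, ∑ x, ∑ z, ∑ t, ∑ s, (idealProb s : ℂ) • L (single k l 1) i j •
      (pull (keyMat x z t s) (single i k 1) * X * pull (keyMat x z t s) (single l j 1)) =
      L (single k l 1) i j • ((((if i = k then 1 else 0) * (if l = j then 1 else 0) / 4 : ℂ)) • X +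
        ((1 / 3 * ((if k = l ∧ i = j then 1 else 0) / 2 -
          (if i = k then 1 else 0) * (if l = j then 1 else 0) / 4) : ℂ)) •
          ((2 * X.trace) • (1 : Op Bool) - X)) := by
    intro i j k l
    have h1 : (single i k (1 : ℂ)).trace = if i = k then 1 else 0 := by
      cases i <;> cases k <;> simp [Matrix.trace]
    have h2 : (single l j (1 : ℂ)).trace = if l = j then 1 else 0 := by
      cases l <;> cases j <;> simp [Matrix.trace]
    have h3 : (single i k (1 : ℂ) * single l j (1 : ℂ)).trace = if k = l ∧ i = j then 1 else 0 := by
      cases i <;> cases k <;> cases l <;> cases j <;> simp [Matrix.trace]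
    rw [← h1, ← h2, ← h3, ← twirl_mul]
    simp only [Finset.smul_sum, smul_comm (L (single k l 1) i j)]
  simp only [hU, Finset.smul_sum]
  have hall : ∀ G : Bool → Bool → Bool → Bool → Bool → Bool → Bool → Bool → Op Bool,
      ∑ x, ∑ z, ∑ t, ∑ s, ∑ i, ∑ j, ∑ k, ∑ l, G i j k l x z t s =
        ∑ i, ∑ j, ∑ k, ∑ l, ∑ x, ∑ z, ∑ t, ∑ s, G i j k l x z t s := fun G =>
    (hswap _).trans <| Finset.sum_congr rfl fun i _ =>
      (hswap _).trans <| Finset.sum_congr rfl fun j _ =>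
      (hswap _).trans <| Finset.sum_congr rfl fun k _ => hswap _
  rw [hall fun i j k l x z t s => (idealProb s : ℂ) • L (single k l 1) i j •
    (pull (keyMat x z t s) (single i k 1) * X * pull (keyMat x z t s) (single l j 1))]
  simp only [hcoef]
  have h1 : (1 : Op Bool) = single false false 1 + single true true 1 := by
    ext i j
    cases i <;> cases j <;> simp
  rw [show L 1 = L (single false false 1) + L (single true true 1) by rw [← map_add, ← h1]]
  generalize (2 * X.trace) • (1 : Op Bool) - X = D
  simp only [Fintype.sum_bool, Matrix.add_apply, and_self, and_true, and_false, reduceCtorEq,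
    if_true, if_false]
  module

end Twirl

/-! ### The effective map for the ideal key distribution -/

section TwirlBits

theorem sum_bits_one {β : Type} [AddCommMonoid β] (f : Bits 1 → β) :
    ∑ y, f y = ∑ b : Bool, f fun _ => b := by
  rw [← (Equiv.funUnique (Fin 1) Bool).symm.sum_comp]
  rfl

theorem bitOp_mul (U V : Op Bool) : bitOp (U * V) = bitOp U * bitOp V := by
  ext y x
  simp [bitOp, Matrix.mul_apply, sum_bits_one]

theorem bitOp_conjTranspose (U : Op Bool) : bitOp Uᴴ = (bitOp U)ᴴ := rfl

theorem bitOp_one : bitOp 1 = 1 := by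
  ext y x
  have h : y 0 = x 0 ↔ y = x :=
    ⟨fun h => funext fun i => by rw [Subsingleton.elim i 0, h], fun h => by rw [h]⟩
  simp [bitOp, one_apply, h]

theorem bitOp_add (U V : Op Bool) : bitOp (U + V) = bitOp U + bitOp V := rfl

theorem bitOp_smul (c : ℂ) (U : Op Bool) : bitOp (c • U) = c • bitOp U := rfl

theorem bitOp_sub (U V : Op Bool) : bitOp (U - V) = bitOp U - bitOp V := rfl

theorem trace_bitOp (U : Op Bool) : (bitOp U).trace = U.trace := by
  simp [bitOp, Matrix.trace, sum_bits_one]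

theorem bitOp_sum {κ : Type} [Fintype κ] (U : κ → Op Bool) :
    bitOp (∑ k, U k) = ∑ k, bitOp (U k) := by
  ext y x
  simp [bitOp, Matrix.sum_apply]

theorem bitOp_single (i j : Bool) :
    bitOp (single i j 1) = single (fun _ => i) (fun _ => j) 1 := by
  ext y x
  have h : ∀ (b : Bool) (u : Bits 1), b = u 0 ↔ (fun _ => b) = u := fun b u =>
    ⟨fun h => funext fun l => by rw [h, Subsingleton.elim l 0], fun h => by rw [← h]⟩
  simp [bitOp, single_apply, h]

/-- The unitary of the key `k`. -/
def keyU (k : Bits 4) : Op Bool := keyMat (k 0) (k 1) (k 2) (k 3)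

theorem keyU_conjTranspose_mul (k : Bits 4) : (keyU k)ᴴ * keyU k = 1 :=
  keyMat_conjTranspose_mul _ _ _ _

theorem keyU_mul_conjTranspose (k : Bits 4) : keyU k * (keyU k)ᴴ = 1 :=
  mul_eq_one_comm.1 (keyU_conjTranspose_mul k)

theorem bitOp_keyU_conjTranspose_mul (k : Bits 4) : (bitOp (keyU k))ᴴ * bitOp (keyU k) = 1 := by
  rw [← bitOp_conjTranspose, ← bitOp_mul, keyU_conjTranspose_mul, bitOp_one]

theorem bitOp_keyU_mul_conjTranspose (k : Bits 4) : bitOp (keyU k) * (bitOp (keyU k))ᴴ = 1 := by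
  rw [← bitOp_conjTranspose, ← bitOp_mul, keyU_mul_conjTranspose, bitOp_one]

theorem sum_bits_four {β : Type} [AddCommMonoid β] (f : Bool → Bool → Bool → Bool → β) :
    ∑ k : Bits 4, f (k 0) (k 1) (k 2) (k 3) = ∑ x, ∑ z, ∑ t, ∑ s, f x z t s := by
  rw [sum_bits_cons]
  refine Finset.sum_congr rfl fun x _ => ?_
  rw [sum_bits_cons]
  refine Finset.sum_congr rfl fun z _ => ?_
  rw [sum_bits_cons]
  refine Finset.sum_congr rfl fun t _ => ?_
  rw [sum_bits_one]
  rfl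

theorem twirl_bits (L : SuperOp (Bits 1) (Bits 1)) (X : Op (Bits 1)) :
    ∑ k : Bits 4, (idealProb (k 3) : ℂ) •
        conjMap (bitOp (keyU k))ᴴ (L (conjMap (bitOp (keyU k)) X)) =
      (∑ i, ∑ j, L (single i j 1) i j / 4) • X +
        (1 / 3 * (∑ i, (L 1) i i / 2 - ∑ i, ∑ j, L (single i j 1) i j / 4)) •
          ((2 * X.trace) • 1 - X) := by
  -- the same map in the coordinates of a single bit
  let L' : SuperOp Bool Bool :=
    { toFun := fun Y => of fun i j => L (bitOp Y) (fun _ => i) (fun _ => j)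
      map_add' := fun Y Z => by ext i j; simp [bitOp_add]
      map_smul' := fun c Y => by ext i j; simp [bitOp_smul] }
  have hconst : ∀ y : Bits 1, y = fun _ => y 0 := fun y =>
    funext fun l => by rw [Subsingleton.elim l 0]
  have hL' : ∀ Y, L (bitOp Y) = bitOp (L' Y) := by
    intro Y
    ext y x
    change _ = L (bitOp Y) (fun _ => y 0) (fun _ => x 0)
    rw [← hconst, ← hconst]
  obtain ⟨X, rfl⟩ : ∃ Y, X = bitOp Y := ⟨of fun i j => X (fun _ => i) (fun _ => j), by
    ext y x
    change _ = X (fun _ => y 0) (fun _ => x 0)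
    rw [← hconst, ← hconst]⟩
  have h := congrArg bitOp (twirl L' X)
  have e1 : ∑ i, ∑ j, L (single i j 1) i j / 4 = ∑ i, ∑ j, L' (single i j 1) i j / 4 := by
    simp only [sum_bits_one]
    refine Finset.sum_congr rfl fun i _ => Finset.sum_congr rfl fun j _ => ?_
    rw [← bitOp_single, hL']; rfl
  have e2 : ∑ i, (L 1) i i / 2 = ∑ i, (L' 1) i i / 2 := by
    simp only [sum_bits_one]
    refine Finset.sum_congr rfl fun i _ => ?_
    rw [← bitOp_one, hL']; rfl
  rw [e1, e2, trace_bitOp]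
  simp only [bitOp_add, bitOp_smul, bitOp_sub, bitOp_one] at h
  rw [← h, ← sum_bits_four fun x z t s => (idealProb s : ℂ) • ((keyMat x z t s)ᴴ *
    L' (keyMat x z t s * X * (keyMat x z t s)ᴴ) * keyMat x z t s), bitOp_sum]
  refine Finset.sum_congr rfl fun k _ => ?_
  simp only [conjMap, LinearMap.coe_mk, AddHom.coe_mk, conjTranspose_conjTranspose, bitOp_smul,
    bitOp_mul, bitOp_conjTranspose, ← hL']
  rfl

variable {b b' : Type} [Fintype b] [Fintype b'] [DecidableEq b] [DecidableEq b']

/-- The part of an attack between fixed matrix entries of the side registers. -/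
def block {a c : Type} (Λ : SuperOp (a × b) (c × b')) (γ γ' : b) (β β' : b') : SuperOp a c where
  toFun X := of fun i j => Λ (X ⊗ₖ single γ γ' 1) (i, β) (j, β')
  map_add' X Y := by ext i j; simp [Matrix.add_kronecker]
  map_smul' z X := by ext i j; simp [Matrix.smul_kronecker]

omit [Fintype b'] [DecidableEq b'] in
theorem apply_eq_sum_block {a c : Type} (Λ : SuperOp (a × b) (c × b')) (Y : Op (a × b)) (i j : c)
    (β β' : b') : Λ Y (i, β) (j, β') =
      ∑ γ, ∑ γ', block Λ γ γ' β β' (of fun u v => Y (u, γ) (v, γ')) i j := by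
  have h : Y = ∑ γ, ∑ γ', (of fun u v => Y (u, γ) (v, γ')) ⊗ₖ single γ γ' 1 := by
    ext p q
    simp [Matrix.sum_apply, kroneckerMap_apply, single_apply, ite_and]
  conv_lhs => rw [h]
  simp only [map_sum, Matrix.sum_apply]
  rfl

omit [Fintype b] [Fintype b'] [DecidableEq b'] in
theorem probe_apply_single {c r : Type} [Fintype c] [Fintype r]
    (Λ : SuperOp (c × b) (c × b')) (E S : Op (c × r)) (γ γ' : b) (β β' : b') :
    probe Λ E S (single γ γ' 1) β β' = ∑ p : c × r, ∑ q : c × r,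
      E p q * block Λ γ γ' β β' (of fun u v => S (u, q.2) (v, p.2)) q.1 p.1 := rfl

omit [Fintype b'] [DecidableEq b'] in
theorem tensorMap_apply {a c : Type} (N : SuperOp a c) (M : SuperOp b b') (Z : Op (a × b)) (i j : c)
    (β β' : b') : tensorMap N M Z (i, β) (j, β') =
      ∑ γ, ∑ γ', M (single γ γ' 1) β β' * N (of fun u v => Z (u, γ) (v, γ')) i j := by
  have h : (of fun u v => (onRight a M Z) (u, β) (v, β')) =
      ∑ γ, ∑ γ', M (single γ γ' 1) β β' • (of fun u v => Z (u, γ) (v, γ')) := by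
    ext u v
    change M (of fun s t => Z (u, s) (v, t)) β β' = _
    rw [superOp_apply_eq_sum]
    simp [Matrix.sum_apply, mul_comm]
  change N (of fun u v => (onRight a M Z) (u, β) (v, β')) i j = _
  rw [h]
  simp only [map_sum, map_smul, Matrix.sum_apply, Matrix.smul_apply, smul_eq_mul]

omit [Fintype b'] [DecidableEq b'] in
/-- With the ideal key distribution, the one-qubit scheme is exactly non-malleable. -/
theorem ideal_effectiveMap (Λ : SuperOp (Bits 1 × b) (Bits 1 × b')) :
    ∑ k : Bits 4, (idealProb (k 3) : ℂ) •
        (onLeft (embedBot (Bits 1) ∘ₗ conjMap (bitOp (keyU k))ᴴ) b' ∘ₗ Λ ∘ₗ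
          onLeft (conjMap (bitOp (keyU k))) b) =
      tensorMap (embedBot (Bits 1)) (probe Λ (maxEnt (Bits 1)) (maxEnt (Bits 1))) +
        tensorMap ((4 - 1 : ℂ)⁻¹ • ((4 : ℂ) • constMap (Bits 1) (embedBot _ (maxMixed (Bits 1)))
          - embedBot (Bits 1))) (probe Λ (1 - maxEnt (Bits 1)) (maxEnt (Bits 1))) := by
  have hcard : (Fintype.card (Bits 1) : ℂ) = 2 := by simp
  refine LinearMap.ext fun Z => ?_
  ext ⟨o, β⟩ ⟨o', β'⟩
  rw [LinearMap.add_apply, Matrix.add_apply, tensorMap_apply, tensorMap_apply]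
  rcases o with _ | i
  · simp [LinearMap.sum_apply, Matrix.sum_apply, onLeft_apply, embedBot, constMap]
  rcases o' with _ | j
  · simp [LinearMap.sum_apply, Matrix.sum_apply, onLeft_apply, embedBot, constMap]
  have hleft : ∀ k, onLeft (embedBot (Bits 1) ∘ₗ conjMap (bitOp (keyU k))ᴴ) b'
      (Λ (onLeft (conjMap (bitOp (keyU k))) b Z)) (some i, β) (some j, β') =
      ∑ γ, ∑ γ', conjMap (bitOp (keyU k))ᴴ (block Λ γ γ' β β'
        (conjMap (bitOp (keyU k)) (of fun u v => Z (u, γ) (v, γ')))) i j := by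
    intro k
    change conjMap (bitOp (keyU k))ᴴ (of fun u v =>
      (Λ (onLeft (conjMap (bitOp (keyU k))) b Z)) (u, β) (v, β')) i j = _
    have h : (of fun u v => (Λ (onLeft (conjMap (bitOp (keyU k))) b Z)) (u, β) (v, β')) =
        ∑ γ, ∑ γ', block Λ γ γ' β β'
        (conjMap (bitOp (keyU k)) (of fun u v => Z (u, γ) (v, γ'))) := by
      ext u v
      simp only [Matrix.sum_apply]
      exact apply_eq_sum_block Λ _ u v β β'
    rw [h]
    simp only [map_sum, Matrix.sum_apply]
  have hmax : ∀ s t : Bits 1, (of fun u v => maxEnt (Bits 1) (u, s) (v, t)) =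
      (2⁻¹ : ℂ) • single s t 1 := by
    intro s t
    ext u v
    simp [maxEnt, single_apply, eq_comm]
  have hL : ∀ γ γ', probe Λ (maxEnt (Bits 1)) (maxEnt (Bits 1)) (single γ γ' 1) β β' =
      ∑ i, ∑ j, block Λ γ γ' β β' (single i j 1) i j / 4 := by
    intro γ γ'
    rw [probe_apply_single]
    simp only [hmax, map_smul, Matrix.smul_apply, smul_eq_mul, Fintype.sum_prod_type]
    simp [maxEnt, ite_and]
    rw [Finset.sum_comm]
    refine Finset.sum_congr rfl fun x _ => Finset.sum_congr rfl fun y _ => ?_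
    ring
  have h1 : ∀ γ γ', probe Λ 1 (maxEnt (Bits 1)) (single γ γ' 1) β β' =
      ∑ i, block Λ γ γ' β β' 1 i i / 2 := by
    intro γ γ'
    rw [probe_apply_single]
    simp only [hmax, map_smul, Matrix.smul_apply, smul_eq_mul, Fintype.sum_prod_type, one_apply]
    simp
    have hone : (1 : Op (Bits 1)) = ∑ k, single k k 1 := by
      ext u v
      simp [Matrix.sum_apply, single_apply, one_apply, ite_and]
    simp only [ite_and, Finset.sum_ite_irrel, Finset.sum_const_zero, Finset.sum_ite_eq,
      Finset.mem_univ, if_true]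
    rw [hone]
    simp only [map_sum, Matrix.sum_apply, Finset.sum_div]
    refine Finset.sum_congr rfl fun x _ => Finset.sum_congr rfl fun y _ => ?_
    ring
  have hL2 : ∀ γ γ', probe Λ (1 - maxEnt (Bits 1)) (maxEnt (Bits 1)) (single γ γ' 1) β β' =
      ∑ i, block Λ γ γ' β β' 1 i i / 2 - ∑ i, ∑ j, block Λ γ γ' β β' (single i j 1) i j / 4 := by
    intro γ γ'
    rw [← h1, ← hL, ← probe_add_sub Λ (maxEnt (Bits 1)) (maxEnt (Bits 1))]
    simp
  rw [LinearMap.sum_apply, Matrix.sum_apply]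
  simp only [LinearMap.smul_apply, LinearMap.comp_apply, Matrix.smul_apply, hleft, hL, hL2]
  have htw := fun γ γ' => congrFun (congrFun (twirl_bits (block Λ γ γ' β β')
    (of fun u v => Z (u, γ) (v, γ'))) i) j
  simp only [Matrix.sum_apply, Matrix.smul_apply, Matrix.add_apply, smul_eq_mul] at htw
  simp only [smul_eq_mul, Finset.mul_sum]
  rw [Finset.sum_comm]
  rw [← Finset.sum_add_distrib]
  refine Finset.sum_congr rfl fun γ _ => ?_
  rw [Finset.sum_comm, ← Finset.sum_add_distrib]
  refine Finset.sum_congr rfl fun γ' _ => ?_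
  rw [htw]
  generalize ∑ i, ∑ j, block Λ γ γ' β β' (single i j 1) i j / 4 = c₁
  generalize ∑ i, block Λ γ γ' β β' 1 i i / 2 = c₂
  simp [embedBot, constMap, maxMixed]
  norm_num
  ring

end TwirlBits

/-! ### Key generation -/

section KeyGeneration

/-- The result of `n` NAND gates: the `i`-th one combines the previous value with wire `i + 4`, and
the first value is the content of wire `3`. -/
def nandChain (f : ℕ → Bool) : ℕ → Bool
  | 0 => f 3
  | n + 1 => !(nandChain f n && f (n + 4))

theorem nandChain_congr {f g : ℕ → Bool} {n : ℕ} (h : ∀ i < n + 4, f i = g i) :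
    nandChain f n = nandChain g n := by
  induction n with
  | zero => exact h 3 (by omega)
  | succ n ih => rw [nandChain, nandChain, ih fun i hi => h i (by omega), h _ (by omega)]

/-- The key generation circuit. The first three bits of the key are uniformly random, and the fourth
one is the negation of a chain of `n` NAND gates on random bits, so that it is `1` with probability
close to `1/3`. The secret key is a copy of the public key. -/
def keyGenCircuit (n : ℕ) : BoolCircuit where
  randomBits := n + 4
  gates := ((List.range n).flatMap fun i => [(3, i + 4, 3)]) ++
    [(3, 3, 3), (0, 0, 4), (4, 4, 4), (1, 1, 5), (5, 5, 5), (2, 2, 6), (6, 6, 6), (3, 3, 7),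
      (7, 7, 7)]

theorem isUniform_keyGenCircuit : IsUniform BoolCircuit.code keyGenCircuit := by
  refine isUniform_of_loop _ _ 4 4 [3] [3] [3, 3, 3, 0, 0, 4, 4, 4, 4, 1, 1, 5, 5, 5, 5, 2, 2, 6,
    6, 6, 6, 3, 3, 7, 7, 7, 7] fun n => ?_
  simp [BoolCircuit.code, keyGenCircuit, List.flatMap_append, List.flatMap_assoc]

theorem foldl_nandChain (f : ℕ → Bool) (n : ℕ) :
    ((List.range n).flatMap fun i => [(3, i + 4, 3)]).foldl
        (fun s (g : ℕ × ℕ × ℕ) => Function.update s g.2.2 (!(s g.1 && s g.2.1))) f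
      = Function.update f 3 (nandChain f n) := by
  induction n with
  | zero => simp [nandChain]
  | succ n ih =>
    rw [List.range_succ, List.flatMap_append, List.foldl_append, ih]
    simp [nandChain]

/-- The key computed from the random bits `ω`. -/
def keyOf (n : ℕ) (ω : Bits (n + 4)) : Bits 4 :=
  ![wire ω 0, wire ω 1, wire ω 2, !nandChain (wire ω) n]

theorem eval_keyGenCircuit (n : ℕ) (ω : Bits (n + 4)) :
    (keyGenCircuit n).eval 8 (Fin.elim0 : Bits 0) ω = Fin.append (keyOf n ω) (keyOf n ω) := by
  have hstart : (fun i => if h : i < 0 + (keyGenCircuit n).randomBits then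
      Fin.append (Fin.elim0 : Bits 0) ω ⟨i, h⟩ else false) = wire ω := by
    funext i
    by_cases h : i < n + 4
    · have h' : i < 0 + (keyGenCircuit n).randomBits := by simpa [keyGenCircuit] using h
      rw [dif_pos h', wire, dif_pos h]
      have := Fin.append_right (Fin.elim0 : Bits 0) ω ⟨i, h⟩
      rw [← this]
      congr 1
      ext
      simp
    · have h' : ¬ i < 0 + (keyGenCircuit n).randomBits := by simpa [keyGenCircuit] using h
      rw [dif_neg h', wire, dif_neg h]
  have heval : (keyGenCircuit n).eval 8 (Fin.elim0 : Bits 0) ω = fun i : Fin 8 =>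
      (keyGenCircuit n).gates.foldl
        (fun s g => Function.update s g.2.2 (!(s g.1 && s g.2.1))) (wire ω) i := by
    rw [← hstart]
    rfl
  rw [heval, show (keyGenCircuit n).gates = _ ++ _ from rfl, List.foldl_append, foldl_nandChain]
  funext i
  fin_cases i <;> simp [keyOf, Fin.append, Fin.addCases]

theorem wire_snoc_of_lt {m : ℕ} (ω : Bits m) (b : Bool) {i : ℕ} (hi : i < m) :
    wire (Fin.snoc ω b : Bits (m + 1)) i = wire ω i := by
  rw [wire, wire, dif_pos (by omega), dif_pos hi]
  exact Fin.snoc_castSucc (α := fun _ => Bool) b ω ⟨i, hi⟩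

theorem wire_snoc_last {m : ℕ} (ω : Bits m) (b : Bool) :
    wire (Fin.snoc ω b : Bits (m + 1)) m = b := by
  rw [wire, dif_pos (by omega)]
  exact Fin.snoc_last (α := fun _ => Bool) b ω

/-- The number of random strings that lead to a given key. -/
theorem sum_nandChain_eq (n : ℕ) (x z t s : Bool) :
    ∑ ω : Bits (n + 4), (if wire ω 0 = x ∧ wire ω 1 = z ∧ wire ω 2 = t ∧ nandChain (wire ω) n = s
      then (1 : ℝ) else 0) = if s then (2 ^ (n + 2) - (-1) ^ n) / 3 else
        (2 ^ (n + 1) + (-1) ^ n) / 3 := by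
  induction n generalizing s with
  | zero =>
    have h : ∀ ω : Bits 4, (wire ω 0 = x ∧ wire ω 1 = z ∧ wire ω 2 = t ∧
        nandChain (wire ω) 0 = s) ↔ ω = ![x, z, t, s] := by
      intro ω
      rw [funext_iff]
      simp [Fin.forall_fin_succ, wire, nandChain]
    simp only [h, Finset.sum_ite_eq', Finset.mem_univ, if_true]
    cases s <;> norm_num
  | succ n ih =>
    rw [sum_bits_succ]
    have h : ∀ (ω : Bits (n + 4)) (b : Bool),
        nandChain (wire (Fin.snoc ω b : Bits (n + 4 + 1))) (n + 1) = !(nandChain (wire ω) n && b) := by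
      intro ω b
      rw [nandChain, wire_snoc_last, nandChain_congr fun i hi => wire_snoc_of_lt ω b hi]
    have h0 : 0 < n + 4 := by omega
    have h1 : 1 < n + 4 := by omega
    have h2 : 2 < n + 4 := by omega
    have hg : ∀ (ω : Bits (n + 4)), (∑ b : Bool, if wire (Fin.snoc ω b : Bits (n + 4 + 1)) 0 = x ∧
        wire (Fin.snoc ω b : Bits (n + 4 + 1)) 1 = z ∧ wire (Fin.snoc ω b : Bits (n + 4 + 1)) 2 = t ∧
        nandChain (wire (Fin.snoc ω b : Bits (n + 4 + 1))) (n + 1) = s then (1 : ℝ) else 0) =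
        (if s then 2 else 0) * (if wire ω 0 = x ∧ wire ω 1 = z ∧ wire ω 2 = t ∧
          nandChain (wire ω) n = false then (1 : ℝ) else 0) +
        (if wire ω 0 = x ∧ wire ω 1 = z ∧ wire ω 2 = t ∧
          nandChain (wire ω) n = true then (1 : ℝ) else 0) := by
      intro ω
      simp only [h, wire_snoc_of_lt _ _ h0, wire_snoc_of_lt _ _ h1, wire_snoc_of_lt _ _ h2,
        Fintype.sum_bool]
      by_cases hx : wire ω 0 = x ∧ wire ω 1 = z ∧ wire ω 2 = t
      · cases s <;> cases nandChain (wire ω) n <;> simp [hx]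
        norm_num
      · have : ∀ Q : Prop, ¬ (wire ω 0 = x ∧ wire ω 1 = z ∧ wire ω 2 = t ∧ Q) := by tauto
        simp [this]
    have := Finset.sum_congr (rfl : (Finset.univ : Finset (Bits (n + 4))) = Finset.univ)
      fun ω _ => hg ω
    refine this.trans ?_
    rw [Finset.sum_add_distrib, ← Finset.mul_sum, ih, ih]
    cases s <;> simp [pow_succ] <;> ring

/-- The weight that the actual key generation gives to a key. -/
def keyWeight (n : ℕ) (k : Bits 4) : ℝ :=
  idealProb (k 3) + (if k 3 then 1 else -1) * ((-1) ^ n * ((1 / 2) ^ n / 48))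

theorem prob_keyGenCircuit (n : ℕ) (pk sk : Bits 4) :
    (keyGenCircuit n).prob (Fin.elim0 : Bits 0) (Fin.append pk sk) =
      if pk = sk then keyWeight n pk else 0 := by
  have hev : ∀ ω : Bits (n + 4), (keyGenCircuit n).eval (4 + 4) (Fin.elim0 : Bits 0) ω =
      Fin.append pk sk ↔ (keyOf n ω = pk ∧ pk = sk) := by
    intro ω
    rw [eval_keyGenCircuit]
    constructor
    · intro h
      have h1 : keyOf n ω = pk := by
        funext i
        simpa only [Fin.append_left] using congrFun h (Fin.castAdd 4 i)
      have h2 : keyOf n ω = sk := by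
        funext i
        simpa only [Fin.append_right] using congrFun h (Fin.natAdd 4 i)
      exact ⟨h1, h1.symm.trans h2⟩
    · rintro ⟨rfl, rfl⟩
      rfl
  have hprob : (keyGenCircuit n).prob (Fin.elim0 : Bits 0) (Fin.append pk sk) =
      (∑ ω : Bits (n + 4), if (keyGenCircuit n).eval (4 + 4) (Fin.elim0 : Bits 0) ω =
        Fin.append pk sk then (1 : ℝ) else 0) / 2 ^ (n + 4) := by
    rw [BoolCircuit.prob, Finset.card_filter]
    push_cast
    rfl
  rw [hprob]
  simp only [hev]
  split_ifs with h
  · have hk : ∀ ω : Bits (n + 4), (keyOf n ω = pk ∧ pk = sk) ↔ (wire ω 0 = pk 0 ∧ wire ω 1 = pk 1 ∧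
        wire ω 2 = pk 2 ∧ nandChain (wire ω) n = !pk 3) := by
      intro ω
      rw [funext_iff]
      simp [Fin.forall_fin_succ, keyOf, h, Bool.not_eq_eq_eq_not]
    simp only [hk]
    rw [sum_nandChain_eq, keyWeight]
    have h2 : ((1 : ℝ) / 2) ^ n = 1 / 2 ^ n := by rw [div_pow, one_pow]
    rw [h2]
    cases pk 3 <;> simp [idealProb, pow_add] <;> field_simp <;> ring
  · simp [h]

end KeyGeneration

/-! ### The two schemes -/

section Schemes

theorem conjMap_comp {a b c : Type} [Fintype a] [Fintype b] [Fintype c] (V : Matrix c b ℂ)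
    (W : Matrix b a ℂ) : conjMap V ∘ₗ conjMap W = conjMap (V * W) := by
  ext1 X
  simp [conjMap, Matrix.mul_assoc, conjTranspose_mul]

theorem conjMap_one {a : Type} [Fintype a] [DecidableEq a] :
    conjMap (1 : Op a) = LinearMap.id := by
  ext1 X
  simp [conjMap]

theorem dropLast_comp_appendZero (c : ℕ) : dropLast c ∘ₗ appendZero c = LinearMap.id := by
  ext X y y'
  simp [dropLast, appendZero]

theorem flagToBot_comp_appendZero (m : ℕ) :
    flagToBot m ∘ₗ appendZero m = embedBot (Bits m) := by
  ext X y y'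
  cases y <;> cases y' <;> simp [flagToBot, appendZero, embedBot]

theorem word_encGates_one (k : Bits 4) (x : Bits 1) :
    word (startVal k x) (encGates 1) = keyU k := by
  rw [word_encGates]
  have h := startVal_right k x
  exact congr (congr (congr (congrArg _ (h 0)) (h 1)) (h 2)) (h 3)

theorem word_encGates_two (k : Bits 4) (x : Bits 2) :
    word (startVal k x) (encGates 2) = keyU k := by
  rw [word_encGates]
  have h := startVal_right k x
  exact congr (congr (congr (congrArg _ (h 0)) (h 1)) (h 2)) (h 3)

theorem negligible_zero : Negligible fun _ => 0 := fun _ hp => hp.mono fun _ hn => by positivity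

theorem channel_enc (k : Bits 4) :
    (QCircuit.mk 5 (encGates 1)).channel 1 1 k = conjMap (bitOp (keyU k)) :=
  channel_one_one 5 _ (by omega) (onZero_encGates (by omega) (by omega)) k _ (word_encGates_one k)

theorem channel_dec (k : Bits 4) :
    (QCircuit.mk 6 (inverseGates (encGates 1) ++ clearOne 5)).channel 1 2 k =
      appendZero 1 ∘ₗ conjMap (bitOp (keyU k))ᴴ :=
  channel_one_two 6 5 _ (by omega) (by omega) (by omega)
    (onZero_inverseGates (onZero_encGates (by omega) (by omega))) k (keyU k)ᴴ
    fun x => by rw [word_inverseGates, word_encGates_one]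

theorem channel_enc_padded (k : Bits 4) :
    (QCircuit.mk 6 (encGates 1 ++ clearOne 5)).channel 1 2 k =
      appendZero 1 ∘ₗ conjMap (bitOp (keyU k)) :=
  channel_one_two 6 5 _ (by omega) (by omega) (by omega)
    (onZero_encGates (by omega) (by omega)) k (keyU k) (word_encGates_one k)

theorem channel_dec_padded (k : Bits 4) :
    (QCircuit.mk 7 (inverseGates (encGates 2) ++ clearOne 6)).channel 2 2 k =
      appendZero 1 ∘ₗ conjMap (bitOp (keyU k))ᴴ ∘ₗ dropLast 1 :=
  channel_two_two_clear 7 6 _ (by omega) (by omega)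
    (onZero_inverseGates (onZero_encGates (by omega) (by omega))) k (keyU k)ᴴ
    fun x => by rw [word_inverseGates, word_encGates_two]

theorem decrypt_encrypt (k : Bits 4) :
    conjMap (bitOp (keyU k))ᴴ ∘ₗ conjMap (bitOp (keyU k)) = LinearMap.id := by
  rw [conjMap_comp, bitOp_keyU_conjTranspose_mul, conjMap_one]

theorem eq_of_prob_pos {n : ℕ} {pk sk : Bits 4}
    (h : 0 < (keyGenCircuit n).prob (Fin.elim0 : Bits 0) (Fin.append pk sk)) : pk = sk := by
  by_contra hne
  rw [prob_keyGenCircuit, if_neg hne] at h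
  exact lt_irrefl _ h

/-- The scheme that encrypts one qubit by applying the unitary of the key. -/
def unitaryScheme : PKQES (fun _ => 4) (fun _ => 4) (fun _ => 1) (fun _ => 1) where
  keyGen := keyGenCircuit
  encCircuit _ := ⟨5, encGates 1⟩
  decCircuit _ := ⟨6, inverseGates (encGates 1) ++ clearOne 5⟩
  keyGen_uniform := isUniform_keyGenCircuit
  enc_uniform := isUniform_const _ _
  dec_uniform := isUniform_const _ _
  enc_fits _ := ⟨by norm_num, by norm_num⟩
  dec_fits _ := ⟨by norm_num, by norm_num⟩
  msgLen_pos _ := le_rfl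
  msgLen_le _ := le_rfl
  ctLen_le := ⟨1, fun _ => by simp⟩
  correct := by
    refine ⟨_, negligible_zero, fun n pk sk h => ?_⟩
    obtain rfl := eq_of_prob_pos h
    rw [channel_enc, channel_dec, LinearMap.comp_assoc, decrypt_encrypt, LinearMap.comp_id,
      flagToBot_comp_appendZero, sub_self]
    exact diamondNorm_zero

/-- The scheme `unitaryScheme`, with an unused qubit appended to the ciphertext. -/
def paddedScheme : PKQES (fun _ => 4) (fun _ => 4) (fun _ => 1) (fun _ => 1 + 1) where
  keyGen := keyGenCircuit
  encCircuit _ := ⟨6, encGates 1 ++ clearOne 5⟩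
  decCircuit _ := ⟨7, inverseGates (encGates 2) ++ clearOne 6⟩
  keyGen_uniform := isUniform_keyGenCircuit
  enc_uniform := isUniform_const _ _
  dec_uniform := isUniform_const _ _
  enc_fits _ := ⟨by norm_num, by norm_num⟩
  dec_fits _ := ⟨by norm_num, by norm_num⟩
  msgLen_pos _ := le_rfl
  msgLen_le _ := by norm_num
  ctLen_le := ⟨2, fun _ => by simp⟩
  correct := by
    refine ⟨_, negligible_zero, fun n pk sk h => ?_⟩
    obtain rfl := eq_of_prob_pos h
    have h1 : (appendZero 1 ∘ₗ conjMap (bitOp (keyU pk))ᴴ ∘ₗ dropLast 1) ∘ₗ appendZero 1 ∘ₗ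
        conjMap (bitOp (keyU pk)) = appendZero 1 := by
      rw [LinearMap.comp_assoc, LinearMap.comp_assoc, 
        ← LinearMap.comp_assoc _ (appendZero 1) (dropLast 1),
        dropLast_comp_appendZero, LinearMap.id_comp, decrypt_encrypt, LinearMap.comp_id]
    have h2 : flagToBot 1 ∘ₗ (QCircuit.mk 7 (inverseGates (encGates 2) ++ clearOne 6)).channel 2 2 pk
        ∘ₗ (QCircuit.mk 6 (encGates 1 ++ clearOne 5)).channel 1 2 pk = embedBot (Bits 1) := by
      rw [channel_enc_padded, channel_dec_padded, h1, flagToBot_comp_appendZero]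
    exact (congrArg diamondNorm (sub_eq_zero.2 h2)).trans_le diamondNorm_zero

theorem keyProb_unitaryScheme (n : ℕ) (pk sk : Bits 4) :
    unitaryScheme.keyProb n pk sk = if pk = sk then keyWeight n pk else 0 :=
  prob_keyGenCircuit n pk sk

theorem enc_unitaryScheme (n : ℕ) (k : Bits 4) :
    unitaryScheme.enc n k = conjMap (bitOp (keyU k)) := channel_enc k

theorem dec_unitaryScheme (n : ℕ) (k : Bits 4) :
    unitaryScheme.dec n k = embedBot (Bits 1) ∘ₗ conjMap (bitOp (keyU k))ᴴ := by
  rw [← flagToBot_comp_appendZero, LinearMap.comp_assoc, ← channel_dec]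
  rfl

theorem isPaddingOf_unitaryScheme :
    PKQES.IsPaddingOf (ctLen := fun _ => 1) paddedScheme unitaryScheme := by
  refine ⟨rfl, fun n pk => ?_, fun n sk => ?_⟩
  · rw [enc_unitaryScheme]
    exact channel_enc_padded pk
  · rw [dec_unitaryScheme, ← flagToBot_comp_appendZero, LinearMap.comp_assoc, LinearMap.comp_assoc,
      ← channel_dec_padded]
    rfl

end Schemes

/-! ### Non-malleability -/

section NonMalleability

theorem negligible_half_pow : Negligible fun n => (1 / 2) ^ n / 3 := by
  intro p hp
  have h : Filter.Tendsto (fun n : ℕ => p.eval (n : ℝ) * (1 / 2 : ℝ) ^ n) Filter.atTop (nhds 0) := by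
    have h1 : (fun n : ℕ => p.eval (n : ℝ) * (1 / 2 : ℝ) ^ n) = fun n : ℕ =>
        ∑ i ∈ Finset.range (p.natDegree + 1), p.coeff i * ((n : ℝ) ^ i * (1 / 2) ^ n) := by
      funext n
      rw [Polynomial.eval_eq_sum_range, Finset.sum_mul]
      exact Finset.sum_congr rfl fun i _ => mul_assoc _ _ _
    rw [h1, show (0 : ℝ) = ∑ i ∈ Finset.range (p.natDegree + 1), 0 by simp]
    refine tendsto_finsetSum _ fun i _ => ?_
    have h2 := (tendsto_pow_const_mul_const_pow_of_abs_lt_one i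
      (show |(1 / 2 : ℝ)| < 1 by rw [abs_of_pos] <;> norm_num)).const_mul (p.coeff i)
    rwa [mul_zero] at h2
  filter_upwards [hp, h.eventually_lt_const (show (0 : ℝ) < 3 by norm_num)] with n hn hn'
  rw [lt_div_iff₀ hn]
  linarith

theorem sum_keyWeight (n : ℕ) : ∑ k, keyWeight n k = 1 := by
  have h := sum_bits_four fun _ _ _ s =>
    idealProb s + (if s then 1 else -1) * ((-1) ^ n * ((1 / 2 : ℝ) ^ n / 48))
  refine h.trans ?_
  simp [idealProb]
  ring

theorem sum_keyProb {β : Type} [AddCommGroup β] [Module ℂ β] (n : ℕ) (F : Bits 4 → Bits 4 → β) :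
    ∑ pk, ∑ sk, (unitaryScheme.keyProb n pk sk : ℂ) • F pk sk =
      ∑ k, (keyWeight n k : ℂ) • F k k := by
  refine Finset.sum_congr rfl fun pk _ => ?_
  rw [Finset.sum_eq_single pk]
  · rw [keyProb_unitaryScheme, if_pos rfl]
  · intro sk _ h
    rw [keyProb_unitaryScheme, if_neg h.symm]
    simp
  · simp

theorem dec_maxMixed (n : ℕ) (k : Bits 4) :
    unitaryScheme.dec n k (maxMixed (Bits 1)) = embedBot (Bits 1) (maxMixed (Bits 1)) := by
  rw [dec_unitaryScheme, LinearMap.comp_apply]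
  congr 1
  simp [conjMap, maxMixed, bitOp_keyU_conjTranspose_mul]

theorem decMixed_unitaryScheme (n : ℕ) :
    unitaryScheme.decMixed n = embedBot (Bits 1) (maxMixed (Bits 1)) := by
  refine (sum_keyProb n fun _ sk => unitaryScheme.dec n sk (maxMixed (Bits 1))).trans ?_
  simp only [dec_maxMixed, ← Finset.sum_smul]
  rw [← Complex.ofReal_sum, sum_keyWeight, Complex.ofReal_one, one_smul]

/-- The effective map of an attack, for a fixed key. -/
def keyedMap {b b' : Type} (Λ : SuperOp (Bits 1 × b) (Bits 1 × b')) (k : Bits 4) :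
    SuperOp (Bits 1 × b) (Option (Bits 1) × b') :=
  onLeft (embedBot (Bits 1) ∘ₗ conjMap (bitOp (keyU k))ᴴ) b' ∘ₗ Λ ∘ₗ
    onLeft (conjMap (bitOp (keyU k))) b

theorem isCPTP_keyedMap {b b' : Type} [Fintype b] [Fintype b'] [DecidableEq b] [DecidableEq b']
    {Λ : SuperOp (Bits 1 × b) (Bits 1 × b')} (hΛ : IsCPTP Λ) (k : Bits 4) :
    IsCPTP (keyedMap Λ k) := by
  refine ⟨(isCP_embedBot.comp (isCP_conjMap _)).onLeft.comp
    (hΛ.1.comp (isCP_conjMap _).onLeft), fun X => ?_⟩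
  rw [keyedMap, LinearMap.comp_apply, LinearMap.comp_apply, trace_onLeft _ fun X => ?_, hΛ.2,
    trace_onLeft _ (trace_conjMap (bitOp_keyU_conjTranspose_mul k))]
  rw [LinearMap.comp_apply, trace_embedBot, trace_conjMap]
  rw [conjTranspose_conjTranspose, bitOp_keyU_mul_conjTranspose]

theorem effectiveMap_unitaryScheme (n : ℕ) {b b' : Type}
    (Λ : SuperOp (Bits 1 × b) (Bits 1 × b')) :
    unitaryScheme.effectiveMap n Λ = ∑ k, (keyWeight n k : ℂ) • keyedMap Λ k := by
  refine (sum_keyProb n fun pk sk => onLeft (unitaryScheme.dec n sk) b' ∘ₗ Λ ∘ₗ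
    onLeft (unitaryScheme.enc n pk) b).trans ?_
  simp only [enc_unitaryScheme, dec_unitaryScheme]
  rfl

theorem card_bits_one_sq : (Fintype.card (Bits 1) : ℂ) ^ 2 = 4 := by
  norm_num [Fintype.card_fun]

theorem simulator_unitaryScheme {b b' : Type} [Fintype b] [Fintype b'] [DecidableEq b]
    [DecidableEq b'] (n : ℕ) (Λ : SuperOp (Bits 1 × b) (Bits 1 × b')) :
    unitaryScheme.simulator n ((Fintype.card (Bits 1) : ℂ) ^ 2)
      (probe Λ (maxEnt (Bits 1)) (maxEnt (Bits 1)))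
      (probe Λ (1 - maxEnt (Bits 1)) (maxEnt (Bits 1))) =
    ∑ k, (idealProb (k 3) : ℂ) • keyedMap Λ k := by
  rw [PKQES.simulator, decMixed_unitaryScheme, card_bits_one_sq]
  exact (ideal_effectiveMap Λ).symm

/-- The effective map of an attack differs from the simulator only by the rounding error of the key
distribution. -/
theorem diamondNorm_effectiveMap_sub_simulator_le {b b' : Type} [Fintype b] [Fintype b']
    [DecidableEq b] [DecidableEq b'] (n : ℕ) {Λ : SuperOp (Bits 1 × b) (Bits 1 × b')}
    (hΛ : IsCPTP Λ) :
    diamondNorm (unitaryScheme.effectiveMap n Λ -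
      unitaryScheme.simulator n ((Fintype.card (Bits 1) : ℂ) ^ 2)
        (probe Λ (maxEnt (Bits 1)) (maxEnt (Bits 1)))
        (probe Λ (1 - maxEnt (Bits 1)) (maxEnt (Bits 1)))) ≤ (1 / 2) ^ n / 3 := by
  have h : unitaryScheme.effectiveMap n Λ -
      unitaryScheme.simulator n ((Fintype.card (Bits 1) : ℂ) ^ 2)
        (probe Λ (maxEnt (Bits 1)) (maxEnt (Bits 1)))
        (probe Λ (1 - maxEnt (Bits 1)) (maxEnt (Bits 1))) =
      ∑ k, ((keyWeight n k - idealProb (k 3) : ℝ) : ℂ) • keyedMap Λ k := by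
    rw [effectiveMap_unitaryScheme, simulator_unitaryScheme, ← Finset.sum_sub_distrib]
    refine Finset.sum_congr rfl fun k _ => ?_
    rw [Complex.ofReal_sub]
    exact (sub_smul _ _ _).symm
  rw [h]
  refine (diamondNorm_sum_smul_le _ _ (isCPTP_keyedMap hΛ)).trans (le_of_eq ?_)
  have h2 : ∀ k : Bits 4, |keyWeight n k - idealProb (k 3)| = (1 / 2) ^ n / 48 := by
    intro k
    rw [keyWeight, add_sub_cancel_left, abs_mul, abs_mul, abs_pow, abs_neg, abs_one, one_pow,
      one_mul, abs_of_pos (by positivity : (0 : ℝ) < (1 / 2) ^ n / 48)]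
    split_ifs <;> simp
  simp only [h2, Finset.sum_const, Finset.card_univ, Fintype.card_fun, Fintype.card_bool,
    Fintype.card_fin, nsmul_eq_mul]
  push_cast
  ring

theorem isNM_unitaryScheme : unitaryScheme.IsNM :=
  ⟨_, negligible_half_pow, fun n _ _ _ hΛ => diamondNorm_effectiveMap_sub_simulator_le n hΛ⟩

/-- The attack on the ciphertext without the unused qubit that corresponds to an attack on the
padded ciphertext. -/
def unpad {b b' : Type} (Λ : SuperOp (Bits (1 + 1) × b) (Bits (1 + 1) × b')) :
    SuperOp (Bits 1 × b) (Bits 1 × b') :=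
  onLeft (dropLast 1) b' ∘ₗ Λ ∘ₗ onLeft (appendZero 1) b

theorem isCPTP_unpad {b b' : Type} [Fintype b] [Fintype b'] [DecidableEq b] [DecidableEq b']
    {Λ : SuperOp (Bits (1 + 1) × b) (Bits (1 + 1) × b')} (hΛ : IsCPTP Λ) : IsCPTP (unpad Λ) := by
  refine ⟨(isCP_dropLast 1).onLeft.comp (hΛ.1.comp (isCP_appendZero 1).onLeft), fun X => ?_⟩
  rw [unpad, LinearMap.comp_apply, LinearMap.comp_apply, trace_onLeft _ (trace_dropLast 1), hΛ.2,
    trace_onLeft _ (trace_appendZero 1)]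

theorem enc_paddedScheme (n : ℕ) (k : Bits 4) :
    paddedScheme.enc n k = appendZero 1 ∘ₗ unitaryScheme.enc n k :=
  isPaddingOf_unitaryScheme.2.1 n k

theorem dec_paddedScheme (n : ℕ) (k : Bits 4) :
    paddedScheme.dec n k = unitaryScheme.dec n k ∘ₗ dropLast 1 :=
  isPaddingOf_unitaryScheme.2.2 n k

theorem effectiveMap_paddedScheme (n : ℕ) {b b' : Type}
    (Λ : SuperOp (Bits (1 + 1) × b) (Bits (1 + 1) × b')) :
    paddedScheme.effectiveMap n Λ = unitaryScheme.effectiveMap n (unpad Λ) := by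
  refine Finset.sum_congr rfl fun pk _ => Finset.sum_congr rfl fun sk _ => ?_
  rw [enc_paddedScheme, dec_paddedScheme]
  rfl

theorem dropLast_maxMixed : dropLast 1 (maxMixed (Bits (1 + 1))) = maxMixed (Bits 1) := by
  ext y y'
  by_cases h : y = y'
  · simp [dropLast, maxMixed, h]
    norm_num
  · simp [dropLast, maxMixed, h, one_apply, Fin.snoc_inj]

theorem decMixed_paddedScheme (n : ℕ) : paddedScheme.decMixed n = unitaryScheme.decMixed n := by
  refine Finset.sum_congr rfl fun pk _ => Finset.sum_congr rfl fun sk _ => ?_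
  have h : paddedScheme.dec n sk (maxMixed (Bits (1 + 1))) =
      unitaryScheme.dec n sk (maxMixed (Bits 1)) := by
    rw [dec_paddedScheme, LinearMap.comp_apply, dropLast_maxMixed]
  exact congrArg _ h

theorem simulator_paddedScheme (n : ℕ) (α : ℂ) {b b' : Type} (Λ₁ Λ₂ : SuperOp b b') :
    paddedScheme.simulator n α Λ₁ Λ₂ = unitaryScheme.simulator n α Λ₁ Λ₂ := by
  rw [PKQES.simulator, PKQES.simulator, decMixed_paddedScheme]

theorem isPNM_paddedScheme : paddedScheme.IsPNM := by
  refine ⟨_, negligible_half_pow, fun n b b' Λ hΛ => ?_⟩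
  have hΛ' := isCPTP_unpad hΛ
  obtain ⟨h1, h2, h3⟩ := probe_instrument hΛ' (maxEnt_posSemidef (a := Bits 1))
    (posSemidef_one_sub_of_mul_self_eq maxEnt_posSemidef maxEnt_mul_self) trace_maxEnt
  refine ⟨_, _, h1, h2, h3, ?_⟩
  rw [simulator_paddedScheme]
  have h := diamondNorm_effectiveMap_sub_simulator_le n hΛ'
  rw [← effectiveMap_paddedScheme] at h
  exact h

end NonMalleability

/-! ### The attack on the unused qubit -/

section FlipAttack

variable {a a' b b' : Type} [Fintype a] [Fintype a'] [Fintype b] [Fintype b']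
  [DecidableEq a] [DecidableEq a'] [DecidableEq b] [DecidableEq b']

theorem isDensity_single (i : a) : IsDensity (single i i (1 : ℂ)) := by
  have h : single i i (1 : ℂ) = vecMulVec (Pi.single i 1) (star (Pi.single i 1)) := by
    ext u v
    by_cases hu : u = i <;> by_cases hv : v = i <;>
      simp [vecMulVec_apply, hu, hv, Ne.symm]
  refine ⟨?_, by simp⟩
  rw [h]
  exact posSemidef_vecMulVec_self_star _

/-- A lower bound for the diamond norm, from a basis state without entanglement. -/
theorem sum_norm_diag_le_diamondNorm (L : SuperOp a b) (i : a) :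
    ∑ o, ‖L (single i i 1) o o‖ ≤ diamondNorm L := by
  refine le_trans ?_ (traceNorm_le_diamondNorm L (isDensity_single (i, i)))
  refine le_trans ?_ (sum_norm_diag_le_traceNorm _)
  have h : ∀ o, onLeft L a (single (i, i) (i, i) 1) (o, i) (o, i) = L (single i i 1) o o := by
    intro o
    have h2 : (of fun u v => single (i, i) (i, i) (1 : ℂ) (u, i) (v, i)) = single i i 1 := by
      ext u v
      simp [single_apply]
    rw [onLeft_apply, ← h2]
  rw [Fintype.sum_prod_type]
  refine Finset.sum_le_sum fun o _ => ?_
  rw [← h]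
  exact Finset.single_le_sum (f := fun s => ‖onLeft L a (single (i, i) (i, i) 1) (o, s) (o, s)‖)
    (fun _ _ => norm_nonneg _) (Finset.mem_univ i)

omit [Fintype a] [Fintype a'] [Fintype b] [Fintype b'] [DecidableEq a'] [DecidableEq b'] in
theorem tensorMap_single (L : SuperOp a a') (N : SuperOp b b') (i : a) (j : b) (o o' : a')
    (u u' : b') :
    tensorMap L N (single (i, j) (i, j) 1) (o, u) (o', u') =
      L (single i i 1) o o' * N (single j j 1) u u' := by
  have h : ∀ p q : a, (of fun k l => single (i, j) (i, j) (1 : ℂ) (p, k) (q, l)) =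
      single i i (1 : ℂ) p q • single j j (1 : ℂ) := by
    intro p q
    ext k l
    simp only [of_apply, Matrix.smul_apply, single_apply, Prod.mk.injEq, smul_eq_mul]
    split_ifs <;> first | (exfalso; tauto) | simp
  rw [tensorMap, LinearMap.comp_apply, onLeft_apply]
  have h2 : (of fun p q => onRight a N (single (i, j) (i, j) 1) (p, u) (q, u')) =
      N (single j j 1) u u' • single i i (1 : ℂ) := by
    ext p q
    simp only [of_apply, onRight_apply, h, map_smul, Matrix.smul_apply, smul_eq_mul]
    ring
  rw [h2, map_smul, Matrix.smul_apply, smul_eq_mul, mul_comm]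

/-- Flipping the unused qubit does not change the message. -/
theorem unpad_flipAttack_apply (n : ℕ) (Z : Op (Bits 1 × Bits n)) (i j : Bits 1) (u v : Bits 0) :
    unpad (flipAttack 1 n) Z (i, u) (j, v) = ∑ β, Z (i, β) (j, β) := by
  rw [Subsingleton.elim v u]
  have h : ∀ (i : Bits 1) (b : Bool), (Fin.snoc i b : Bits (1 + 1)) 1 = b := fun i b =>
    Fin.snoc_last (α := fun _ => Bool) b i
  simp [h, unpad, onLeft_apply, flipAttack, tensorMap, onRight_apply, dropLast, flipLast, flipLastBit,
    appendZero, constMap, Matrix.trace]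

theorem keyedMap_flipAttack_apply (n : ℕ) (k : Bits 4) (Z : Op (Bits 1 × Bits n)) (i : Bits 1)
    (u : Bits 0) :
    keyedMap (unpad (flipAttack 1 n)) k Z (some i, u) (some i, u) = ∑ β, Z (i, β) (i, β) := by
  rw [keyedMap, LinearMap.comp_apply, LinearMap.comp_apply, onLeft_apply]
  simp only [unpad_flipAttack_apply, onLeft_apply]
  have h : (of fun p q => ∑ β, conjMap (bitOp (keyU k)) (of fun i j => Z (i, β) (j, β)) p q) =
      conjMap (bitOp (keyU k)) (∑ β, of fun i j => Z (i, β) (j, β)) := by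
    ext p q
    rw [map_sum, Matrix.sum_apply]
    rfl
  rw [h, LinearMap.comp_apply, ← LinearMap.comp_apply (conjMap _), decrypt_encrypt]
  simp [embedBot, Matrix.sum_apply]

theorem effectiveMap_flipAttack_single (n m : ℕ) (i j : Bits 1) (β : Bits m) (u : Bits 0) :
    paddedScheme.effectiveMap n (flipAttack 1 m) (single (i, β) (i, β) 1) (some j, u) (some j, u) =
      if i = j then 1 else 0 := by
  have h : paddedScheme.effectiveMap n (flipAttack 1 m) =
      ∑ k, (keyWeight n k : ℂ) • keyedMap (unpad (flipAttack 1 m)) k := by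
    rw [← effectiveMap_unitaryScheme]
    exact effectiveMap_paddedScheme n (flipAttack 1 m)
  rw [h]
  simp only [LinearMap.sum_apply, Matrix.sum_apply, LinearMap.smul_apply, Matrix.smul_apply,
    keyedMap_flipAttack_apply, ← Finset.sum_smul]
  rw [← Complex.ofReal_sum, sum_keyWeight]
  by_cases hij : i = j <;> simp [single_apply, hij]

omit [DecidableEq a] [DecidableEq b] in
theorem sum_norm_some_le (Y : Op (Option a × b)) (u : b) :
    ∑ j, ‖Y (some j, u) (some j, u)‖ ≤ ∑ o, ‖Y o o‖ := by
  rw [Fintype.sum_prod_type, Fintype.sum_option]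
  refine le_add_of_nonneg_of_le (Finset.sum_nonneg fun _ _ => norm_nonneg _) ?_
  exact Finset.sum_le_sum fun j _ => Finset.single_le_sum
    (f := fun u => ‖Y (some j, u) (some j, u)‖) (fun _ _ => norm_nonneg _) (Finset.mem_univ u)

theorem card_bits_two_sq : (Fintype.card (Bits (1 + 1)) : ℂ) ^ 2 = 16 := by
  norm_num [Fintype.card_fun]

/-- A simulator that identifies the attack that flips the unused qubit with the identity with small
probability `x` only is far from its effective map. -/
theorem one_lt_diamondNorm_flipAttack (n m : ℕ) (Λ₁ Λ₂ : SuperOp (Bits m) (Bits 0)) (β : Bits m)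
    (u : Bits 0) (h1 : ‖Λ₁ (single β β 1) u u‖ < 1 / 16)
    (h2 : Λ₂ (single β β 1) u u = 1 - Λ₁ (single β β 1) u u) :
    1 < diamondNorm (paddedScheme.effectiveMap n (flipAttack 1 m) -
      paddedScheme.simulator n ((Fintype.card (Bits (1 + 1)) : ℂ) ^ 2) Λ₁ Λ₂) := by
  set x := Λ₁ (single β β 1) u u with hx
  let i : Bits 1 := fun _ => false
  refine lt_of_lt_of_le ?_ (sum_norm_diag_le_diamondNorm _ (i, β))
  have hd : ∀ j : Bits 1, (paddedScheme.effectiveMap n (flipAttack 1 m) -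
      paddedScheme.simulator n ((Fintype.card (Bits (1 + 1)) : ℂ) ^ 2) Λ₁ Λ₂)
        (single (i, β) (i, β) 1) (some j, u) (some j, u) =
      (if i = j then 1 else -1) * (8 / 15 * (1 - x)) := by
    intro j
    rw [LinearMap.sub_apply, Matrix.sub_apply, effectiveMap_flipAttack_single,
      simulator_paddedScheme, PKQES.simulator, decMixed_unitaryScheme, card_bits_two_sq,
      LinearMap.add_apply, Matrix.add_apply]
    rw [show tensorMap (embedBot (Bits 1)) Λ₁ (single (i, β) (i, β) 1) (some j, u) (some j, u) = _
      from tensorMap_single _ Λ₁ i β _ _ u u]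
    rw [show tensorMap ((16 - 1 : ℂ)⁻¹ • ((16 : ℂ) • constMap (Bits 1) (embedBot (Bits 1) (maxMixed (Bits 1)))
          - embedBot (Bits 1))) Λ₂ (single (i, β) (i, β) 1) (some j, u) (some j, u) = _
      from tensorMap_single _ Λ₂ i β _ _ u u, h2, ← hx]
    by_cases hij : i = j
    · simp [embedBot, constMap, maxMixed, hij]
      ring
    · simp [embedBot, constMap, maxMixed, hij, single_apply]
      left
      ring
  have hn : 15 / 16 < ‖1 - x‖ := by
    have := norm_sub_norm_le 1 x
    rw [norm_one] at this
    linarith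
  refine lt_of_lt_of_le ?_ (sum_norm_some_le _ u)
  simp only [hd]
  have hv : ∀ j : Bits 1, ‖(if i = j then 1 else -1) * (8 / 15 * (1 - x))‖ = 8 / 15 * ‖1 - x‖ := by
    intro j
    rw [norm_mul, norm_mul]
    split_ifs <;> norm_num
  simp only [hv, Finset.sum_const, Finset.card_univ, Fintype.card_fun, Fintype.card_bool,
    Fintype.card_fin, nsmul_eq_mul]
  push_cast
  linarith

end FlipAttack

/-! ### The simulators for the attack on the unused qubit -/

section Probes

/-- Flip the last bit of the first component. -/
def flipFst {c : ℕ} {r : Type} (p : Bits (c + 1) × r) : Bits (c + 1) × r := (flipLastBit p.1, p.2)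

theorem flipFst_involutive {c : ℕ} {r : Type} :
    Function.Involutive (flipFst : Bits (c + 1) × r → Bits (c + 1) × r) := fun p => by
  simp [flipFst, flipLastBit_flipLastBit]

theorem sum_flipFst {c : ℕ} {r β : Type} [Fintype r] [AddCommMonoid β]
    (f : Bits (c + 1) × r → β) : ∑ p, f (flipFst p) = ∑ p, f p :=
  Equiv.sum_comp flipFst_involutive.toPerm f

/-- The overlap of an operator `E` with the operator `S` after the attack. -/
def flipOverlap {c : ℕ} {r : Type} [Fintype r] (E S : Op (Bits (c + 1) × r)) : ℂ :=
  ∑ p, ∑ q, E p q * S (flipFst q) (flipFst p)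

theorem probe_flipAttack_apply {c b : ℕ} {r : Type} [Fintype r] (E S : Op (Bits (c + 1) × r))
    (Y : Op (Bits b)) (u : Bits 0) :
    probe (flipAttack c b) E S Y u u = flipOverlap E S * Y.trace := by
  have h : ∀ p q : Bits (c + 1) × r, onLeft (flipAttack c b) r (attach S Y)
      ((q.1, u), q.2) ((p.1, u), p.2) = S (flipFst q) (flipFst p) * Y.trace := by
    intro p q
    simp [onLeft_apply, flipAttack, tensorMap, onRight_apply, flipLast, attach, constMap,
      Matrix.trace, Finset.mul_sum, flipFst]
  change ∑ p, ∑ q, E p q * onLeft (flipAttack c b) r (attach S Y)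
      ((q.1, u), q.2) ((p.1, u), p.2) = _
  simp only [h, flipOverlap, Finset.sum_mul, mul_assoc]

theorem flipOverlap_one {c : ℕ} {r : Type} [Fintype r] [DecidableEq r]
    (S : Op (Bits (c + 1) × r)) : flipOverlap 1 S = S.trace := by
  have h : flipOverlap 1 S = ∑ p, S (flipFst p) (flipFst p) := by
    simp [flipOverlap, one_apply]
  rw [h]
  exact sum_flipFst fun p => S p p

theorem flipOverlap_sub {c : ℕ} {r : Type} [Fintype r] (E E' S : Op (Bits (c + 1) × r)) :
    flipOverlap (E - E') S = flipOverlap E S - flipOverlap E' S := by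
  simp [flipOverlap, sub_mul]

theorem flipLastBit_ne {c : ℕ} (y : Bits (c + 1)) : flipLastBit y ≠ y := fun h => by
  have := congrFun h (Fin.last c)
  simp [flipLastBit] at this

/-- A maximally entangled state is orthogonal to the one with a flipped qubit. -/
theorem flipOverlap_maxEnt (c : ℕ) :
    flipOverlap (maxEnt (Bits (c + 1))) (maxEnt (Bits (c + 1))) = 0 := by
  refine Finset.sum_eq_zero fun p _ => Finset.sum_eq_zero fun q _ => ?_
  by_cases h : p.1 = p.2
  · have h2 : ¬ (flipFst p).1 = (flipFst p).2 := by
      rw [flipFst, ← h]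
      exact flipLastBit_ne _
    simp [maxEnt, h2]
  · simp [maxEnt, h]

/-- A pure state with small weight on the strings that end in `1` has small overlap with the state
in which the last bit is flipped. -/
theorem norm_flipOverlap_ketbra_le {c : ℕ} {r : Type} [Fintype r] (Ψ : Bits (c + 1) × r → ℂ)
    (hΨ : ∑ p, ‖Ψ p‖ ^ 2 = 1) :
    ‖flipOverlap (ketbra Ψ) (ketbra Ψ)‖ ≤
      1 / 32 + 32 * ∑ p, if p.1 (Fin.last c) = true then ‖Ψ p‖ ^ 2 else 0 := by
  have h1 : flipOverlap (ketbra Ψ) (ketbra Ψ) =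
      (∑ p, Ψ p * star (Ψ (flipFst p))) * ∑ q, star (Ψ q) * Ψ (flipFst q) := by
    rw [flipOverlap, Finset.sum_mul_sum]
    refine Finset.sum_congr rfl fun p _ => Finset.sum_congr rfl fun q _ => ?_
    simp only [ketbra, vecMulVec_apply, Pi.star_apply]
    ring
  set s := ∑ p, ‖Ψ p‖ * ‖Ψ (flipFst p)‖ with hs
  have hs0 : 0 ≤ s := Finset.sum_nonneg fun _ _ => by positivity
  have h2 : ‖flipOverlap (ketbra Ψ) (ketbra Ψ)‖ ≤ s * s := by
    rw [h1, norm_mul]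
    refine mul_le_mul ?_ ?_ (norm_nonneg _) hs0
    · refine (norm_sum_le _ _).trans (le_of_eq (Finset.sum_congr rfl fun p _ => ?_))
      rw [norm_mul, norm_star]
    · refine (norm_sum_le _ _).trans (le_of_eq (Finset.sum_congr rfl fun p _ => ?_))
      rw [norm_mul, norm_star]
  have h3 : s ≤ 1 := by
    have h : s ≤ ∑ p, (‖Ψ p‖ ^ 2 / 2 + ‖Ψ (flipFst p)‖ ^ 2 / 2) :=
      Finset.sum_le_sum fun p _ => by nlinarith [sq_nonneg (‖Ψ p‖ - ‖Ψ (flipFst p)‖)]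
    rw [Finset.sum_add_distrib, sum_flipFst fun p => ‖Ψ p‖ ^ 2 / 2, ← Finset.sum_div, hΨ] at h
    linarith
  -- One of the two strings ends in `1`: weigh the two factors with `32` and `1 / 32`.
  have h4 : s ≤ 1 / 32 + 32 * ∑ p, if p.1 (Fin.last c) = true then ‖Ψ p‖ ^ 2 else 0 := by
    let B : Bits (c + 1) × r → ℝ := fun p =>
      ‖Ψ p‖ ^ 2 / 64 + 16 * if p.1 (Fin.last c) = true then ‖Ψ p‖ ^ 2 else 0
    have h : s ≤ ∑ p, (B p + B (flipFst p)) := by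
      refine Finset.sum_le_sum fun p _ => ?_
      have hlast : (flipFst p).1 (Fin.last c) = !p.1 (Fin.last c) := by simp [flipFst, flipLastBit]
      simp only [B, hlast]
      cases p.1 (Fin.last c)
      · simp
        nlinarith [sq_nonneg (‖Ψ p‖ - 32 * ‖Ψ (flipFst p)‖), sq_nonneg ‖Ψ (flipFst p)‖]
      · simp
        nlinarith [sq_nonneg (32 * ‖Ψ p‖ - ‖Ψ (flipFst p)‖), sq_nonneg ‖Ψ p‖]
    rw [Finset.sum_add_distrib, sum_flipFst B] at h
    have hB : ∑ p, B p = 1 / 64 + 16 * ∑ p, if p.1 (Fin.last c) = true then ‖Ψ p‖ ^ 2 else 0 := by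
      rw [Finset.sum_add_distrib, ← Finset.sum_div, hΨ, Finset.mul_sum]
    linarith
  calc _ ≤ s * s := h2
    _ ≤ s * 1 := by gcongr
    _ ≤ _ := by rw [mul_one]; exact h4

theorem trace_ketbra {a : Type} [Fintype a] (v : a → ℂ) :
    (ketbra v).trace = ((∑ i, ‖v i‖ ^ 2 : ℝ) : ℂ) := by
  simp only [Matrix.trace, diag_apply, ketbra, vecMulVec_apply, Pi.star_apply, Complex.star_def,
    Complex.mul_conj', Complex.ofReal_sum, Complex.ofReal_pow]

theorem negligible_lt {ε : ℕ → ℝ} (h : Negligible ε) {c : ℝ} (hc : 0 < c) :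
    ∀ᶠ n in Filter.atTop, ε n < c := by
  have := h (Polynomial.C (1 / c)) (Filter.Eventually.of_forall fun n => by
    rw [Polynomial.eval_C]; positivity)
  simpa using this

theorem one_lt_diamondNorm_simNM (n m : ℕ) :
    1 < diamondNorm (paddedScheme.effectiveMap n (flipAttack 1 m) -
      paddedScheme.simNM n (flipAttack 1 m)) := by
  let u : Bits 0 := Fin.elim0
  have h1 : probe (flipAttack 1 m) (maxEnt (Bits (1 + 1))) (maxEnt (Bits (1 + 1)))
      (single (fun _ => false) (fun _ => false) 1) u u = 0 := by
    rw [probe_flipAttack_apply, flipOverlap_maxEnt, zero_mul]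
  refine one_lt_diamondNorm_flipAttack n m _ _ (fun _ => false) u ?_ ?_
  · rw [h1]
    norm_num
  · rw [h1, probe_flipAttack_apply, flipOverlap_sub, flipOverlap_maxEnt, flipOverlap_one,
      trace_maxEnt]
    simp

theorem not_isNM_paddedScheme : ¬ paddedScheme.IsNM := by
  rintro ⟨ε, hε, h⟩
  obtain ⟨n, hn⟩ := (negligible_lt hε one_pos).exists
  have h1 := h n 0 0 (flipAttack 1 0) (isCPTP_flipAttack 1 0)
  exact absurd (one_lt_diamondNorm_simNM n 0) (not_lt.2 (h1.trans hn.le))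

section CanonicalForms

variable {pkLen skLen msgLen ctLen : ℕ → ℕ} {S : PKQES pkLen skLen msgLen ctLen}

/-- The states `ψ_{k,r}` are pure. -/
theorem exists_encState_eq_ketbra (D : S.CanonicalForm) (n : ℕ) (pk : Bits (pkLen n))
    (sk : Bits (skLen n)) (r : Bits (ctLen n - msgLen n)) :
    ∃ Ψ, D.encState n pk sk r = ketbra Ψ ∧ ∑ p, ‖Ψ p‖ ^ 2 = 1 := by
  let s : ℂ := ((Real.sqrt (Fintype.card (Bits (msgLen n)) : ℝ) : ℝ) : ℂ)⁻¹
  have hs : s * star s = (Fintype.card (Bits (msgLen n)) : ℂ)⁻¹ := by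
    simp only [s, Complex.star_def, map_inv₀, Complex.conj_ofReal]
    rw [← mul_inv, ← Complex.ofReal_mul, Real.mul_self_sqrt (Nat.cast_nonneg _)]
    simp
  let Ψ : Bits (ctLen n) × Bits (msgLen n) → ℂ := fun p =>
    s * ∑ t, D.V n pk sk p.1 (p.2, t) * D.ψ n pk sk r t
  have h : D.encState n pk sk r = ketbra Ψ := by
    ext p q
    rw [PKQES.CanonicalForm.encState, onLeft_apply, LinearMap.comp_apply, conjMap_apply]
    simp only [ketbra, vecMulVec_apply, Pi.star_apply, Ψ, star_mul', star_sum, Fintype.sum_prod_type,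
      tensorState, maxEnt, LinearMap.coe_mk, AddHom.coe_mk, kroneckerMap_apply, of_apply]
    rw [mul_mul_mul_comm, hs, Finset.sum_mul_sum]
    simp only [ite_and, ite_mul, mul_ite, zero_mul,
      mul_zero, Finset.sum_ite_irrel, Finset.sum_const_zero, Finset.sum_ite_eq', Finset.mem_univ,
      if_true]
    simp only [Finset.mul_sum]
    refine Finset.sum_congr rfl fun t _ => Finset.sum_congr rfl fun t' _ => ?_
    ring
  refine ⟨Ψ, h, ?_⟩
  have htr : (D.encState n pk sk r).trace = 1 := by
    rw [PKQES.CanonicalForm.encState, trace_onLeft _ fun X => ?_, trace_maxEnt]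
    rw [LinearMap.comp_apply, trace_conjMap (D.V_isometry n pk sk)]
    change (X ⊗ₖ ketbra (D.ψ n pk sk r)).trace = X.trace
    rw [trace_kronecker]
    rw [trace_ketbra, D.ψ_unit, Complex.ofReal_one, mul_one]
  rw [h, trace_ketbra] at htr
  exact_mod_cast htr

end CanonicalForms

variable (D : paddedScheme.CanonicalForm)

theorem norm_flipOverlap_encState_le (n : ℕ) (pk sk : Bits 4) (r : Bits (1 + 1 - 1)) :
    ‖flipOverlap (c := 1) (D.encState n pk sk r) (D.encState n pk sk r)‖ ≤
      1 / 32 + 32 * ∑ q : Bits (1 + 1) × Bits 1,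
        if q.1 (Fin.last 1) = true then (D.encState n pk sk r q q).re else 0 := by
  obtain ⟨Ψ, h, hΨ⟩ := exists_encState_eq_ketbra D n pk sk r
  rw [h]
  refine (norm_flipOverlap_ketbra_le (c := 1) Ψ hΨ).trans (le_of_eq ?_)
  have h2 : ∀ q, (ketbra Ψ q q).re = ‖Ψ q‖ ^ 2 := by
    intro q
    rw [ketbra, vecMulVec_apply, Pi.star_apply, Complex.star_def, Complex.mul_conj',
      ← Complex.ofReal_pow, Complex.ofReal_re]
  simp only [h2]

/-- Since ciphertexts end in `0`, so do the states `ψ_{k,r}`, up to the error of the canonical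
form. -/
theorem sum_weight_le (n : ℕ) (pk sk : Bits 4) (hk : 0 < paddedScheme.keyProb n pk sk) :
    ∑ r, D.p n pk sk r * ∑ q : Bits (1 + 1) × Bits 1,
      (if q.1 (Fin.last 1) = true then (D.encState n pk sk r q q).re else 0) ≤ D.err n := by
  have h1 := (traceNorm_le_diamondNorm _ (isDensity_maxEnt (a := Bits 1))).trans
    (D.sample_close n pk sk hk)
  refine le_trans ?_ ((sum_norm_diag_le_traceNorm _).trans h1)
  simp only [Finset.mul_sum]
  rw [Finset.sum_comm]
  refine Finset.sum_le_sum fun q _ => ?_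
  by_cases hq : q.1 (Fin.last 1) = true
  · have henc : onLeft (paddedScheme.enc n pk) (Bits 1) (maxEnt (Bits 1)) q q = 0 := by
      rw [enc_paddedScheme, onLeft_apply, LinearMap.comp_apply]
      refine if_neg fun h => ?_
      rw [hq] at h
      exact absurd h.1 (by decide)
    have hsum : onLeft (paddedScheme.enc n pk - ∑ r, (D.p n pk sk r : ℂ) •
        (conjMap (D.V n pk sk) ∘ₗ tensorState (Bits 1) (ketbra (D.ψ n pk sk r)))) (Bits 1)
        (maxEnt (Bits 1)) q q = - ∑ r, (D.p n pk sk r : ℂ) * D.encState n pk sk r q q := by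
      rw [onLeft_apply, LinearMap.sub_apply, Matrix.sub_apply, ← onLeft_apply, henc, zero_sub,
        LinearMap.sum_apply, Matrix.sum_apply]
      rfl
    refine le_trans (le_of_eq ?_)
      ((neg_le_abs _).trans ((Complex.abs_re_le_norm _).trans (congrArg norm hsum.symm).le))
    simp only [if_pos hq, Complex.neg_re, neg_neg, Complex.re_sum, Complex.re_ofReal_mul]
  · simp only [if_neg hq, mul_zero, Finset.sum_const_zero]
    exact norm_nonneg _

theorem keyProb_paddedScheme (n : ℕ) (pk sk : Bits 4) :
    paddedScheme.keyProb n pk sk = unitaryScheme.keyProb n pk sk := rfl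

theorem keyProb_nonneg (n : ℕ) (pk sk : Bits 4) : 0 ≤ paddedScheme.keyProb n pk sk :=
  div_nonneg (Nat.cast_nonneg _) (by positivity)

theorem sum_keyProb_eq_one (n : ℕ) :
    ∑ pk : Bits 4, ∑ sk : Bits 4, paddedScheme.keyProb n pk sk = 1 := by
  have h := sum_keyProb n fun _ _ => (1 : ℂ)
  simp only [smul_eq_mul, mul_one] at h
  rw [← Complex.ofReal_sum, sum_keyWeight] at h
  exact_mod_cast h

theorem one_lt_diamondNorm_simCiNM (n m : ℕ) (hn : D.err n < 1 / 1024) :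
    1 < diamondNorm (paddedScheme.effectiveMap n (flipAttack 1 m) -
      D.simCiNM n (flipAttack 1 m)) := by
  let u : Bits 0 := Fin.elim0
  let β : Bits m := fun _ => false
  let E : Bits 4 → Bits 4 → Bits (1 + 1 - 1) → Op (Bits (1 + 1) × Bits 1) := D.encState n
  let w : Bits 4 → Bits 4 → Bits (1 + 1 - 1) → ℝ := fun pk sk r =>
    paddedScheme.keyProb n pk sk * D.p n pk sk r
  have hw0 : ∀ pk sk r, 0 ≤ w pk sk r := fun pk sk r =>
    mul_nonneg (keyProb_nonneg n pk sk) (D.p_nonneg n pk sk r)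
  have hw1 : ∑ pk, ∑ sk, ∑ r, w pk sk r = 1 := by
    have h : ∀ pk sk, ∑ r, w pk sk r = paddedScheme.keyProb n pk sk := fun pk sk => by
      rw [← Finset.mul_sum]
      exact (congrArg _ (D.p_sum n pk sk)).trans (mul_one _)
    simp only [h]
    exact sum_keyProb_eq_one n
  have happ : ∀ F : Bits 4 → Bits 4 → Bits (1 + 1 - 1) → Op (Bits (1 + 1) × Bits 1),
      (∑ pk, ∑ sk, ∑ r, (w pk sk r : ℂ) • probe (flipAttack 1 m) (F pk sk r) (E pk sk r))
        (single β β 1) u u = ∑ pk, ∑ sk, ∑ r, w pk sk r * flipOverlap (F pk sk r) (E pk sk r) := by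
    intro F
    simp only [LinearMap.sum_apply, Matrix.sum_apply, LinearMap.smul_apply, Matrix.smul_apply,
      probe_flipAttack_apply, trace_single_eq_same, mul_one, smul_eq_mul]
  have hle : ‖∑ pk, ∑ sk, ∑ r, w pk sk r * flipOverlap (E pk sk r) (E pk sk r)‖ < 1 / 16 := by
    have h1 : ‖∑ pk, ∑ sk, ∑ r, w pk sk r * flipOverlap (E pk sk r) (E pk sk r)‖ ≤
        ∑ pk, ∑ sk, paddedScheme.keyProb n pk sk * (1 / 32 + 32 * D.err n) := by
      refine norm_sum_le_of_le _ fun pk _ => norm_sum_le_of_le _ fun sk _ => ?_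
      rcases (keyProb_nonneg n pk sk).eq_or_lt with h0 | h0
      · simp [w, ← h0]
      refine (norm_sum_le _ _).trans ?_
      have h2 : ∀ r, ‖w pk sk r * flipOverlap (E pk sk r) (E pk sk r)‖ ≤
          paddedScheme.keyProb n pk sk * (D.p n pk sk r * (1 / 32) + 32 * (D.p n pk sk r *
            ∑ q : Bits (1 + 1) × Bits 1, if q.1 (Fin.last 1) = true then (E pk sk r q q).re
              else 0)) := by
        intro r
        rw [norm_mul, Complex.norm_real, Real.norm_of_nonneg (hw0 pk sk r)]
        refine (mul_le_mul_of_nonneg_left (norm_flipOverlap_encState_le D n pk sk r)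
          (hw0 pk sk r)).trans (le_of_eq ?_)
        simp only [w, E]
        ring
      refine (Finset.sum_le_sum fun r _ => h2 r).trans ?_
      rw [← Finset.mul_sum, Finset.sum_add_distrib, ← Finset.sum_mul, ← Finset.mul_sum]
      refine mul_le_mul_of_nonneg_left ?_ h0.le
      have h3 : ∑ r, D.p n pk sk r = 1 := D.p_sum n pk sk
      have h4 := sum_weight_le D n pk sk h0
      rw [h3, one_mul]
      exact add_le_add le_rfl (mul_le_mul_of_nonneg_left h4 (by norm_num))
    simp only [← Finset.sum_mul] at h1
    rw [sum_keyProb_eq_one] at h1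
    linarith
  have hsub : ∀ pk sk r, flipOverlap (1 - E pk sk r) (E pk sk r) =
      1 - flipOverlap (E pk sk r) (E pk sk r) := by
    intro pk sk r
    obtain ⟨Ψ, h, hΨ⟩ := exists_encState_eq_ketbra D n pk sk r
    have h2 : E pk sk r = ketbra Ψ := h
    rw [flipOverlap_sub, flipOverlap_one, h2, trace_ketbra]
    rw [show (∑ p : Bits (1 + 1) × Bits 1, ‖Ψ p‖ ^ 2 : ℝ) = 1 from hΨ, Complex.ofReal_one]
  have hsim : D.simCiNM n (flipAttack 1 m) =
      paddedScheme.simulator n ((Fintype.card (Bits (1 + 1)) : ℂ) ^ 2)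
        (∑ pk, ∑ sk, ∑ r, (w pk sk r : ℂ) • probe (flipAttack 1 m) (E pk sk r) (E pk sk r))
        (∑ pk, ∑ sk, ∑ r, (w pk sk r : ℂ) • probe (flipAttack 1 m) (1 - E pk sk r) (E pk sk r)) := by
    rw [PKQES.CanonicalForm.simCiNM]
  rw [hsim]
  refine one_lt_diamondNorm_flipAttack n m _ _ β u ?_ ?_
  · rw [happ]
    exact hle
  · rw [happ, happ]
    simp only [hsub, mul_sub, mul_one, Finset.sum_sub_distrib]
    congr 1
    exact_mod_cast hw1

theorem eventually_one_lt_simCiNM : ∀ᶠ n in Filter.atTop, ∀ m : ℕ,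
    1 < diamondNorm (paddedScheme.effectiveMap n (flipAttack 1 m) -
      D.simCiNM n (flipAttack 1 m)) :=
  (negligible_lt D.err_negl (by norm_num : (0 : ℝ) < 1 / 1024)).mono fun n hn m =>
    one_lt_diamondNorm_simCiNM D n m hn

theorem not_isCiNM_paddedScheme : ¬ D.IsCiNM := by
  rintro ⟨ε, hε, h⟩
  obtain ⟨n, hn, hn'⟩ := ((negligible_lt hε one_pos).and (eventually_one_lt_simCiNM D)).exists
  have h1 := h n 0 0 (flipAttack 1 0) (isCPTP_flipAttack 1 0)
  exact absurd (hn' 0) (not_lt.2 (h1.trans hn.le))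

end Probes

/-! ### An efficient canonical form -/

section EfficientForm

theorem bitOpFirst_conjTranspose (U : Op Bool) : (bitOpFirst U)ᴴ = bitOpFirst Uᴴ := by
  ext y x
  by_cases h : y 1 = x 1
  · simp [bitOpFirst, conjTranspose_apply, h]
  · simp [bitOpFirst, conjTranspose_apply, h, Ne.symm h]

theorem bitOpFirst_mul (U V : Op Bool) : bitOpFirst U * bitOpFirst V = bitOpFirst (U * V) := by
  ext y x
  have h : ∀ f : Bits 2 → ℂ, ∑ z, f z = ∑ b, ∑ c, f ![b, c] := by
    intro f
    rw [sum_bits_cons]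
    refine Finset.sum_congr rfl fun b _ => ?_
    rw [sum_bits_one]
    exact Finset.sum_congr rfl fun c _ => congrArg f (by ext i; fin_cases i <;> rfl)
  rw [Matrix.mul_apply, h]
  by_cases hyx : y 1 = x 1
  · simp [bitOpFirst, Matrix.mul_apply, hyx]
  · simp [bitOpFirst, hyx]

theorem bitOpFirst_one : bitOpFirst 1 = 1 := by
  ext y x
  have h : y = x ↔ y 0 = x 0 ∧ y 1 = x 1 := by rw [funext_iff, Fin.forall_fin_two]
  simp only [bitOpFirst, one_apply, of_apply, h]
  by_cases h0 : y 0 = x 0 <;> by_cases h1 : y 1 = x 1 <;> simp [h0, h1]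

/-- The unitary of the canonical form: the unitary of the key, applied to the message. -/
def keyV (k : Bits 4) : Matrix (Bits 2) (Bits 1 × Bits 1) ℂ :=
  (bitOpFirst (keyU k)).submatrix id (Fin.appendEquiv 1 1)

theorem keyV_conjTranspose_mul (k : Bits 4) : (keyV k)ᴴ * keyV k = 1 := by
  rw [keyV, conjTranspose_submatrix, bitOpFirst_conjTranspose,
    submatrix_mul _ _ _ id _ Function.bijective_id |>.symm, bitOpFirst_mul, keyU_conjTranspose_mul,
    bitOpFirst_one, submatrix_one_equiv]

theorem keyV_mul_conjTranspose (k : Bits 4) : keyV k * (keyV k)ᴴ = 1 := by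
  rw [keyV, conjTranspose_submatrix, bitOpFirst_conjTranspose, submatrix_mul_equiv, bitOpFirst_mul,
    keyU_mul_conjTranspose, bitOpFirst_one, submatrix_id_id]

theorem keyV_apply (k : Bits 4) (y : Bits 2) (m t : Bits 1) :
    keyV k y (m, t) = if y 1 = t 0 then keyU k (y 0) (m 0) else 0 := by
  rfl

/-- The projector `|0⟩⟨0|` on the unused qubit. -/
def zeroOp : Op (Bits 1) := single (fun _ => false) (fun _ => false) 1

theorem zeroOp_apply (t t' : Bits 1) :
    zeroOp t t' = if t 0 = false ∧ t' 0 = false then 1 else 0 := by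
  have h : ∀ t : Bits 1, (fun _ => false) = t ↔ t 0 = false := by
    intro t
    rw [funext_iff, Fin.forall_fin_one, eq_comm]
  simp [zeroOp, single_apply, h]

theorem conjMap_keyV_tensorState (k : Bits 4) :
    conjMap (keyV k) ∘ₗ tensorState (Bits 1) zeroOp = appendZero 1 ∘ₗ conjMap (bitOp (keyU k)) := by
  ext1 X
  ext y y'
  simp only [LinearMap.comp_apply, conjMap_apply, tensorState, appendZero, LinearMap.coe_mk,
    AddHom.coe_mk, kroneckerMap_apply, of_apply, Fintype.sum_prod_type, keyV_apply, zeroOp_apply,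
    sum_bits_one,
    bitOp]
  rw [show (Fin.last 1 : Fin 2) = 1 from rfl]
  cases h1 : y 1 <;> cases h2 : y' 1 <;> simp [Fin.init]

theorem dropLast_comp_keyV (k : Bits 4) :
    dropLast 1 ∘ₗ conjMap (keyV k) = conjMap (bitOp (keyU k)) ∘ₗ traceRight (Bits 1) (Bits 1) := by
  ext1 X
  ext y y'
  have hs : ∀ (y : Bits 1) (b : Bool), (Fin.snoc y b : Bits 2) 1 = b := fun y b =>
    Fin.snoc_last (α := fun _ => Bool) b y
  have hs0 : ∀ (y : Bits 1) (b : Bool), (Fin.snoc y b : Bits 2) 0 = y 0 := fun y b =>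
    Fin.snoc_castSucc (α := fun _ => Bool) b y 0
  simp only [LinearMap.comp_apply, conjMap_apply, traceRight, dropLast, LinearMap.coe_mk,
    AddHom.coe_mk, of_apply, Fintype.sum_prod_type, keyV_apply, sum_bits_one, bitOp, hs, hs0,
    Fintype.sum_bool]
  simp
  ring

theorem ketbra_single {a : Type} [DecidableEq a] (i : a) :
    ketbra (Pi.single i 1 : a → ℂ) = single i i 1 := by
  ext u v
  by_cases hu : u = i <;> by_cases hv : v = i <;>
    simp [ketbra, vecMulVec_apply, hu, hv, Ne.symm]

theorem enc_paddedScheme_eq (n : ℕ) (k : Bits 4) :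
    paddedScheme.enc n k = conjMap (keyV k) ∘ₗ tensorState (Bits 1) zeroOp := by
  rw [conjMap_keyV_tensorState, enc_paddedScheme, enc_unitaryScheme]

theorem dec_comp_keyV (n : ℕ) (k : Bits 4) :
    paddedScheme.dec n k ∘ₗ conjMap (keyV k) =
      embedBot (Bits 1) ∘ₗ traceRight (Bits 1) (Bits 1) := by
  rw [dec_paddedScheme, dec_unitaryScheme, LinearMap.comp_assoc, dropLast_comp_keyV,
    LinearMap.comp_assoc, ← LinearMap.comp_assoc _ (conjMap (bitOp (keyU k))), decrypt_encrypt,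
    LinearMap.id_comp]

theorem zeroOp_mul_self : zeroOp * zeroOp = zeroOp := by simp [zeroOp]

theorem eq_of_keyProb_pos {n : ℕ} {pk sk : Bits 4} (h : 0 < paddedScheme.keyProb n pk sk) :
    pk = sk := by
  by_contra hne
  rw [keyProb_paddedScheme, keyProb_unitaryScheme, if_neg hne] at h
  exact lt_irrefl _ h

theorem dec_paddedForm (n : ℕ) {pk sk : Bits 4} (h : pk = sk) :
    paddedScheme.dec n sk ∘ₗ conjMap (keyV pk) ∘ₗ onRight (Bits 1) (conjMap zeroOp) ∘ₗ
        conjMap (keyV pk)ᴴ =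
      embedBot (Bits 1) ∘ₗ traceRight (Bits 1) (Bits 1) ∘ₗ onRight (Bits 1) (conjMap zeroOp) ∘ₗ
        conjMap (keyV pk)ᴴ := by
  subst h
  rw [← LinearMap.comp_assoc, dec_comp_keyV, LinearMap.comp_assoc]

/-- The canonical form of the padded scheme; its register `T` is the unused qubit. -/
def paddedForm : paddedScheme.CanonicalForm where
  V _ pk _ := keyV pk
  σ _ _ _ := zeroOp
  P _ _ _ := zeroOp
  p _ _ _ r := if r = fun _ => false then 1 else 0
  ψ _ _ _ r := Pi.single r 1
  err _ := 0
  err_negl := negligible_zero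
  V_isometry _ pk _ := keyV_conjTranspose_mul pk
  V_coisometry _ pk _ := keyV_mul_conjTranspose pk
  σ_density _ _ _ := isDensity_single _
  P_herm _ _ _ := (isDensity_single _).1.1
  P_idem _ _ _ := zeroOp_mul_self
  p_nonneg _ _ _ r := by split_ifs <;> norm_num
  p_sum _ _ _ := by simp
  ψ_unit _ _ _ r := by
    rw [Finset.sum_eq_single r]
    · simp
    · intro x _ hx
      simp [hx]
    · simp
  enc_close n pk sk _ := by
    refine (congrArg diamondNorm (sub_eq_zero.2 ?_)).trans_le diamondNorm_zero
    exact enc_paddedScheme_eq n pk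
  dec_close n pk sk h := by
    refine (congrArg diamondNorm (sub_eq_zero.2 ?_)).trans_le diamondNorm_zero
    exact dec_paddedForm n (eq_of_keyProb_pos h)
  P_close _ _ _ _ := by
    refine (congrArg traceNorm (sub_eq_zero.2 ?_)).trans_le traceNorm_zero.le
    exact (congrArg (· * zeroOp) zeroOp_mul_self).trans zeroOp_mul_self
  sample_close n pk sk _ := by
    refine (congrArg diamondNorm (sub_eq_zero.2 ?_)).trans_le diamondNorm_zero
    refine (enc_paddedScheme_eq n pk).trans ?_
    rw [Finset.sum_eq_single (fun _ => false)]
    · rw [if_pos rfl, Complex.ofReal_one, one_smul, ketbra_single]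
      rfl
    · intro r _ hr
      rw [if_neg hr, Complex.ofReal_zero, zero_smul]
    · simp

/-- A CNOT whose control is wire `0`, in a basis state. -/
theorem cnot_zero_mulVec_prodState {w j : ℕ} (hj : j ≠ 0) (hw : 0 < w) (c : Bool)
    (f : ℕ → Bool) :
    (QGate.cnot 0 j).matrix w *ᵥ prodState w (Pi.single c 1) f
      = prodState w (Pi.single c 1) (Function.update f j (xor (f j) c)) := by
  set φ : Bits w → Bits w := fun x l => if l.val = j ∧ 0 ≠ j then xor (x l) (wire x 0) else x l
    with hφ
  have h0 : ∀ x, wire (φ x) 0 = wire x 0 := fun x => by simp [wire, hφ, hj.symm, hw]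
  have hinv : ∀ x, φ (φ x) = x := by
    intro x
    funext l
    by_cases hl : l.val = j
    · have h1 : φ x l = xor (x l) (wire x 0) := by simp [hφ, hl, hj.symm]
      have h2 : φ (φ x) l = xor (φ x l) (wire (φ x) 0) := by simp [hφ, hl, hj.symm]
      rw [h2, h1, h0]; simp
    · simp [hφ, hl]
  ext y
  have h1 : ∀ x, y = φ x ↔ x = φ y := fun x =>
    ⟨fun h => by rw [h, hinv], fun h => by rw [h, hinv]⟩
  simp only [mulVec, dotProduct, QGate.matrix, of_apply]
  change ∑ x, (if y = φ x then 1 else 0) * prodState w (Pi.single c 1) f x = _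
  simp only [h1]
  rw [Finset.sum_eq_single (φ y) (by intro x _ hx; simp [hx]) (by simp)]
  simp only [prodState, h0, if_true, one_mul]
  by_cases hc : wire y 0 = c
  · have hcond : (∀ l : Fin w, l.val ≠ 0 → φ y l = f l) ↔
        ∀ l : Fin w, l.val ≠ 0 → y l = Function.update f j (xor (f j) c) l := by
      refine forall_congr' fun l => imp_congr_right fun _ => ?_
      by_cases hlj : l.val = j
      · simp only [hφ, hlj, Function.update_self, hc, ne_eq, hj.symm, not_false_eq_true, and_self,
          if_true]
        cases y l <;> cases f j <;> cases c <;> simp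
      · simp [hφ, hlj]
    simp only [hcond]
  · simp [hc]

/-- The measurement `{|0⟩⟨0|, |1⟩⟨1|}` of wire `0`, with the outcome written to wire `1`. -/
def measureGates : List QGate := clearOne 9 ++ [.cnot 0 10, .cnot 0 1]

theorem unitary_measureGates (k : Bits 8) (x : Bits 1) :
    (QCircuit.mk 11 measureGates).unitary *ᵥ
        (fun z => (QCircuit.mk 11 measureGates).inject 1 k z x) =
      prodState 11 (Pi.single (x 0) 1) (Function.update (Function.update (Function.update
        (Function.update (startVal k x) 9 (startVal k x 1)) 1 false) 10 (x 0)) 1 (x 0)) := by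
  have h9 : startVal k x 9 = false := by rw [startVal, dif_neg (by omega)]
  have h10 : startVal k x 10 = false := by rw [startVal, dif_neg (by omega)]
  have h := unitary_mulVec_inject 11 [] measureGates Nat.one_pos (by omega) (by simp) k x
  rw [List.nil_append] at h
  rw [h, word_nil, one_mulVec, measureGates, List.foldl_append,
    foldl_clearOne (by omega) (by omega) _ _ h9]
  simp only [List.foldl_cons, List.foldl_nil]
  rw [show x ⟨0, Nat.one_pos⟩ = x 0 from rfl,
    cnot_zero_mulVec_prodState (by omega) (by omega), cnot_zero_mulVec_prodState (by omega) (by omega)]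
  congr 2
  · simp [h10]
  · simp

theorem channel_measureGates (k : Bits 8) (X : Op (Bits 1)) (y y' : Bits 2) :
    (QCircuit.mk 11 measureGates).channel 1 2 k X y y' =
      if y 0 = y 1 ∧ y' 0 = y' 1 ∧ y 0 = y' 0 then X (fun _ => y 0) (fun _ => y 0) else 0 := by
  rw [channel_mk_apply _ _ k Nat.two_pos (by omega) _ _ (unitary_measureGates k)]
  have hA : ∀ x x' : Bits 1, (∀ l, 2 ≤ l → l < 11 →
      Function.update (Function.update (Function.update
        (Function.update (startVal k x) 9 (startVal k x 1)) 1 false) 10 (x 0)) 1 (x 0) l =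
      Function.update (Function.update (Function.update
        (Function.update (startVal k x') 9 (startVal k x' 1)) 1 false) 10 (x' 0)) 1 (x' 0) l) ↔
      x 0 = x' 0 := by
    intro x x'
    constructor
    · intro h
      simpa using h 10 (by omega) (by omega)
    · intro h l h2 _
      have h1 : l ≠ 1 := by omega
      simp only [Function.update_apply, h1, if_false, h, startVal_congr k x x' le_rfl,
        startVal_congr k x x' (show 1 ≤ l by omega)]
  have hB : ∀ (x : Bits 1) (u : Bits 2), (∀ i : Fin 2, i.val ≠ 0 → u i =
      Function.update (Function.update (Function.update
        (Function.update (startVal k x) 9 (startVal k x 1)) 1 false) 10 (x 0)) 1 (x 0) i) ↔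
      u 1 = x 0 := by
    intro x u
    simp [Fin.forall_fin_two]
  simp only [hA, hB, sum_bits_one, Fintype.sum_bool]
  rw [show y ⟨0, Nat.two_pos⟩ = y 0 from rfl, show y' ⟨0, Nat.two_pos⟩ = y' 0 from rfl]
  cases h0 : y 0 <;> cases h1 : y 1 <;> cases h2 : y' 0 <;> cases h3 : y' 1 <;> simp

/-- The circuit that outputs the bit `0`, on an input of eight bits. -/
def zeroCircuit : BoolCircuit := ⟨0, [(8, 8, 9), (9, 9, 0)]⟩

theorem prob_zeroCircuit (k : Bits 8) (r : Bits 1) :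
    zeroCircuit.prob k r = if r = fun _ => false then 1 else 0 := by
  have h : ∀ ω : Bits zeroCircuit.randomBits, zeroCircuit.eval 1 k ω = fun _ => false := by
    intro ω
    funext i
    rw [Subsingleton.elim i 0]
    simp [BoolCircuit.eval, zeroCircuit]
  rw [BoolCircuit.prob]
  simp only [h, eq_comm]
  split_ifs with hr
  · have hcard : (Finset.univ : Finset (Bits zeroCircuit.randomBits)).card = 1 := rfl
    simp only [hr, Finset.filter_true, hcard]
    norm_num [zeroCircuit]
  · simp [hr]

theorem word_encGates_two_append (pk sk : Bits 4) (x : Bits 2) :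
    word (startVal (Fin.append pk sk) x) (encGates 2) = keyU pk := by
  rw [word_encGates]
  have h : ∀ i : Fin 4, startVal (Fin.append pk sk) x (2 + i) = pk i := fun i =>
    (startVal_right (Fin.append pk sk) x (Fin.castAdd 4 i)).trans (Fin.append_left pk sk i)
  exact congr (congr (congr (congrArg _ (h 0)) (h 1)) (h 2)) (h 3)

theorem conjMap_submatrix {a b c : Type} [Fintype a] [Fintype c] (V : Matrix b a ℂ) (e : c ≃ a)
    (X : Op c) : conjMap (V.submatrix id e) X = conjMap V (reindex e e X) := by
  ext y y'
  rw [conjMap_apply, conjMap_apply, ← e.sum_comp]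
  refine Finset.sum_congr rfl fun x _ => ?_
  rw [← e.sum_comp]
  simp

theorem reindex_conjMap_submatrix {a b c : Type} [Fintype a] (V : Matrix b a ℂ) (e : c ≃ b)
    (X : Op a) : reindex e e (conjMap (V.submatrix e id) X) = conjMap V X := by
  ext y y'
  simp [conjMap_apply]

theorem channel_prepare (k : Bits 8) (X : Op (Bits 1)) : (QCircuit.mk 9 []).channel 1 1 k X = X := by
  rw [channel_one_one 9 [] (by omega) (by simp) k 1 fun x => word_nil _, bitOp_one, conjMap_one]
  rfl

theorem channel_apply_keyV (pk sk : Bits 4) (X : Op (Bits 1 × Bits 1)) :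
    (QCircuit.mk 10 (encGates 2)).channel 2 2 (Fin.append pk sk)
      (reindex (Fin.appendEquiv 1 1) (Fin.appendEquiv 1 1) X) = conjMap (keyV pk) X := by
  rw [channel_two_two 10 _ (by omega) (onZero_encGates (by omega) (by omega)) (Fin.append pk sk)
    (keyU pk) (word_encGates_two_append pk sk)]
  exact (conjMap_submatrix _ _ X).symm

theorem channel_unapply_keyV (pk sk : Bits 4) (Y : Op (Bits 2)) :
    (QCircuit.mk 10 (inverseGates (encGates 2))).channel 2 2 (Fin.append pk sk) Y =
      reindex (Fin.appendEquiv 1 1) (Fin.appendEquiv 1 1) (conjMap (keyV pk)ᴴ Y) := by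
  rw [channel_two_two 10 _ (by omega) (onZero_inverseGates (onZero_encGates (by omega) (by omega)))
    (Fin.append pk sk) (keyU pk)ᴴ fun x => by rw [word_inverseGates, word_encGates_two_append],
    ← bitOpFirst_conjTranspose]
  exact (reindex_conjMap_submatrix _ _ Y).symm

theorem channel_measure (k : Bits 8) (X : Op (Bits 1)) :
    (QCircuit.mk 11 measureGates).channel 1 2 k X = of fun y y' : Bits (1 + 1) =>
      if y (Fin.last 1) = false ∧ y' (Fin.last 1) = false then
        conjMap zeroOp X (Fin.init y) (Fin.init y')
      else if y (Fin.last 1) = true ∧ y' (Fin.last 1) = true then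
        conjMap (1 - zeroOp) X (Fin.init y) (Fin.init y')
      else 0 := by
  ext y y'
  have hone : ∀ t t' : Bits 1, (1 : Op (Bits 1)) t t' = if t 0 = t' 0 then 1 else 0 := by
    intro t t'
    rw [one_apply]
    simp only [funext_iff, Fin.forall_fin_one]
  rw [channel_measureGates]
  simp only [of_apply, conjMap_apply, Matrix.sub_apply, zeroOp_apply, hone, sum_bits_one, Fintype.sum_bool]
  rw [show (Fin.last 1 : Fin 2) = 1 from rfl]
  have hi : ∀ y : Bits 2, (Fin.init y : Bits 1) 0 = y 0 := fun _ => rfl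
  simp only [hi]
  cases h0 : y 0 <;> cases h1 : y 1 <;> cases h2 : y' 0 <;> cases h3 : y' 1 <;> simp

theorem isEfficient_paddedForm : paddedForm.IsEfficient := by
  refine ⟨fun _ => zeroCircuit, fun _ => ⟨9, []⟩, fun _ => ⟨10, encGates 2⟩,
    fun _ => ⟨10, inverseGates (encGates 2)⟩, fun _ => ⟨11, measureGates⟩, isUniform_const _ _,
    isUniform_const _ _, isUniform_const _ _, isUniform_const _ _, isUniform_const _ _, fun n => ?_⟩
  exact ⟨⟨by norm_num, by norm_num⟩, ⟨by norm_num, by norm_num⟩, ⟨by norm_num, by norm_num⟩,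
    ⟨by norm_num, by norm_num⟩, fun pk sk _ => ⟨prob_zeroCircuit _,
      fun r => (channel_prepare _ _).trans (ketbra_single r).symm, channel_apply_keyV pk sk,
      channel_unapply_keyV pk sk, channel_measure _⟩⟩

end EfficientForm

end QNM

end

theorem mainTheorem7 :
    ∃ (pkLen skLen msgLen ctLen : ℕ → ℕ)
      (S' : QNM.PKQES pkLen skLen msgLen ctLen)
      (S : QNM.PKQES pkLen skLen msgLen (fun n => ctLen n + 1)),
      S'.IsNM ∧ S.IsPaddingOf S' ∧
      S.IsPNM ∧ ¬ S.IsNM ∧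
      (∃ D : S.CanonicalForm, D.IsEfficient) ∧
      (∀ D : S.CanonicalForm, ¬ D.IsCiNM) ∧
      (∀ᶠ n in Filter.atTop, ∀ b : ℕ,
        1 < QNM.diamondNorm (S.effectiveMap n (QNM.flipAttack (ctLen n) b)
          - S.simNM n (QNM.flipAttack (ctLen n) b))) ∧
      (∀ D : S.CanonicalForm, ∀ᶠ n in Filter.atTop, ∀ b : ℕ,
        1 < QNM.diamondNorm (S.effectiveMap n (QNM.flipAttack (ctLen n) b)
          - D.simCiNM n (QNM.flipAttack (ctLen n) b))) := by
  refine ⟨fun _ => 4, fun _ => 4, fun _ => 1, fun _ => 1, QNM.unitaryScheme, QNM.paddedScheme,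
    QNM.isNM_unitaryScheme, QNM.isPaddingOf_unitaryScheme, QNM.isPNM_paddedScheme,
    QNM.not_isNM_paddedScheme, ⟨QNM.paddedForm, QNM.isEfficient_paddedForm⟩,
    QNM.not_isCiNM_paddedScheme, ?_, ?_⟩
  · refine Filter.Eventually.of_forall fun n m => ?_
    convert QNM.one_lt_diamondNorm_simNM n m using 2
  · intro D
    filter_upwards [QNM.eventually_one_lt_simCiNM D] with n hn m
    convert hn m using 2
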